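/- **Setting.** Let $d\in\mathbb N$, $\mathbb S=\{1,\dots,d\}$, and let $C$ be a copula on $[0,1]^d$ (the cdf of an absolutely continuous random vector $U$ with uniform marginals), with survival copula $\overline C(u)=\mathbb P(1-U_i\le u_i\ \forall i)$ and restrictions $\overline C_J$ obtained by setting $u_i=1$ for $i\notin J$. Let $\psi_1,\dots,\psi_d$ be continuous probability densities on $(0,\infty)$ with cdfs $\Psi_i$, and $\overline\Psi_i=1-\Psi_i$. A *Comb-Bernoulli* vector with occurrence probabilities $p_i\in(0,1]$ is a random vector $X$ with $$\mathbb P(X_1\le x_1,\dots,X_d\le x_d)=C(F_1(x_1),\dots,F_d(x_d)),\qquad F_i(x)=(1-p_i)\mathbf 1_{\{x\ge0\}}+p_i\Psi_i(x)\mathbf 1_{\{x>0\}} .$$ Write $\mathcal S(x)=\{i:x_i>0\}$. The likelihood of an observation $x\in[0,\infty)^d$ with $\mathcal S(x)=I$ is $\partial^{|I|}/\prod_{i\in I}\partial x_i$ of $\mathbb P(X_i\le x_i\ \forall i\in I,\ X_j=0\ \forall j\notin I)$; the likelihood $L_N$ of a series of $N$ independent observations is the product, and the log-likelihood $\mathcal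 L_N$ the sum of the logarithms. Put $p_I^\perp=\mathbb P(X_i>0\ \forall i\in I,\ X_j=0\ \forall j\notin I)$. Define the restricted Lévy copulas $\mathfrak C_J(u)=\lim_{h\to0+}\overline C_J(hu)/h$ for $\varnothing\ne J\subseteq\mathbb S$. Assume that these limits exist for all $u\in(0,\infty)^J$; that for some $r>0$ the functions $\overline C_J$ have, on $(0,r)^J$, the mixed partial derivatives $\partial_I\overline C_J$, $I\subseteq J$ (at most once in each coordinate, iterated in a fixed order of the coordinates); and that for $\varnothing\neq I\subseteq J$ the mixed derivatives $\partial_I[\overline C_J(h\,\cdot)/h]$ are asymptotically equicontinuous as $h\to0+$ at every point $u\in(0,\infty)^J$, i.e. for every $\varepsilon>0$ there is $\delta>0$ such that, for all small $h>0$, they vary by at most $\varepsilon$ from their value at $u$ on the $\delta$-neighbourhood of $u$. Fix $T>0$, a fixed copula and fixed severities, and numbers $\lambda_I^\perp$ ($\varnothing\ne I\subseteq\mathbb S$) with $\lambda_i:=\sum_{I\ni i}\lambda_I^\perp>0$ for all $i$. For all large $N$ let $\Delta t=T/N$ and consider a Comb-Bernoulli model with Poisson scaling $p_I^\perp=\lambda_I^\perp\Delta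 t+o(\Delta t)$ for all $I\ne\varnothing$ (in particular, $p_I^\perp=\lambda_I^\perp\Delta t$ is allowed). Let $$\zeta(x)=\sum_{J\supseteq\mathcal S(x)}(-1)^{|J|-|\mathcal S(x)|}\left[\frac{\partial^{|\mathcal S(x)|}}{\prod_{i\in\mathcal S(x)}\partial u_i}\mathfrak C_J\bigl(\{u_i\}_{i\in J}\bigr)\right]_{u_i=\lambda_i\overline\Psi_i(x_i)} .$$ **Statement.** 1. The mixed derivatives of $\mathfrak C_J$ occurring in $\zeta$ exist on $(0,\infty)^J$. 2. Let $(t_k,x_k)_{k=1}^n$ be claim events with distinct times $t_k\in(0,T]$, claim vectors $x_k\in[0,\infty)^d\setminus\{0\}$, and $\psi_i(x_{k,i})>0$ for $i\in\mathcal S(x_k)$. For each $N$, monitor them with step $\Delta t=T/N$: the $m$-th observation is the vector of total claims in $((m-1)\Delta t,m\Delta t]$. Then, as $N\to\infty$, $$\frac{L_N}{(\Delta t)^n}\longrightarrow L_\lambda:=\prod_{I\ne\varnothing}\Bigl[e^{-T\lambda_I^\perp}\prod_{k:\mathcal S(x_k)=I}\zeta(x_k)\prod_{i\in I}\lambda_i\psi_i(x_{k,i})\Bigr],$$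 and $\zeta(x_k)\ge0$ for all $k$. If $\zeta(x_k)>0$ for all $k$, then $$\mathcal L_N-n\ln\Delta t\longrightarrow \ln L_\lambda=\sum_{I\ne\varnothing}\Bigl[\sum_{k:\mathcal S(x_k)=I}\Bigl(\ln\zeta(x_k)+\sum_{i\in I}\ln\bigl(\lambda_i\psi_i(x_{k,i})\bigr)\Bigr)-T\lambda_I^\perp\Bigr].$$ 3. There is exactly one finite measure $\nu$ carried by $[0,\infty)^d\setminus\{0\}$ with $\nu\{x:x_j>a_j\ \forall j\in J\}=\mathfrak C_J\bigl(\{\lambda_j\overline\Psi_j(a_j)\}_{j\in J}\bigr)$ for all $J\ne\varnothing$, $a\in[0,\infty)^d$. It satisfies $\nu\{x:\mathcal S(x)=I\}=\lambda_I^\perp$ for all $I\neq\varnothing$, and $L_\lambda$ is the likelihood of the continuous-time compound Poisson model on $(0,T]$ with Lévy measure $\nu$: the law of its claim events (a Poisson point process with intensity $dt\otimes\nu$) has density $L_\lambda$ on finite configurations with respect to the reference measure whose $n$-point part is $\frac1{n!}(dt|_{(0,T]}\otimes\chi)^{\otimes n}$, where $\chi=\sum_{I\ne\varnothing}\bigotimes_{i\in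 I}dx_i|_{(0,\infty)}\otimes\bigotimes_{j\notin I}\delta_0$. -/

import Mathlib

open MeasureTheory Filter Topology

noncomputable section

namespace CombBernoulli

variable {d : ℕ}

/-! ### Partial derivatives and active sets -/

/-- The partial derivative `∂f/∂xᵢ`. -/
def partialDeriv (i : Fin d) (f : (Fin d → ℝ) → ℝ) : (Fin d → ℝ) → ℝ :=
  fun x => deriv (fun s => f (Function.update x i s)) (x i)

/-- The mixed partial derivative `∂^{|I|} f / ∏_{i ∈ I} ∂xᵢ`, once in each coordinate of `I`
(iterated in increasing order of the indices). -/
def mixedPartial (I : Finset (Fin d)) (f : (Fin d → ℝ) → ℝ) : (Fin d → ℝ) → ℝ :=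
  (I.sort (· ≤ ·)).foldr partialDeriv f

/-- The active set `S(x) = {i : xᵢ > 0}`. -/
def activeSet (x : Fin d → ℝ) : Finset (Fin d) := by
  classical exact Finset.univ.filter (fun i => 0 < x i)

/-! ### Copulas -/

/-- A copula, given by its law `κ` on `[0,1]^d`: an absolutely continuous probability measure
with uniform one-dimensional marginals. -/
structure IsCopulaLaw (κ : Measure (Fin d → ℝ)) : Prop where
  prob : IsProbabilityMeasure κ
  uniform : ∀ i, κ.map (fun u => u i) = volume.restrict (Set.Icc (0 : ℝ) 1)
  absCont : κ ≪ volume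

/-- The copula function `C(u) = P(U₁ ≤ u₁, …, U_d ≤ u_d)`. -/
def copula (κ : Measure (Fin d → ℝ)) (u : Fin d → ℝ) : ℝ :=
  κ.real {v | ∀ i, v i ≤ u i}

/-- The survival copula `C̄(u) = P(1 - U₁ ≤ u₁, …, 1 - U_d ≤ u_d)`. -/
def survivalCopula (κ : Measure (Fin d → ℝ)) (u : Fin d → ℝ) : ℝ :=
  κ.real {v | ∀ i, 1 - v i ≤ u i}

/-- The restriction `C̄_J` of the survival copula to the coordinates in `J`: all the other
coordinates are set to `1`. As a function on `ℝ^d` it depends on the coordinates in `J` only. -/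
def restrictedSurvival (κ : Measure (Fin d → ℝ)) (J : Finset (Fin d)) (u : Fin d → ℝ) : ℝ :=
  survivalCopula κ (fun i => if i ∈ J then u i else 1)

/-- The rescaled restricted survival copula `u ↦ C̄_J(h u) / h`. -/
def rescaledSurvival (κ : Measure (Fin d → ℝ)) (J : Finset (Fin d)) (h : ℝ)
    (u : Fin d → ℝ) : ℝ :=
  restrictedSurvival κ J (h • u) / h

/-- The restricted Lévy copula `𝔠_J(u) = lim_{h → 0+} C̄_J(h u) / h`. -/
def levyCopula (κ : Measure (Fin d → ℝ)) (J : Finset (Fin d)) (u : Fin d → ℝ) : ℝ :=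
  limUnder (𝓝[>] (0 : ℝ)) (fun h => rescaledSurvival κ J h u)

/-- The limits defining the Lévy copulas exist; near the origin the restricted survival copulas
have mixed partial derivatives; and the mixed partial derivatives of `u ↦ C̄_J(h u) / h` are
asymptotically equicontinuous, as `h → 0+`, at every point of the open orthant. (No convergence
of derivatives is required.) -/
structure IsTailRegular (κ : Measure (Fin d → ℝ)) : Prop where
  exists_limit : ∀ J : Finset (Fin d), J.Nonempty → ∀ u : Fin d → ℝ, (∀ j ∈ J, 0 < u j) →
    ∃ l : ℝ, Tendsto (fun h => rescaledSurvival κ J h u) (𝓝[>] (0 : ℝ)) (𝓝 l)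
  differentiable : ∃ r > (0 : ℝ), ∀ J I : Finset (Fin d), I ⊆ J →
    ∀ i ∈ J, (∀ j ∈ I, i < j) → ∀ u : Fin d → ℝ, (∀ j ∈ J, 0 < u j ∧ u j < r) →
      DifferentiableAt ℝ
        (fun s => mixedPartial I (restrictedSurvival κ J) (Function.update u i s)) (u i)
  equicontinuous : ∀ J I : Finset (Fin d), I ⊆ J → I.Nonempty →
    ∀ u : Fin d → ℝ, (∀ j ∈ J, 0 < u j) → ∀ ε > (0 : ℝ), ∃ δ > (0 : ℝ),
      ∀ᶠ h in 𝓝[>] (0 : ℝ), ∀ v : Fin d → ℝ, (∀ j ∈ J, |v j - u j| < δ) →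
        |mixedPartial I (rescaledSurvival κ J h) v - mixedPartial I (rescaledSurvival κ J h) u|
          ≤ ε

/-! ### The discrete-time model -/

/-- `ψ` is a continuous probability density on `(0, ∞)`. -/
structure IsSeverityDensity (ψ : ℝ → ℝ) : Prop where
  continuousOn : ContinuousOn ψ (Set.Ioi 0)
  nonneg : ∀ x, 0 < x → 0 ≤ ψ x
  integrableOn : IntegrableOn ψ (Set.Ioi 0)
  integral_eq_one : ∫ x in Set.Ioi (0 : ℝ), ψ x = 1

/-- The severity cdf `Ψ(x) = ∫_0^x ψ`. -/
def severityCDF (ψ : ℝ → ℝ) (x : ℝ) : ℝ := ∫ s in Set.Ioc 0 x, ψ s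

/-- The severity survival function `Ψ̄ = 1 - Ψ`. -/
def severitySurvival (ψ : ℝ → ℝ) (x : ℝ) : ℝ := 1 - severityCDF ψ x

/-- The zero-inflated marginal cdf `F(x) = (1 - p) 1_{x ≥ 0} + p Ψ(x) 1_{x > 0}`. -/
def marginalCDF (ψ : ℝ → ℝ) (p : ℝ) (x : ℝ) : ℝ :=
  (if 0 ≤ x then 1 - p else 0) + (if 0 < x then p * severityCDF ψ x else 0)

/-- `P` is the law of a Comb-Bernoulli vector with occurrence probabilities `pᵢ`, severity
densities `ψᵢ` and copula law `κ`: its joint cdf is `C(F₁(x₁), …, F_d(x_d))`. -/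
structure IsCombBernoulli (κ : Measure (Fin d → ℝ)) (ψ : Fin d → ℝ → ℝ) (p : Fin d → ℝ)
    (P : Measure (Fin d → ℝ)) : Prop where
  prob : IsProbabilityMeasure P
  p_pos : ∀ i, 0 < p i
  p_le_one : ∀ i, p i ≤ 1
  cdf_eq : ∀ x : Fin d → ℝ,
    P.real {z | ∀ i, z i ≤ x i} = copula κ (fun i => marginalCDF (ψ i) (p i) (x i))

/-- `p_I^⊥`: the probability that the positive components are exactly those in `I`. -/
def activeProb (P : Measure (Fin d → ℝ)) (I : Finset (Fin d)) : ℝ :=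
  P.real {z | (∀ i ∈ I, 0 < z i) ∧ ∀ j ∉ I, z j = 0}

/-- The likelihood of one observation `x ∈ [0,∞)^d`: the density of `P` at `x` in the active
coordinates, jointly with the event that all the other coordinates vanish. -/
def obsLikelihood (P : Measure (Fin d → ℝ)) (x : Fin d → ℝ) : ℝ :=
  mixedPartial (activeSet x)
    (fun y => P.real {z | (∀ i ∈ activeSet x, z i ≤ y i) ∧ ∀ j ∉ activeSet x, z j = 0}) x

/-- The likelihood of a time series of independent observations with law `P`. -/
def seriesLikelihood {N : ℕ} (P : Measure (Fin d → ℝ)) (X : Fin N → Fin d → ℝ) : ℝ :=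
  ∏ m, obsLikelihood P (X m)

/-- The log-likelihood of a time series of independent observations with law `P`. -/
def seriesLogLikelihood {N : ℕ} (P : Measure (Fin d → ℝ)) (X : Fin N → Fin d → ℝ) : ℝ :=
  ∑ m, Real.log (obsLikelihood P (X m))

/-- Claim events `(t_k, x_k)` over `(0, T]`, monitored with time step `T / N`: observation `m` is
the vector of total claims in `(m T/N, (m+1) T/N]`, `m = 0, …, N - 1`. -/
def monitoredSeries {n : ℕ} (T : ℝ) (t : Fin n → ℝ) (x : Fin n → Fin d → ℝ) (N : ℕ) :
    Fin N → Fin d → ℝ := fun m =>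
  ∑ k, Set.indicator (Set.Ioc ((m : ℝ) * (T / N)) (((m : ℝ) + 1) * (T / N)))
    (fun _ => x k) (t k)

/-! ### The continuous-time model -/

/-- The intensity `λᵢ = ∑_{I ∋ i} λ_I^⊥` of component `i`. -/
def intensity (lam : Finset (Fin d) → ℝ) (i : Fin d) : ℝ :=
  ∑ I ∈ Finset.univ.filter (fun I : Finset (Fin d) => i ∈ I), lam I

/-- The function
`ζ(x) = ∑_{J ⊇ S(x)} (-1)^{|J| + |S(x)|} [∂_{S(x)} 𝔠_J(u)]_{uᵢ = λᵢ Ψ̄ᵢ(xᵢ)}`. -/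
def zeta (κ : Measure (Fin d → ℝ)) (ψ : Fin d → ℝ → ℝ) (lam : Finset (Fin d) → ℝ)
    (x : Fin d → ℝ) : ℝ :=
  ∑ J ∈ Finset.univ.filter (fun J : Finset (Fin d) => activeSet x ⊆ J),
    (-1 : ℝ) ^ (J.card + (activeSet x).card) *
      mixedPartial (activeSet x) (levyCopula κ J)
        (fun i => intensity lam i * severitySurvival (ψ i) (x i))

/-- `∏_{I ≠ ∅} [e^{-T λ_I^⊥} ∏_{k : S(x_k) = I} ζ(x_k) ∏_{i ∈ I} λᵢ ψᵢ(x_{k,i})]`. -/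
def levyLikelihood (κ : Measure (Fin d → ℝ)) (ψ : Fin d → ℝ → ℝ)
    (lam : Finset (Fin d) → ℝ) (T : ℝ) {n : ℕ} (x : Fin n → Fin d → ℝ) : ℝ :=
  ∏ I ∈ Finset.univ.filter (fun I : Finset (Fin d) => I.Nonempty),
    (Real.exp (-(T * lam I)) *
      ∏ k ∈ Finset.univ.filter (fun k => activeSet (x k) = I),
        (zeta κ ψ lam (x k) * ∏ i ∈ I, intensity lam i * ψ i (x k i)))

/-- `∑_{I ≠ ∅} [∑_{k : S(x_k) = I} (ln ζ(x_k) + ∑_{i ∈ I} ln (λᵢ ψᵢ(x_{k,i}))) - T λ_I^⊥]`. -/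
def levyLogLikelihood (κ : Measure (Fin d → ℝ)) (ψ : Fin d → ℝ → ℝ)
    (lam : Finset (Fin d) → ℝ) (T : ℝ) {n : ℕ} (x : Fin n → Fin d → ℝ) : ℝ :=
  ∑ I ∈ Finset.univ.filter (fun I : Finset (Fin d) => I.Nonempty),
    ((∑ k ∈ Finset.univ.filter (fun k => activeSet (x k) = I),
        (Real.log (zeta κ ψ lam (x k)) +
          ∑ i ∈ I, Real.log (intensity lam i * ψ i (x k i)))) - T * lam I)

/-- `ν` is the Lévy measure with marginal tail integrals `λᵢ Ψ̄ᵢ` and Lévy copulas `𝔠_J`: a finite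
measure carried by `[0,∞)^d \ {0}` with
`ν {x : xⱼ > aⱼ ∀ j ∈ J} = 𝔠_J ((λⱼ Ψ̄ⱼ(aⱼ))_{j ∈ J})` for `J ≠ ∅` and `a ≥ 0`. -/
structure IsLevyMeasureOf (κ : Measure (Fin d → ℝ)) (ψ : Fin d → ℝ → ℝ)
    (lam : Finset (Fin d) → ℝ) (ν : Measure (Fin d → ℝ)) : Prop where
  finite : IsFiniteMeasure ν
  carrier : ∀ᵐ x ∂ν, (∀ i, 0 ≤ x i) ∧ x ≠ 0
  tail : ∀ J : Finset (Fin d), J.Nonempty → ∀ a : Fin d → ℝ, (∀ i, 0 ≤ a i) →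
    ν.real {x | ∀ j ∈ J, a j < x j}
      = levyCopula κ J (fun i => intensity lam i * severitySurvival (ψ i) (a i))

/-- The law of the Poisson point process with finite intensity measure `ρ`, listed as a labelled
finite configuration: the number `n` of points is Poisson with mean `ρ(E)` and, given `n`, the
points are independent with law `ρ / ρ(E)`; so the part with `n` points is
`e^{-ρ(E)} ρ^{⊗n} / n!`. -/
def poissonLaw {E : Type*} [MeasurableSpace E] (ρ : Measure E) :
    Measure (Σ n : ℕ, Fin n → E) :=
  Measure.sum fun n : ℕ =>
    (ENNReal.ofReal (Real.exp (-ρ.real Set.univ) / (n.factorial : ℝ)) •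
      Measure.pi (fun _ : Fin n => ρ)).map (Sigma.mk n)

/-- The reference measure for likelihoods of finite configurations of points: `χ^{⊗n} / n!` on the
configurations with `n` points. -/
def configReference {E : Type*} [MeasurableSpace E] (χ : Measure E) :
    Measure (Σ n : ℕ, Fin n → E) :=
  Measure.sum fun n : ℕ =>
    (ENNReal.ofReal (1 / (n.factorial : ℝ)) •
      Measure.pi (fun _ : Fin n => χ)).map (Sigma.mk n)

/-- The reference measure for claim vectors: for every nonempty active set `I`, Lebesgue measure in
the positive coordinates in `I`, with all the other coordinates equal to `0`. -/
def claimReference (d : ℕ) : Measure (Fin d → ℝ) :=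
  ∑ I ∈ Finset.univ.filter (fun I : Finset (Fin d) => I.Nonempty),
    Measure.pi (fun i => if i ∈ I then volume.restrict (Set.Ioi (0 : ℝ)) else Measure.dirac 0)

/-- The law of the claim events `(t, x)` over `(0, T]` of the compound Poisson process with Lévy
measure `ν`: a Poisson point process with intensity `dt ⊗ ν`. -/
def compoundPoissonLaw (T : ℝ) (ν : Measure (Fin d → ℝ)) :
    Measure (Σ n : ℕ, Fin n → ℝ × (Fin d → ℝ)) :=
  poissonLaw ((volume.restrict (Set.Ioc 0 T)).prod ν)

/-- Reference measure for the claim events over `(0, T]`. -/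
def eventReference (T : ℝ) (d : ℕ) : Measure (Σ n : ℕ, Fin n → ℝ × (Fin d → ℝ)) :=
  configReference ((volume.restrict (Set.Ioc 0 T)).prod (claimReference d))

end CombBernoulli

end

open CombBernoulli

/-!
Near the origin the survival copula of the model is governed by the Lévy copulas `𝔠_J`, and with a
small time step `h = T / N` only the behaviour near the origin matters.

*Derivatives.* The functions `u ↦ C̄_J(h u) / h` converge pointwise to `𝔠_J`. Asymptotic
equicontinuity of their derivatives turns pointwise convergence into differentiability of the limit
and convergence of the derivatives: by the mean value inequality a derivative at a point is close to
difference quotients, and these converge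
(`differentiableAt_and_tendsto_deriv_of_equicontinuous`). One coordinate at a time this gives
`IsTailRegular.tendsto_mixedPartial`.

*Likelihoods.* Inclusion–exclusion over the joint tails `P(z_j > a_j ∀ j ∈ J) = C̄_J(p Ψ̄(a))` and
the chain rule write the likelihood of an observation as an alternating sum of mixed derivatives of
the rescaled survival copulas (`IsCombBernoulli.obsLikelihood_eq`); divided by `h` it converges to
`ζ(x) ∏ λᵢ ψᵢ(xᵢ)` (`tendsto_obsLikelihood_div`). For large `N` the claims fall into distinct
cells, and the `N - n` empty observations contribute `(1 - ∑ p_I)^(N - n) → exp (-T ∑ λ_I)`.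

*The Lévy measure.* The alternating sums `H_I = ∑_{K ⊇ I} (-1)^{|K| + |I|} 𝔠_K` are limits of
rescaled probabilities, so their box increments are non-negative; hence so are their mixed
derivatives `∂_I H_I`, which is the positivity of `ζ`. The fundamental theorem of calculus, in each
coordinate of `I` in turn, shows that `∂_I H_I` integrates to `H_I` (`lmarginal_mixedPartial`,
`IsTailRegular.lintegral_faceDensity`). The marginal tail integrals `λᵢ Ψ̄ᵢ` transform the measures
`λᵢ ψᵢ(x) dx` into Lebesgue measure (`map_severitySurvival`), so the measure with density
`ζ ∏ λᵢ ψᵢ` has the face masses `H_I`, and Möbius inversion yields its tails `𝔠_J`. The upper sums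
of the `λ_I` are the values `𝔠_J(λ)`, so Möbius inversion also gives the masses of the faces of any
Lévy measure with these tails, in particular its total mass; uniqueness follows from a π-system
argument. The likelihood of the compound Poisson model is then the general formula for the density
of a Poisson point process (`poissonLaw_withDensity`).
-/

namespace CombBernoulli

variable {d : ℕ}

/-! ### Calculus of mixed partial derivatives -/

/-- All the derivatives needed to form `∂_{I'} f`, `I' ⊆ I`, one coordinate at a time in the order
used by `mixedPartial`, exist on `W`. -/
def MixedDiffOn (I : Finset (Fin d)) (W : Set (Fin d → ℝ)) (f : (Fin d → ℝ) → ℝ) : Prop :=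
  ∀ I' ⊆ I, ∀ i ∈ I, (∀ j ∈ I', i < j) → ∀ u ∈ W,
    DifferentiableAt ℝ (fun s => mixedPartial I' f (Function.update u i s)) (u i)

theorem mixedPartial_empty (f : (Fin d → ℝ) → ℝ) : mixedPartial ∅ f = f := by
  simp [mixedPartial]

theorem mixedPartial_insert_min {I : Finset (Fin d)} {i : Fin d} (hi : ∀ j ∈ I, i < j)
    (f : (Fin d → ℝ) → ℝ) :
    mixedPartial (insert i I) f = partialDeriv i (mixedPartial I f) := by
  have h : i ∉ I := fun h => lt_irrefl _ (hi i h)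
  simp only [mixedPartial]
  rw [Finset.sort_insert _ (fun b hb => (hi b hb).le) h]
  simp

theorem mixedPartial_insert_max {I : Finset (Fin d)} {m : Fin d} (hm : ∀ j ∈ I, j < m)
    (f : (Fin d → ℝ) → ℝ) :
    mixedPartial (insert m I) f = mixedPartial I (partialDeriv m f) := by
  induction I using Finset.induction_on_min with
  | empty =>
    rw [mixedPartial_insert_min (by simp), mixedPartial_empty, mixedPartial_empty]
  | insert a s ha ih =>
    rw [Finset.insert_comm, mixedPartial_insert_min, mixedPartial_insert_min ha, ih]
    · intro j hj
      exact hm j (Finset.mem_insert_of_mem hj)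
    · intro j hj
      rcases Finset.mem_insert.1 hj with rfl | hj
      · exact hm a (Finset.mem_insert_self _ _)
      · exact ha j hj

theorem eventually_update_mem {W : Set (Fin d → ℝ)} (hW : IsOpen W) {u : Fin d → ℝ} (hu : u ∈ W)
    (i : Fin d) : ∀ᶠ s in 𝓝 (u i), Function.update u i s ∈ W := by
  have hc : Continuous (fun s : ℝ => Function.update u i s) :=
    continuous_const.update i continuous_id
  apply hc.continuousAt.preimage_mem_nhds
  rw [Function.update_eq_self]
  exact hW.mem_nhds hu

theorem mixedPartial_congr {W : Set (Fin d → ℝ)} (hW : IsOpen W) {f g : (Fin d → ℝ) → ℝ}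
    (hfg : ∀ u ∈ W, f u = g u) (I : Finset (Fin d)) :
    ∀ u ∈ W, mixedPartial I f u = mixedPartial I g u := by
  induction I using Finset.induction_on_min with
  | empty => simpa [mixedPartial_empty] using hfg
  | insert a s ha ih =>
    intro u hu
    rw [mixedPartial_insert_min ha, mixedPartial_insert_min ha]
    apply Filter.EventuallyEq.deriv_eq
    filter_upwards [eventually_update_mem hW hu a] with t ht using ih _ ht

theorem MixedDiffOn.mono {I I' : Finset (Fin d)} {W W' : Set (Fin d → ℝ)}
    {f : (Fin d → ℝ) → ℝ} (hf : MixedDiffOn I W f) (hI : I' ⊆ I) (hW : W' ⊆ W) :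
    MixedDiffOn I' W' f :=
  fun K hK i hi hlt u hu => hf K (hK.trans hI) i (hI hi) hlt u (hW hu)

theorem MixedDiffOn.partialDeriv_max {I : Finset (Fin d)} {m : Fin d} {W : Set (Fin d → ℝ)}
    {f : (Fin d → ℝ) → ℝ} (hm : ∀ j ∈ I, j < m) (hf : MixedDiffOn (insert m I) W f) :
    MixedDiffOn I W (partialDeriv m f) := by
  intro I' hI' i hi hlt u hu
  rw [← mixedPartial_insert_max (fun j hj => hm j (hI' hj))]
  refine hf _ (Finset.insert_subset_insert _ hI') i (Finset.mem_insert_of_mem hi) ?_ u hu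
  intro j hj
  rcases Finset.mem_insert.1 hj with rfl | hj
  · exact hm i hi
  · exact hlt j hj

theorem update_coordwise (φ : Fin d → ℝ → ℝ) (y : Fin d → ℝ) (a : Fin d) (t : ℝ) :
    (fun i => φ i (Function.update y a t i))
      = Function.update (fun i => φ i (y i)) a (φ a t) := by
  ext i
  by_cases h : i = a
  · subst h; simp
  · simp [h]

theorem hasDerivAt_mixedPartial_coordwise {I : Finset (Fin d)} {W' : Set (Fin d → ℝ)}
    {f : (Fin d → ℝ) → ℝ} (hf : MixedDiffOn I W' f) (φ : Fin d → ℝ → ℝ) {s : Finset (Fin d)}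
    (hs : s ⊆ I) {a : Fin d} (ha : a ∈ I) (hlt : ∀ j ∈ s, a < j) {y : Fin d → ℝ}
    (hy : (fun i => φ i (y i)) ∈ W') (hd : DifferentiableAt ℝ (φ a) (y a)) :
    HasDerivAt (fun t => (∏ i ∈ s, deriv (φ i) (Function.update y a t i)) *
        mixedPartial s f (fun i => φ i (Function.update y a t i)))
      ((∏ i ∈ s, deriv (φ i) (y i)) *
        (partialDeriv a (mixedPartial s f) (fun i => φ i (y i)) * deriv (φ a) (y a))) (y a) := by
  have has : a ∉ s := fun h => lt_irrefl _ (hlt a h)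
  have h1 : (fun t => (∏ i ∈ s, deriv (φ i) (Function.update y a t i)) *
        mixedPartial s f (fun i => φ i (Function.update y a t i)))
      = fun t => (∏ i ∈ s, deriv (φ i) (y i)) *
        ((fun r => mixedPartial s f (Function.update (fun i => φ i (y i)) a r)) ∘ φ a) t := by
    ext t
    rw [Function.comp_apply, ← update_coordwise φ y a t]
    congr 1
    refine Finset.prod_congr rfl fun i hi => ?_
    rw [Function.update_of_ne (by rintro rfl; exact has hi)]
  rw [h1]
  refine HasDerivAt.const_mul _ ?_
  exact (hf s hs a ha hlt _ hy).hasDerivAt.comp (y a) hd.hasDerivAt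

/-- Chain rule for a change of variables that acts coordinate by coordinate. -/
theorem mixedPartial_coordwise {I : Finset (Fin d)} {W W' : Set (Fin d → ℝ)}
    {f : (Fin d → ℝ) → ℝ} (hf : MixedDiffOn I W' f) (hW : IsOpen W) (φ : Fin d → ℝ → ℝ)
    (hφ : ∀ y ∈ W, (fun i => φ i (y i)) ∈ W')
    (hd : ∀ y ∈ W, ∀ i ∈ I, DifferentiableAt ℝ (φ i) (y i)) {s : Finset (Fin d)} (hs : s ⊆ I) :
    ∀ y ∈ W, mixedPartial s (fun y => f (fun i => φ i (y i))) y
      = (∏ i ∈ s, deriv (φ i) (y i)) * mixedPartial s f (fun i => φ i (y i)) := by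
  induction s using Finset.induction_on_min with
  | empty => simp [mixedPartial_empty]
  | insert a s ha ih =>
    intro y hy
    have hsI : s ⊆ I := (Finset.subset_insert _ _).trans hs
    have haI : a ∈ I := hs (Finset.mem_insert_self _ _)
    have has : a ∉ s := fun h => lt_irrefl _ (ha a h)
    rw [mixedPartial_insert_min ha, mixedPartial_insert_min ha, Finset.prod_insert has]
    have h2 := hasDerivAt_mixedPartial_coordwise hf φ hsI haI ha (hφ y hy) (hd y hy a haI)
    rw [partialDeriv, Filter.EventuallyEq.deriv_eq (f₁ := fun t => mixedPartial s
      (fun y => f (fun i => φ i (y i))) (Function.update y a t)) (by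
        filter_upwards [eventually_update_mem hW hy a] with t ht using ih hsI _ ht), h2.deriv]
    ring

theorem MixedDiffOn.coordwise {I : Finset (Fin d)} {W W' : Set (Fin d → ℝ)}
    {f : (Fin d → ℝ) → ℝ} (hf : MixedDiffOn I W' f) (hW : IsOpen W) (φ : Fin d → ℝ → ℝ)
    (hφ : ∀ y ∈ W, (fun i => φ i (y i)) ∈ W')
    (hd : ∀ y ∈ W, ∀ i ∈ I, DifferentiableAt ℝ (φ i) (y i)) :
    MixedDiffOn I W (fun y => f (fun i => φ i (y i))) := by
  intro s hs a ha hlt y hy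
  have h2 := hasDerivAt_mixedPartial_coordwise hf φ hs ha hlt (hφ y hy) (hd y hy a ha)
  refine h2.differentiableAt.congr_of_eventuallyEq ?_
  filter_upwards [eventually_update_mem hW hy a] with t ht
  exact mixedPartial_coordwise hf hW φ hφ hd hs _ ht

theorem mixedPartial_sum {ι : Type*} {S : Finset ι} {c : ι → ℝ} {F : ι → (Fin d → ℝ) → ℝ}
    {I : Finset (Fin d)} {W : Set (Fin d → ℝ)} (hW : IsOpen W)
    (hF : ∀ k ∈ S, MixedDiffOn I W (F k)) {s : Finset (Fin d)} (hs : s ⊆ I) :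
    ∀ u ∈ W, mixedPartial s (fun u => ∑ k ∈ S, c k * F k u) u
      = ∑ k ∈ S, c k * mixedPartial s (F k) u := by
  induction s using Finset.induction_on_min with
  | empty => simp [mixedPartial_empty]
  | insert a s ha ih =>
    intro u hu
    have hsI : s ⊆ I := (Finset.subset_insert _ _).trans hs
    have haI : a ∈ I := hs (Finset.mem_insert_self _ _)
    rw [mixedPartial_insert_min ha, partialDeriv, Filter.EventuallyEq.deriv_eq
      (f := fun t => ∑ k ∈ S, c k * mixedPartial s (F k) (Function.update u a t)) (by
        filter_upwards [eventually_update_mem hW hu a] with t ht using ih hsI _ ht)]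
    have h : HasDerivAt (fun t => ∑ k ∈ S, c k * mixedPartial s (F k) (Function.update u a t))
        (∑ k ∈ S, c k * partialDeriv a (mixedPartial s (F k)) u) (u a) :=
      HasDerivAt.fun_sum fun k hk =>
        ((hF k hk s hsI a haI ha u hu).hasDerivAt).const_mul _
    rw [h.deriv]
    exact Finset.sum_congr rfl fun k _ => by rw [mixedPartial_insert_min ha]

theorem MixedDiffOn.sum {ι : Type*} {S : Finset ι} {c : ι → ℝ} {F : ι → (Fin d → ℝ) → ℝ}
    {I : Finset (Fin d)} {W : Set (Fin d → ℝ)} (hW : IsOpen W)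
    (hF : ∀ k ∈ S, MixedDiffOn I W (F k)) :
    MixedDiffOn I W (fun u => ∑ k ∈ S, c k * F k u) := by
  intro s hs a ha hlt u hu
  have h : DifferentiableAt ℝ
      (fun t => ∑ k ∈ S, c k * mixedPartial s (F k) (Function.update u a t)) (u a) :=
    DifferentiableAt.fun_sum fun k hk => (hF k hk s hs a ha hlt u hu).const_mul _
  refine h.congr_of_eventuallyEq ?_
  filter_upwards [eventually_update_mem hW hu a] with t ht using mixedPartial_sum hW hF hs _ ht

theorem mixedPartial_update_of_forall {f : (Fin d → ℝ) → ℝ} {i : Fin d}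
    (hf : ∀ u s, f (Function.update u i s) = f u) {I : Finset (Fin d)} (hi : i ∉ I) :
    ∀ u s, mixedPartial I f (Function.update u i s) = mixedPartial I f u := by
  induction I using Finset.induction_on_min with
  | empty => simpa [mixedPartial_empty] using hf
  | insert a I ha ih =>
    intro u s
    have hia : i ≠ a := by rintro rfl; exact hi (Finset.mem_insert_self _ _)
    have hiI : i ∉ I := fun h => hi (Finset.mem_insert_of_mem h)
    rw [mixedPartial_insert_min ha]
    simp only [partialDeriv]
    rw [Function.update_of_ne hia.symm]
    congr 1
    ext t
    rw [Function.update_comm hia, ih hiI]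

theorem mixedPartial_eq_zero_of_forall {f : (Fin d → ℝ) → ℝ} {i : Fin d}
    (hf : ∀ u s, f (Function.update u i s) = f u) {I : Finset (Fin d)} (hi : i ∈ I) :
    ∀ u, mixedPartial I f u = 0 := by
  induction I using Finset.induction_on_min with
  | empty => simp at hi
  | insert a I ha ih =>
    intro u
    rw [mixedPartial_insert_min ha, partialDeriv]
    by_cases hia : i = a
    · subst hia
      have : i ∉ I := fun h => lt_irrefl _ (ha i h)
      simp [mixedPartial_update_of_forall hf this]
    · have hiI : i ∈ I := (Finset.mem_insert.1 hi).resolve_left hia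
      simp [ih hiI]

/-- Differentiability has to be checked in the coordinates on which the function depends. -/
theorem MixedDiffOn.of_inter {I J : Finset (Fin d)} {W : Set (Fin d → ℝ)}
    {f : (Fin d → ℝ) → ℝ} (hind : ∀ i ∉ J, ∀ u s, f (Function.update u i s) = f u)
    (hf : MixedDiffOn (I ∩ J) W f) : MixedDiffOn I W f := by
  intro s hs a ha hlt u hu
  by_cases hsJ : s ⊆ J
  · by_cases haJ : a ∈ J
    · exact hf s (Finset.subset_inter hs hsJ) a (Finset.mem_inter.2 ⟨ha, haJ⟩) hlt u hu
    · have has : a ∉ s := fun h => lt_irrefl _ (hlt a h)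
      simp [mixedPartial_update_of_forall (hind a haJ) has]
  · obtain ⟨i, his, hiJ⟩ := Finset.not_subset.1 hsJ
    simp [mixedPartial_eq_zero_of_forall (hind i hiJ) his]

/-! ### Limits of derivatives under asymptotic equicontinuity -/

/-- If `F h → f` pointwise near `x` and the derivatives of `F h` are asymptotically equicontinuous
at `x`, then `f` is differentiable at `x` and the derivatives converge at `x`: by the mean value
inequality, the derivative at `x` is close to difference quotients, which converge. -/
theorem differentiableAt_and_tendsto_deriv_of_equicontinuous {l : Filter ℝ} [l.NeBot]
    {F : ℝ → ℝ → ℝ} {f : ℝ → ℝ} {x : ℝ}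
    (hlim : ∀ᶠ s in 𝓝 x, Tendsto (fun h => F h s) l (𝓝 (f s)))
    (hdiff : ∃ δ > (0 : ℝ), ∀ᶠ h in l, ∀ s, |s - x| < δ → DifferentiableAt ℝ (F h) s)
    (hequi : ∀ ε > (0 : ℝ), ∃ δ > (0 : ℝ), ∀ᶠ h in l, ∀ s, |s - x| < δ →
      |deriv (F h) s - deriv (F h) x| ≤ ε) :
    DifferentiableAt ℝ f x ∧ Tendsto (fun h => deriv (F h) x) l (𝓝 (deriv f x)) := by
  obtain ⟨δ₁, hδ₁, h1⟩ := hdiff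
  obtain ⟨δ₀, hδ₀, h0⟩ := Metric.eventually_nhds_iff.1 hlim
  simp only [Real.dist_eq] at h0
  have hx0 : Tendsto (fun h => F h x) l (𝓝 (f x)) := h0 (by simpa using hδ₀)
  have key : ∀ ε > (0 : ℝ), ∃ δ > (0 : ℝ), δ ≤ δ₀ ∧ ∀ᶠ h in l, ∀ s, |s - x| < δ →
      |F h s - F h x - (s - x) * deriv (F h) x| ≤ ε * |s - x| := by
    intro ε hε
    obtain ⟨δ₂, hδ₂, h2⟩ := hequi ε hε
    refine ⟨min δ₀ (min δ₁ δ₂), by positivity, min_le_left _ _, ?_⟩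
    filter_upwards [h1, h2] with h hh1 hh2 s hs
    have hs1 : |s - x| < δ₁ := hs.trans_le ((min_le_right _ _).trans (min_le_left _ _))
    have hs2 : |s - x| < δ₂ := hs.trans_le ((min_le_right _ _).trans (min_le_right _ _))
    have hball : ∀ y ∈ Metric.ball x (min δ₁ δ₂), |y - x| < δ₁ ∧ |y - x| < δ₂ := by
      intro y hy
      rw [Metric.mem_ball, Real.dist_eq] at hy
      exact ⟨hy.trans_le (min_le_left _ _), hy.trans_le (min_le_right _ _)⟩
    have hd : ∀ y ∈ Metric.ball x (min δ₁ δ₂),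
        HasDerivAt (fun y => F h y - y * deriv (F h) x) (deriv (F h) y - deriv (F h) x) y := by
      intro y hy
      have := (hh1 y (hball y hy).1).hasDerivAt.sub
        ((hasDerivAt_id y).mul_const (deriv (F h) x))
      simp only [id_eq, one_mul] at this
      exact this
    have := Convex.norm_image_sub_le_of_norm_deriv_le (𝕜 := ℝ)
      (f := fun y => F h y - y * deriv (F h) x) (C := ε) (s := Metric.ball x (min δ₁ δ₂))
      (x := x) (y := s)
      (fun y hy => (hd y hy).differentiableAt)
      (fun y hy => by
        rw [(hd y hy).deriv, Real.norm_eq_abs]; exact hh2 y (hball y hy).2)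
      (convex_ball _ _) (Metric.mem_ball_self (by positivity))
      (by rw [Metric.mem_ball, Real.dist_eq]; exact lt_min hs1 hs2)
    rw [Real.norm_eq_abs, Real.norm_eq_abs] at this
    calc _ = |F h s - s * deriv (F h) x - (F h x - x * deriv (F h) x)| := by ring_nf
      _ ≤ _ := this
  have hc : Cauchy (map (fun h => deriv (F h) x) l) := by
    rw [Metric.cauchy_iff]
    refine ⟨inferInstance, fun ε hε => ?_⟩
    obtain ⟨δ, hδ, hδ0, hk⟩ := key (ε / 6) (by positivity)
    have hs : |(x + δ / 2) - x| < δ := by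
      rw [add_sub_cancel_left, abs_of_pos (by positivity)]; linarith
    have hs' : |(x + δ / 2) - x| < δ₀ := hs.trans_le hδ0
    have hq : Tendsto (fun h => (F h (x + δ / 2) - F h x)) l (𝓝 (f (x + δ / 2) - f x)) :=
      (h0 hs').sub hx0
    have hq' : ∀ᶠ h in l,
        |(F h (x + δ / 2) - F h x) - (f (x + δ / 2) - f x)| < ε / 6 * (δ / 2) := by
      have := (Metric.tendsto_nhds.1 hq) (ε / 6 * (δ / 2)) (by positivity)
      simpa only [Real.dist_eq] using this
    refine ⟨Metric.closedBall ((f (x + δ / 2) - f x) / (δ / 2)) (ε / 3), ?_, ?_⟩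
    · rw [mem_map]
      filter_upwards [hk, hq'] with h hh hh'
      have e1 := hh _ hs
      rw [add_sub_cancel_left, abs_of_pos (half_pos hδ)] at e1
      have e1' := abs_le.1 e1
      have e2' := abs_lt.1 hh'
      rw [Set.mem_preimage, Metric.mem_closedBall, Real.dist_eq, abs_le]
      constructor
      · have : (f (x + δ / 2) - f x) / (δ / 2) ≤ deriv (F h) x + ε / 3 := by
          rw [div_le_iff₀ (half_pos hδ)]; nlinarith
        linarith
      · have : deriv (F h) x - ε / 3 ≤ (f (x + δ / 2) - f x) / (δ / 2) := by
          rw [le_div_iff₀ (half_pos hδ)]; nlinarith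
        linarith
    · intro a ha b hb
      rw [Metric.mem_closedBall] at ha hb
      calc dist a b ≤ dist a _ + dist _ b := dist_triangle _ ((f (x + δ / 2) - f x) / (δ / 2)) _
        _ ≤ ε / 3 + ε / 3 := add_le_add ha (by rw [dist_comm]; exact hb)
        _ < ε := by linarith
  obtain ⟨L, hL⟩ := cauchy_map_iff_exists_tendsto.1 hc
  have hderiv : HasDerivAt f L x := by
    rw [hasDerivAt_iff_isLittleO, Asymptotics.isLittleO_iff]
    intro ε hε
    obtain ⟨δ, hδ, hδ0, hk⟩ := key ε hε
    filter_upwards [Metric.ball_mem_nhds x hδ] with s hs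
    rw [Metric.mem_ball, Real.dist_eq] at hs
    have ht : Tendsto (fun h => |F h s - F h x - (s - x) * deriv (F h) x|) l
        (𝓝 |f s - f x - (s - x) * L|) :=
      (((h0 (hs.trans_le hδ0)).sub hx0).sub (hL.const_mul _)).abs
    have := le_of_tendsto ht (hk.mono fun h hh => hh s hs)
    simpa [Real.norm_eq_abs] using this
  exact ⟨hderiv.differentiableAt, by rwa [hderiv.deriv]⟩

/-! ### Inclusion–exclusion -/

/-- Inclusion–exclusion for the points of `B` outside all the sets `A i`, `i ∈ J`. -/
theorem measureReal_notMem_eq_sum_powerset {X ι : Type*} [MeasurableSpace X] [DecidableEq ι]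
    (μ : Measure X) [IsFiniteMeasure μ] {A : ι → Set X} (hA : ∀ i, MeasurableSet (A i))
    (J : Finset ι) (B : Set X) :
    μ.real {x | x ∈ B ∧ ∀ i ∈ J, x ∉ A i}
      = ∑ K ∈ J.powerset, (-1 : ℝ) ^ K.card * μ.real {x | x ∈ B ∧ ∀ i ∈ K, x ∈ A i} := by
  induction J using Finset.induction_on generalizing B with
  | empty => simp
  | insert a J ha ih =>
    rw [Finset.sum_powerset_insert ha]
    have h1 := measureReal_inter_add_sdiff (μ := μ) (s := {x | x ∈ B ∧ ∀ i ∈ J, x ∉ A i}) (hA a)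
    have h2 : {x | x ∈ B ∧ ∀ i ∈ J, x ∉ A i} \ A a
        = {x | x ∈ B ∧ ∀ i ∈ insert a J, x ∉ A i} := by
      ext x; simp; tauto
    have h3 : {x | x ∈ B ∧ ∀ i ∈ J, x ∉ A i} ∩ A a
        = {x | x ∈ B ∩ A a ∧ ∀ i ∈ J, x ∉ A i} := by
      ext x; simp; tauto
    rw [h2, h3, ih, ih] at h1
    rw [eq_sub_iff_add_eq'.2 h1, sub_eq_add_neg, ← Finset.sum_neg_distrib]
    congr 1
    refine Finset.sum_congr rfl fun K hK => ?_
    have haK : a ∉ K := fun h => ha (Finset.mem_powerset.1 hK h)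
    rw [Finset.card_insert_of_notMem haK, pow_succ]
    have : {x | x ∈ B ∩ A a ∧ ∀ i ∈ K, x ∈ A i}
        = {x | x ∈ B ∧ ∀ i ∈ insert a K, x ∈ A i} := by
      ext x; simp; tauto
    rw [this]; ring

/-- Two finite measures that agree on all intersections of the sets `A i` (respectively `A' i`)
agree on all intersections of their complements. -/
theorem measureReal_forall_notMem_congr {X Y ι : Type*} [MeasurableSpace X] [MeasurableSpace Y]
    [DecidableEq ι] (μ : Measure X) [IsFiniteMeasure μ] (ν : Measure Y) [IsFiniteMeasure ν]
    {A : ι → Set X} (hA : ∀ i, MeasurableSet (A i)) {A' : ι → Set Y}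
    (hA' : ∀ i, MeasurableSet (A' i))
    (h : ∀ K : Finset ι, μ.real {x | ∀ i ∈ K, x ∈ A i} = ν.real {y | ∀ i ∈ K, y ∈ A' i})
    (J : Finset ι) : μ.real {x | ∀ i ∈ J, x ∉ A i} = ν.real {y | ∀ i ∈ J, y ∉ A' i} := by
  have h1 := measureReal_notMem_eq_sum_powerset μ hA J Set.univ
  have h2 := measureReal_notMem_eq_sum_powerset ν hA' J Set.univ
  simp only [Set.mem_univ, true_and] at h1 h2
  rw [h1, h2]
  exact Finset.sum_congr rfl fun K _ => by rw [h K]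

/-! ### Copulas and survival copulas -/

theorem IsCopulaLaw.apply_eval {κ : Measure (Fin d → ℝ)} (hκ : IsCopulaLaw κ) (i : Fin d)
    {S : Set ℝ} (hS : MeasurableSet S) : κ {v | v i ∈ S} = volume (S ∩ Set.Icc 0 1) := by
  rw [← Measure.restrict_apply hS, ← hκ.uniform i, Measure.map_apply (by fun_prop) hS]
  rfl

theorem IsCopulaLaw.ae_mem_Icc {κ : Measure (Fin d → ℝ)} (hκ : IsCopulaLaw κ) :
    ∀ᵐ v ∂κ, ∀ i, v i ∈ Set.Icc (0 : ℝ) 1 := by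
  rw [ae_all_iff]
  intro i
  have := hκ.apply_eval i (measurableSet_Icc (a := (0 : ℝ)) (b := 1)).compl
  rw [Set.compl_inter_self, measure_empty] at this
  exact this

theorem IsCopulaLaw.ae_ne {κ : Measure (Fin d → ℝ)} (hκ : IsCopulaLaw κ) (c : Fin d → ℝ) :
    ∀ᵐ v ∂κ, ∀ i, v i ≠ c i := by
  rw [ae_all_iff]
  intro i
  have h := hκ.apply_eval i (measurableSet_singleton (c i))
  have h0 : volume ({c i} ∩ Set.Icc (0 : ℝ) 1) = 0 :=
    measure_mono_null Set.inter_subset_left Real.volume_singleton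
  rw [h0] at h
  rw [ae_iff]
  simpa using h

theorem IsCopulaLaw.measureReal_eval_le {κ : Measure (Fin d → ℝ)} (hκ : IsCopulaLaw κ)
    (i : Fin d) {S : Set ℝ} {a b : ℝ} (hS : MeasurableSet S) (hab : S ⊆ Set.Icc a b) :
    κ.real {v | v i ∈ S} ≤ |b - a| := by
  rw [Measure.real, hκ.apply_eval i hS]
  refine ENNReal.toReal_le_of_le_ofReal (abs_nonneg _) ?_
  calc volume (S ∩ Set.Icc 0 1) ≤ volume (Set.Icc a b) :=
        measure_mono (Set.inter_subset_left.trans hab)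
    _ = ENNReal.ofReal (b - a) := Real.volume_Icc
    _ ≤ _ := ENNReal.ofReal_le_ofReal (le_abs_self _)

theorem IsCopulaLaw.copula_le_add {κ : Measure (Fin d → ℝ)} (hκ : IsCopulaLaw κ)
    (a b : Fin d → ℝ) : copula κ a ≤ copula κ b + ∑ i, |a i - b i| := by
  have := hκ.prob
  have hsub : {v : Fin d → ℝ | ∀ i, v i ≤ a i}
      ⊆ {v | ∀ i, v i ≤ b i} ∪
        ⋃ i ∈ (Finset.univ : Finset (Fin d)), {v | v i ∈ Set.Ioc (b i) (a i)} := by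
    intro v hv
    by_cases h : ∀ i, v i ≤ b i
    · exact Or.inl h
    · push Not at h
      obtain ⟨i, hi⟩ := h
      refine Or.inr ?_
      simp only [Finset.mem_univ, Set.iUnion_true, Set.mem_iUnion]
      exact ⟨i, hi, hv i⟩
  calc copula κ a ≤ _ := measureReal_mono hsub
    _ ≤ _ := measureReal_union_le _ _
    _ ≤ _ := by
      refine add_le_add le_rfl ((measureReal_biUnion_finset_le _ _).trans ?_)
      exact Finset.sum_le_sum fun i _ => hκ.measureReal_eval_le i measurableSet_Ioc
        Set.Ioc_subset_Icc_self

theorem IsCopulaLaw.abs_copula_sub_le {κ : Measure (Fin d → ℝ)} (hκ : IsCopulaLaw κ)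
    (a b : Fin d → ℝ) : |copula κ a - copula κ b| ≤ ∑ i, |a i - b i| := by
  rw [abs_le]
  have h1 := hκ.copula_le_add a b
  have h2 := hκ.copula_le_add b a
  simp only [abs_sub_comm (b _) (a _)] at h2
  constructor <;> linarith

theorem IsCopulaLaw.restrictedSurvival_eq {κ : Measure (Fin d → ℝ)} (hκ : IsCopulaLaw κ)
    (J : Finset (Fin d)) (u : Fin d → ℝ) :
    restrictedSurvival κ J u = κ.real {v | ∀ j ∈ J, 1 - v j ≤ u j} := by
  apply measureReal_congr
  filter_upwards [hκ.ae_mem_Icc] with v hv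
  apply propext
  change (∀ i, 1 - v i ≤ if i ∈ J then u i else 1) ↔ ∀ j ∈ J, 1 - v j ≤ u j
  constructor
  · intro h j hj
    simpa [hj] using h j
  · intro h j
    by_cases hj : j ∈ J
    · simpa [hj] using h j hj
    · simpa [hj] using (hv j).1

theorem restrictedSurvival_update (κ : Measure (Fin d → ℝ)) {J : Finset (Fin d)} {i : Fin d}
    (hi : i ∉ J) (u : Fin d → ℝ) (s : ℝ) :
    restrictedSurvival κ J (Function.update u i s) = restrictedSurvival κ J u := by
  simp only [restrictedSurvival]
  congr 1
  ext k
  by_cases hk : k ∈ J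
  · have : k ≠ i := by rintro rfl; exact hi hk
    simp [hk, this]
  · simp [hk]

theorem IsCopulaLaw.restrictedSurvival_le_add {κ : Measure (Fin d → ℝ)} (hκ : IsCopulaLaw κ)
    (J : Finset (Fin d)) (a b : Fin d → ℝ) :
    restrictedSurvival κ J a ≤ restrictedSurvival κ J b + ∑ j ∈ J, |a j - b j| := by
  have := hκ.prob
  rw [hκ.restrictedSurvival_eq, hκ.restrictedSurvival_eq]
  have hsub : {v : Fin d → ℝ | ∀ j ∈ J, 1 - v j ≤ a j}
      ⊆ {v | ∀ j ∈ J, 1 - v j ≤ b j} ∪ ⋃ j ∈ J, {v | v j ∈ Set.Ico (1 - a j) (1 - b j)} := by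
    intro v hv
    by_cases h : ∀ j ∈ J, 1 - v j ≤ b j
    · exact Or.inl h
    · push Not at h
      obtain ⟨i, hiJ, hi⟩ := h
      refine Or.inr ?_
      simp only [Set.mem_iUnion]
      exact ⟨i, hiJ, by have := hv i hiJ; linarith, by linarith⟩
  refine (measureReal_mono hsub).trans ((measureReal_union_le _ _).trans ?_)
  refine add_le_add le_rfl ((measureReal_biUnion_finset_le _ _).trans ?_)
  refine Finset.sum_le_sum fun i _ => (hκ.measureReal_eval_le i measurableSet_Ico
        Set.Ico_subset_Icc_self).trans_eq ?_
  congr 1; ring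

theorem IsCopulaLaw.abs_restrictedSurvival_sub_le {κ : Measure (Fin d → ℝ)} (hκ : IsCopulaLaw κ)
    (J : Finset (Fin d)) (a b : Fin d → ℝ) :
    |restrictedSurvival κ J a - restrictedSurvival κ J b| ≤ ∑ j ∈ J, |a j - b j| := by
  rw [abs_le]
  have h1 := hκ.restrictedSurvival_le_add J a b
  have h2 := hκ.restrictedSurvival_le_add J b a
  simp only [abs_sub_comm (b _) (a _)] at h2
  constructor <;> linarith

theorem restrictedSurvival_nonneg (κ : Measure (Fin d → ℝ)) (J : Finset (Fin d))
    (u : Fin d → ℝ) : 0 ≤ restrictedSurvival κ J u := measureReal_nonneg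

theorem IsCopulaLaw.restrictedSurvival_le {κ : Measure (Fin d → ℝ)} (hκ : IsCopulaLaw κ)
    {J : Finset (Fin d)} {j : Fin d} (hj : j ∈ J) {u : Fin d → ℝ} (hu : 0 ≤ u j) :
    restrictedSurvival κ J u ≤ u j := by
  have := hκ.prob
  rw [hκ.restrictedSurvival_eq]
  have h1 : κ.real {v | ∀ j ∈ J, 1 - v j ≤ u j} ≤ κ.real {v | v j ∈ Set.Icc (1 - u j) 1} := by
    refine ENNReal.toReal_mono (measure_ne_top _ _) (measure_mono_ae ?_)
    filter_upwards [hκ.ae_mem_Icc] with v hv h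
    exact ⟨by have := h j hj; linarith, (hv j).2⟩
  refine h1.trans ((hκ.measureReal_eval_le j measurableSet_Icc subset_rfl).trans_eq ?_)
  rw [sub_sub_cancel, abs_of_nonneg hu]

/-! ### Severity distributions -/

theorem severityCDF_of_nonpos {ψ : ℝ → ℝ} {x : ℝ} (hx : x ≤ 0) : severityCDF ψ x = 0 := by
  simp [severityCDF, Set.Ioc_eq_empty_of_le hx]

theorem severitySurvival_zero (ψ : ℝ → ℝ) : severitySurvival ψ 0 = 1 := by
  simp [severitySurvival, severityCDF_of_nonpos le_rfl]

theorem severitySurvival_eq_integral {ψ : ℝ → ℝ} (hψ : IsSeverityDensity ψ) {x : ℝ}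
    (hx : 0 ≤ x) : severitySurvival ψ x = ∫ s in Set.Ioi x, ψ s := by
  have h := setIntegral_union (μ := volume) (f := ψ) (s := Set.Ioc 0 x) (t := Set.Ioi x)
    (by rw [Set.disjoint_left]; intro y hy hy'; exact absurd hy.2 (not_le.2 hy'))
    measurableSet_Ioi (hψ.integrableOn.mono_set Set.Ioc_subset_Ioi_self)
    (hψ.integrableOn.mono_set (Set.Ioi_subset_Ioi hx))
  rw [Set.Ioc_union_Ioi_eq_Ioi hx, hψ.integral_eq_one] at h
  rw [severitySurvival, severityCDF, h]; ring

theorem tendsto_severityCDF {ψ : ℝ → ℝ} (hψ : IsSeverityDensity ψ) :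
    Tendsto (severityCDF ψ) atTop (𝓝 1) := by
  have h := intervalIntegral_tendsto_integral_Ioi (μ := volume) 0 hψ.integrableOn tendsto_id
  rw [hψ.integral_eq_one] at h
  refine h.congr' ?_
  filter_upwards [eventually_ge_atTop (0 : ℝ)] with x hx
  rw [id, intervalIntegral.integral_of_le hx, severityCDF]

theorem tendsto_severitySurvival {ψ : ℝ → ℝ} (hψ : IsSeverityDensity ψ) :
    Tendsto (severitySurvival ψ) atTop (𝓝 0) := by
  have h := (tendsto_severityCDF hψ).const_sub 1
  rw [sub_self] at h
  exact h

theorem hasDerivAt_severitySurvival {ψ : ℝ → ℝ} (hψ : IsSeverityDensity ψ) {x : ℝ} (hx : 0 < x) :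
    HasDerivAt (severitySurvival ψ) (-ψ x) x := by
  have h : HasDerivAt (fun u => ∫ s in (0 : ℝ)..u, ψ s) (ψ x) x := by
    refine intervalIntegral.integral_hasDerivAt_right ?_ ?_ ?_
    · rw [intervalIntegrable_iff_integrableOn_Ioc_of_le hx.le]
      exact hψ.integrableOn.mono_set Set.Ioc_subset_Ioi_self
    · exact hψ.continuousOn.stronglyMeasurableAtFilter isOpen_Ioi x hx
    · exact hψ.continuousOn.continuousAt (Ioi_mem_nhds hx)
  refine (h.const_sub 1).congr_of_eventuallyEq ?_
  filter_upwards [Ioi_mem_nhds hx] with y hy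
  rw [severitySurvival, severityCDF, intervalIntegral.integral_of_le (le_of_lt hy)]

theorem severitySurvival_antitoneOn {ψ : ℝ → ℝ} (hψ : IsSeverityDensity ψ) {x y : ℝ}
    (hx : 0 ≤ x) (hxy : x ≤ y) : severitySurvival ψ y ≤ severitySurvival ψ x := by
  rw [severitySurvival_eq_integral hψ hx, severitySurvival_eq_integral hψ (hx.trans hxy)]
  refine setIntegral_mono_set (hψ.integrableOn.mono_set (Set.Ioi_subset_Ioi hx)) ?_
    (Set.Ioi_subset_Ioi hxy).eventuallyLE
  filter_upwards [ae_restrict_mem measurableSet_Ioi] with s hs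
  exact hψ.nonneg s (lt_of_le_of_lt hx hs)

theorem severitySurvival_nonneg {ψ : ℝ → ℝ} (hψ : IsSeverityDensity ψ) {x : ℝ} (hx : 0 ≤ x) :
    0 ≤ severitySurvival ψ x := by
  rw [severitySurvival_eq_integral hψ hx]
  exact setIntegral_nonneg measurableSet_Ioi fun s hs => hψ.nonneg s (lt_of_le_of_lt hx hs)

/-- A point at which the density is positive is not the right end of the support. -/
theorem severitySurvival_pos {ψ : ℝ → ℝ} (hψ : IsSeverityDensity ψ) {x : ℝ} (hx : 0 < x)
    (h : 0 < ψ x) : 0 < severitySurvival ψ x := by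
  by_contra hcon
  have hx0 : severitySurvival ψ x = 0 :=
    le_antisymm (not_lt.1 hcon) (severitySurvival_nonneg hψ hx.le)
  have hmin : IsLocalMin (severitySurvival ψ) x := by
    filter_upwards [Ioi_mem_nhds hx] with y hy
    rw [hx0]
    exact severitySurvival_nonneg hψ (le_of_lt hy)
  have := hmin.hasDerivAt_eq_zero (hasDerivAt_severitySurvival hψ hx)
  linarith

/-! ### The law of a Comb-Bernoulli vector -/

theorem marginalCDF_of_nonneg (ψ : ℝ → ℝ) (p : ℝ) {x : ℝ} (hx : 0 ≤ x) :
    marginalCDF ψ p x = 1 - p * severitySurvival ψ x := by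
  rw [marginalCDF, if_pos hx, severitySurvival]
  rcases hx.eq_or_lt with rfl | hx
  · simp [severityCDF_of_nonpos le_rfl]
  · rw [if_pos hx]; ring

theorem marginalCDF_of_neg (ψ : ℝ → ℝ) (p : ℝ) {x : ℝ} (hx : x < 0) :
    marginalCDF ψ p x = 0 := by
  rw [marginalCDF, if_neg (not_le.2 hx), if_neg (not_lt.2 hx.le), add_zero]

theorem IsCombBernoulli.measureReal_forall_le {κ : Measure (Fin d → ℝ)} (hκ : IsCopulaLaw κ)
    {ψ : Fin d → ℝ → ℝ} (hψ : ∀ i, IsSeverityDensity (ψ i)) {p : Fin d → ℝ}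
    {P : Measure (Fin d → ℝ)} (hP : IsCombBernoulli κ ψ p P) (K : Finset (Fin d))
    (a : Fin d → ℝ) :
    P.real {z | ∀ i ∈ K, z i ≤ a i}
      = κ.real {v | ∀ i ∈ K, v i ≤ marginalCDF (ψ i) (p i) (a i)} := by
  have := hP.prob
  have := hκ.prob
  let b : ℕ → Fin d → ℝ := fun n i => if i ∈ K then a i else n
  have h1 : Tendsto (fun n => P.real {z | ∀ i, z i ≤ b n i}) atTop
      (𝓝 (P.real {z | ∀ i ∈ K, z i ≤ a i})) := by
    have hU : (⋃ n, {z : Fin d → ℝ | ∀ i, z i ≤ b n i}) = {z | ∀ i ∈ K, z i ≤ a i} := by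
      ext z
      simp only [Set.mem_iUnion, Set.mem_ofPred_eq, b]
      constructor
      · rintro ⟨n, hn⟩ i hi
        simpa [hi] using hn i
      · intro h
        obtain ⟨n, hn⟩ := exists_nat_ge (∑ i, |z i|)
        refine ⟨n, fun i => ?_⟩
        by_cases hi : i ∈ K
        · simpa [hi] using h i hi
        · simp only [hi, if_false]
          exact (le_abs_self _).trans ((Finset.single_le_sum (f := fun i => |z i|)
            (fun i _ => abs_nonneg _) (Finset.mem_univ i)).trans hn)
    rw [← hU]
    have hmono : Monotone (fun n => {z : Fin d → ℝ | ∀ i, z i ≤ b n i}) := by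
      intro m n hmn z hz i
      refine (hz i).trans ?_
      simp only [b]
      split_ifs
      · exact le_rfl
      · exact_mod_cast hmn
    exact (ENNReal.tendsto_toReal (measure_ne_top _ _)).comp (tendsto_measure_iUnion_atTop hmono)
  let c : Fin d → ℝ := fun i => if i ∈ K then marginalCDF (ψ i) (p i) (a i) else 1
  have h2 : Tendsto (fun n => P.real {z | ∀ i, z i ≤ b n i}) atTop (𝓝 (copula κ c)) := by
    simp only [hP.cdf_eq]
    rw [tendsto_iff_norm_sub_tendsto_zero]
    refine squeeze_zero (fun _ => norm_nonneg _) (fun n => hκ.abs_copula_sub_le _ _) ?_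
    rw [← Finset.sum_const_zero (s := (Finset.univ : Finset (Fin d)))]
    refine tendsto_finsetSum _ fun i _ => ?_
    by_cases hi : i ∈ K
    · simp [b, c, hi]
    · simp only [b, c, hi, if_false]
      have : Tendsto (fun n : ℕ => 1 - p i * severitySurvival (ψ i) n - 1) atTop (𝓝 0) := by
        have := ((((tendsto_severitySurvival (hψ i)).comp tendsto_natCast_atTop_atTop).const_mul
          (p i)).const_sub 1).sub_const 1
        simpa using this
      have := this.abs
      rw [abs_zero] at this
      refine this.congr fun n => ?_
      rw [marginalCDF_of_nonneg _ _ (Nat.cast_nonneg n)]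
  rw [tendsto_nhds_unique h1 h2]
  apply measureReal_congr
  filter_upwards [hκ.ae_mem_Icc] with v hv
  apply propext
  change (∀ i, v i ≤ if i ∈ K then _ else 1) ↔ ∀ i ∈ K, v i ≤ _
  constructor
  · intro h j hj
    simpa [hj] using h j
  · intro h j
    by_cases hj : j ∈ K
    · simpa [hj] using h j hj
    · simpa [hj] using (hv j).2

theorem IsCombBernoulli.ae_nonneg {κ : Measure (Fin d → ℝ)} (hκ : IsCopulaLaw κ)
    {ψ : Fin d → ℝ → ℝ} (hψ : ∀ i, IsSeverityDensity (ψ i)) {p : Fin d → ℝ}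
    {P : Measure (Fin d → ℝ)} (hP : IsCombBernoulli κ ψ p P) : ∀ᵐ z ∂P, ∀ i, 0 ≤ z i := by
  have := hP.prob
  have := hκ.prob
  rw [ae_all_iff]
  intro i
  have h : ∀ n : ℕ, ∀ᵐ z ∂P, ¬ (z i ≤ -(1 / ((n : ℝ) + 1))) := by
    intro n
    have hn : -(1 / ((n : ℝ) + 1)) < 0 := by
      rw [neg_lt_zero]; positivity
    have h1 := hP.measureReal_forall_le hκ hψ {i} (fun _ => -(1 / ((n : ℝ) + 1)))
    simp only [Finset.mem_singleton, forall_eq, marginalCDF_of_neg _ _ hn] at h1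
    have h2 : κ.real {v | v i ≤ 0} = 0 := by
      rw [measureReal_eq_zero_iff, ← nonpos_iff_eq_zero, ← measure_empty (μ := κ)]
      refine measure_mono_ae ?_
      filter_upwards [hκ.ae_mem_Icc, hκ.ae_ne 0] with v hv hv0 hle
      exact (hv0 i (le_antisymm hle (hv i).1)).elim
    rw [h2, measureReal_eq_zero_iff] at h1
    rw [ae_iff]
    simpa using h1
  filter_upwards [ae_all_iff.2 h] with z hz
  by_contra hcon
  obtain ⟨n, hn⟩ := exists_nat_one_div_lt (neg_pos.2 (not_le.1 hcon))
  exact hz n (by linarith)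

/-- Joint tail probabilities of a Comb-Bernoulli vector in terms of the survival copula. -/
theorem IsCombBernoulli.measureReal_forall_lt {κ : Measure (Fin d → ℝ)} (hκ : IsCopulaLaw κ)
    {ψ : Fin d → ℝ → ℝ} (hψ : ∀ i, IsSeverityDensity (ψ i)) {p : Fin d → ℝ}
    {P : Measure (Fin d → ℝ)} (hP : IsCombBernoulli κ ψ p P) (J : Finset (Fin d))
    {a : Fin d → ℝ} (ha : ∀ i ∈ J, 0 ≤ a i) :
    P.real {z | ∀ i ∈ J, a i < z i}
      = restrictedSurvival κ J (fun i => p i * severitySurvival (ψ i) (a i)) := by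
  have := hP.prob
  have := hκ.prob
  have h := measureReal_forall_notMem_congr P κ (A := fun i => {z : Fin d → ℝ | z i ≤ a i})
    (A' := fun i => {v : Fin d → ℝ | v i ≤ marginalCDF (ψ i) (p i) (a i)})
    (fun i => measurableSet_le (measurable_pi_apply i) measurable_const)
    (fun i => measurableSet_le (measurable_pi_apply i) measurable_const)
    (fun K => hP.measureReal_forall_le hκ hψ K a) J
  simp only [Set.mem_ofPred_eq, not_le] at h
  rw [h, hκ.restrictedSurvival_eq]
  apply measureReal_congr
  filter_upwards [hκ.ae_ne (fun i => marginalCDF (ψ i) (p i) (a i))] with v hv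
  apply propext
  refine forall₂_congr fun i hi => ?_
  have hvi := hv i
  rw [marginalCDF_of_nonneg _ _ (ha i hi)] at hvi ⊢
  constructor
  · intro h; linarith
  · intro h
    exact lt_of_le_of_ne (by linarith) (Ne.symm hvi)

/-- The masses of the orthants `{z_j > 0 ∀ j ∈ J}` are the sums of the masses of the faces. -/
theorem measureReal_forall_pos_eq_sum (μ : Measure (Fin d → ℝ)) [IsFiniteMeasure μ]
    (hμ : ∀ᵐ z ∂μ, ∀ i, 0 ≤ z i) (J : Finset (Fin d)) :
    μ.real {z | ∀ j ∈ J, 0 < z j}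
      = ∑ I ∈ Finset.univ.filter (fun I => J ⊆ I), activeProb μ I := by
  classical
  have hmeas : ∀ I : Finset (Fin d),
      MeasurableSet {z : Fin d → ℝ | (∀ i ∈ I, 0 < z i) ∧ ∀ j ∉ I, z j = 0} := by
    intro I
    have h1 : MeasurableSet {z : Fin d → ℝ | ∀ i ∈ I, 0 < z i} := by
      simp only [Set.ofPred_forall]
      exact MeasurableSet.iInter fun i => MeasurableSet.iInter fun _ =>
        measurableSet_lt measurable_const (measurable_pi_apply i)
    have h2 : MeasurableSet {z : Fin d → ℝ | ∀ j ∉ I, z j = 0} := by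
      simp only [Set.ofPred_forall]
      exact MeasurableSet.iInter fun i => MeasurableSet.iInter fun _ =>
        measurableSet_eq_fun (measurable_pi_apply i) measurable_const
    exact h1.inter h2
  simp only [activeProb]
  rw [← measureReal_biUnion_finset]
  · apply measureReal_congr
    filter_upwards [hμ] with z hz
    apply propext
    change (∀ j ∈ J, 0 < z j) ↔ z ∈ ⋃ I ∈ _, _
    simp only [Set.mem_iUnion, Finset.mem_filter, Finset.mem_univ, true_and, Set.mem_ofPred_eq]
    constructor
    · intro h
      refine ⟨activeSet z, fun j hj => by simp [activeSet, h j hj], fun i hi => ?_, fun j hj => ?_⟩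
      · simpa [activeSet] using hi
      · simp only [activeSet, Finset.mem_filter, Finset.mem_univ, true_and, not_lt] at hj
        exact le_antisymm hj (hz j)
    · rintro ⟨I, hJI, h, -⟩ j hj
      exact h j (hJI hj)
  · intro I _ I' _ hne
    rw [Function.onFun, Set.disjoint_left]
    rintro z ⟨h1, h2⟩ ⟨h3, h4⟩
    apply hne
    ext i
    constructor
    · intro hi
      by_contra hi'
      exact (h1 i hi).ne' (h4 i hi')
    · intro hi
      by_contra hi'
      exact (h3 i hi).ne' (h2 i hi')
  · intro I _
    exact hmeas I

/-! ### Lévy copulas and their mixed derivatives -/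

theorem rescaledSurvival_update (κ : Measure (Fin d → ℝ)) {J : Finset (Fin d)} {i : Fin d}
    (hi : i ∉ J) (h : ℝ) (u : Fin d → ℝ) (s : ℝ) :
    rescaledSurvival κ J h (Function.update u i s) = rescaledSurvival κ J h u := by
  have : h • Function.update u i s = Function.update (h • u) i (h * s) := by
    ext k
    by_cases hk : k = i
    · subst hk; simp
    · simp [hk]
  rw [rescaledSurvival, rescaledSurvival, this, restrictedSurvival_update κ hi]

theorem IsCopulaLaw.abs_rescaledSurvival_sub_le {κ : Measure (Fin d → ℝ)} (hκ : IsCopulaLaw κ)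
    (J : Finset (Fin d)) {h : ℝ} (hh : 0 < h) (a b : Fin d → ℝ) :
    |rescaledSurvival κ J h a - rescaledSurvival κ J h b| ≤ ∑ j ∈ J, |a j - b j| := by
  rw [rescaledSurvival, rescaledSurvival, ← sub_div, abs_div, abs_of_pos hh, div_le_iff₀ hh]
  refine (hκ.abs_restrictedSurvival_sub_le J _ _).trans_eq ?_
  rw [Finset.sum_mul]
  refine Finset.sum_congr rfl fun j _ => ?_
  rw [Pi.smul_apply, Pi.smul_apply, smul_eq_mul, smul_eq_mul, ← mul_sub, abs_mul, abs_of_pos hh,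
    mul_comm]

theorem rescaledSurvival_nonneg (κ : Measure (Fin d → ℝ)) (J : Finset (Fin d)) {h : ℝ}
    (hh : 0 < h) (u : Fin d → ℝ) : 0 ≤ rescaledSurvival κ J h u :=
  div_nonneg (restrictedSurvival_nonneg _ _ _) hh.le

theorem IsCopulaLaw.rescaledSurvival_le {κ : Measure (Fin d → ℝ)} (hκ : IsCopulaLaw κ)
    {J : Finset (Fin d)} {j : Fin d} (hj : j ∈ J) {h : ℝ} (hh : 0 < h) {u : Fin d → ℝ}
    (hu : 0 ≤ u j) : rescaledSurvival κ J h u ≤ u j := by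
  rw [rescaledSurvival, div_le_iff₀ hh]
  refine (hκ.restrictedSurvival_le hj ?_).trans_eq ?_
  · exact mul_nonneg hh.le hu
  · simp [mul_comm]

theorem IsTailRegular.tendsto_rescaledSurvival {κ : Measure (Fin d → ℝ)} (hκ : IsCopulaLaw κ)
    (hreg : IsTailRegular κ) {J : Finset (Fin d)} (hJ : J.Nonempty) {u : Fin d → ℝ}
    (hu : ∀ j ∈ J, 0 ≤ u j) :
    Tendsto (fun h => rescaledSurvival κ J h u) (𝓝[>] (0 : ℝ)) (𝓝 (levyCopula κ J u)) := by
  apply tendsto_nhds_limUnder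
  by_cases h0 : ∀ j ∈ J, 0 < u j
  · exact hreg.exists_limit J hJ u h0
  · push Not at h0
    obtain ⟨j, hj, hj0⟩ := h0
    refine ⟨0, tendsto_const_nhds.congr' ?_⟩
    filter_upwards [self_mem_nhdsWithin] with h hh
    refine le_antisymm (rescaledSurvival_nonneg κ J hh u) ?_
    exact (hκ.rescaledSurvival_le hj hh (hu j hj)).trans hj0

/-- A Lévy copula depends on its own coordinates only. -/
theorem levyCopula_congr (κ : Measure (Fin d → ℝ)) {J : Finset (Fin d)} {u w : Fin d → ℝ}
    (h : ∀ j ∈ J, u j = w j) : levyCopula κ J u = levyCopula κ J w := by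
  have : ∀ t, rescaledSurvival κ J t u = rescaledSurvival κ J t w := by
    intro t
    simp only [rescaledSurvival, restrictedSurvival]
    congr 2
    ext i
    split_ifs with hi
    · simp [h i hi]
    · rfl
  simp only [levyCopula, this]

theorem IsTailRegular.levyCopula_nonneg {κ : Measure (Fin d → ℝ)} (hκ : IsCopulaLaw κ)
    (hreg : IsTailRegular κ) {J : Finset (Fin d)} (hJ : J.Nonempty) {u : Fin d → ℝ}
    (hu : ∀ j ∈ J, 0 ≤ u j) : 0 ≤ levyCopula κ J u := by
  refine ge_of_tendsto (hreg.tendsto_rescaledSurvival hκ hJ hu) ?_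
  filter_upwards [self_mem_nhdsWithin] with h hh using rescaledSurvival_nonneg κ J hh u

theorem IsTailRegular.levyCopula_le {κ : Measure (Fin d → ℝ)} (hκ : IsCopulaLaw κ)
    (hreg : IsTailRegular κ) {J : Finset (Fin d)} {u : Fin d → ℝ}
    (hu : ∀ j ∈ J, 0 ≤ u j) {j : Fin d} (hj : j ∈ J) : levyCopula κ J u ≤ u j := by
  refine le_of_tendsto (hreg.tendsto_rescaledSurvival hκ ⟨j, hj⟩ hu) ?_
  filter_upwards [self_mem_nhdsWithin] with h hh using hκ.rescaledSurvival_le hj hh (hu j hj)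

theorem isOpen_setOf_forall_mem {I : Finset (Fin d)} {A : Fin d → Set ℝ}
    (hA : ∀ i, IsOpen (A i)) : IsOpen {u : Fin d → ℝ | ∀ i ∈ I, u i ∈ A i} := by
  simp only [Set.ofPred_forall]
  exact isOpen_biInter_finset fun i _ => (hA i).preimage (continuous_apply i)

theorem IsTailRegular.exists_mixedDiffOn_rescaledSurvival {κ : Measure (Fin d → ℝ)}
    (hreg : IsTailRegular κ) : ∃ r > (0 : ℝ), ∀ h > (0 : ℝ), ∀ J I : Finset (Fin d),
      MixedDiffOn I {u | ∀ j ∈ J, u j ∈ Set.Ioo 0 (r / h)} (rescaledSurvival κ J h) := by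
  obtain ⟨r, hr, hd⟩ := hreg.differentiable
  refine ⟨r, hr, fun h hh J I => ?_⟩
  have h1 : MixedDiffOn (I ∩ J) {u | ∀ j ∈ J, 0 < u j ∧ u j < r} (restrictedSurvival κ J) := by
    intro s hs i hi hlt u hu
    exact hd J s (hs.trans Finset.inter_subset_right) i (Finset.mem_inter.1 hi).2 hlt u hu
  have hW : IsOpen {u : Fin d → ℝ | ∀ j ∈ J, u j ∈ Set.Ioo 0 (r / h)} :=
    isOpen_setOf_forall_mem fun _ => isOpen_Ioo
  have h2 := h1.coordwise hW (fun _ x => h * x)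
    (fun y hy j hj => ⟨mul_pos hh (hy j hj).1, by
      change h * y j < r
      rw [mul_comm, ← lt_div_iff₀ hh]; exact (hy j hj).2⟩)
    (fun _ _ _ _ => by fun_prop)
  have h3 := MixedDiffOn.sum (S := ({()} : Finset Unit)) (c := fun _ => 1 / h) hW
    (fun _ _ => h2)
  have h4 : (fun u => ∑ _k ∈ ({()} : Finset Unit), 1 / h *
      restrictedSurvival κ J (fun i => h * u i)) = rescaledSurvival κ J h := by
    ext u
    rw [Finset.sum_singleton, rescaledSurvival, div_mul_eq_mul_div, one_mul]
    rfl
  rw [h4] at h3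
  exact h3.of_inter fun i hi u s => rescaledSurvival_update κ hi h u s

/-- Near `0+`, the rescaled survival copulas have mixed derivatives at the points of any box. -/
theorem IsTailRegular.eventually_mixedDiffOn_rescaledSurvival {κ : Measure (Fin d → ℝ)}
    (hreg : IsTailRegular κ) (M : ℝ) : ∀ᶠ h in 𝓝[>] (0 : ℝ), ∀ J I : Finset (Fin d),
      MixedDiffOn I {u | ∀ j ∈ J, u j ∈ Set.Ioo 0 M} (rescaledSurvival κ J h) := by
  obtain ⟨r, hr, hd⟩ := hreg.exists_mixedDiffOn_rescaledSurvival
  have : ∀ᶠ h in 𝓝[>] (0 : ℝ), h < r / (|M| + 1) :=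
    mem_nhdsWithin_of_mem_nhds (Iio_mem_nhds (by positivity))
  filter_upwards [self_mem_nhdsWithin, this] with h hh hlt J I
  refine (hd h hh J I).mono subset_rfl fun u hu j hj => ⟨(hu j hj).1, (hu j hj).2.trans ?_⟩
  rw [lt_div_iff₀ (by positivity)] at hlt
  rw [lt_div_iff₀ hh]
  have hh' : (0 : ℝ) < h := hh
  nlinarith [le_abs_self M]

/-- The mixed derivatives of the rescaled survival copulas converge to those of the Lévy copula. -/
theorem IsTailRegular.tendsto_mixedPartial {κ : Measure (Fin d → ℝ)} (hκ : IsCopulaLaw κ)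
    (hreg : IsTailRegular κ) {J : Finset (Fin d)} (hJ : J.Nonempty) {I : Finset (Fin d)}
    (hI : I ⊆ J) : ∀ u : Fin d → ℝ, (∀ j ∈ J, 0 < u j) →
      Tendsto (fun h => mixedPartial I (rescaledSurvival κ J h) u) (𝓝[>] (0 : ℝ))
        (𝓝 (mixedPartial I (levyCopula κ J) u)) ∧
      ∀ i ∈ J, (∀ j ∈ I, i < j) → DifferentiableAt ℝ
        (fun s => mixedPartial I (levyCopula κ J) (Function.update u i s)) (u i) ∧
      Tendsto (fun h => mixedPartial (insert i I) (rescaledSurvival κ J h) u) (𝓝[>] (0 : ℝ))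
        (𝓝 (mixedPartial (insert i I) (levyCopula κ J) u)) := by
  -- convergence at stage `I` gives differentiability at stage `I` and convergence one stage later
  have key : ∀ I : Finset (Fin d), I ⊆ J → (∀ u : Fin d → ℝ, (∀ j ∈ J, 0 < u j) →
      Tendsto (fun h => mixedPartial I (rescaledSurvival κ J h) u) (𝓝[>] (0 : ℝ))
        (𝓝 (mixedPartial I (levyCopula κ J) u))) →
      ∀ u : Fin d → ℝ, (∀ j ∈ J, 0 < u j) → ∀ i ∈ J, (∀ j ∈ I, i < j) → DifferentiableAt ℝ
        (fun s => mixedPartial I (levyCopula κ J) (Function.update u i s)) (u i) ∧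
      Tendsto (fun h => mixedPartial (insert i I) (rescaledSurvival κ J h) u) (𝓝[>] (0 : ℝ))
        (𝓝 (mixedPartial (insert i I) (levyCopula κ J) u)) := by
    intro I hI hlim u hu i hi hlt
    have hopen : IsOpen {u : Fin d → ℝ | ∀ j ∈ J, u j ∈ Set.Ioi 0} :=
      isOpen_setOf_forall_mem fun _ => isOpen_Ioi
    let M : ℝ := ∑ j, |u j| + 1
    have hopenM : IsOpen {u : Fin d → ℝ | ∀ j ∈ J, u j ∈ Set.Ioo 0 M} :=
      isOpen_setOf_forall_mem fun _ => isOpen_Ioo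
    have huM : u ∈ {u : Fin d → ℝ | ∀ j ∈ J, u j ∈ Set.Ioo 0 M} := by
      intro j hj
      refine ⟨hu j hj, ?_⟩
      have := Finset.single_le_sum (f := fun i => |u i|) (fun i _ => abs_nonneg _)
        (Finset.mem_univ j)
      have h2 := le_abs_self (u j)
      simp only [M]
      linarith
    simp only [mixedPartial_insert_min hlt]
    refine differentiableAt_and_tendsto_deriv_of_equicontinuous
      (F := fun h s => mixedPartial I (rescaledSurvival κ J h) (Function.update u i s)) ?_ ?_ ?_
    · filter_upwards [eventually_update_mem hopen hu i] with s hs using hlim _ hs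
    · obtain ⟨δ, hδ, hs⟩ := Metric.eventually_nhds_iff.1 (eventually_update_mem hopenM huM i)
      refine ⟨δ, hδ, ?_⟩
      filter_upwards [hreg.eventually_mixedDiffOn_rescaledSurvival M] with h hh s hsd
      have := hh J J I hI i hi hlt _ (hs (by rwa [Real.dist_eq]))
      simpa using this
    · intro ε hε
      obtain ⟨δ, hδ, he⟩ := hreg.equicontinuous J (insert i I) (Finset.insert_subset hi hI)
        ⟨i, Finset.mem_insert_self _ _⟩ u hu ε hε
      refine ⟨δ, hδ, ?_⟩
      filter_upwards [he] with h hh s hs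
      have := hh (Function.update u i s) (fun j hj => by
        by_cases hji : j = i
        · subst hji; simpa using hs
        · simpa [hji] using hδ)
      rw [mixedPartial_insert_min hlt] at this
      simpa [partialDeriv] using this
  have main : ∀ I : Finset (Fin d), I ⊆ J → ∀ u : Fin d → ℝ, (∀ j ∈ J, 0 < u j) →
      Tendsto (fun h => mixedPartial I (rescaledSurvival κ J h) u) (𝓝[>] (0 : ℝ))
        (𝓝 (mixedPartial I (levyCopula κ J) u)) := by
    intro I
    induction I using Finset.induction_on_min with
    | empty =>
      intro _ u hu
      simpa only [mixedPartial_empty] using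
        hreg.tendsto_rescaledSurvival hκ hJ fun j hj => (hu j hj).le
    | insert a s ha ih =>
      intro hsub u hu
      have hs : s ⊆ J := (Finset.subset_insert _ _).trans hsub
      exact (key s hs (ih hs) u hu a (hsub (Finset.mem_insert_self _ _)) ha).2
  exact fun u hu => ⟨main I hI u hu, key I hI (main I hI) u hu⟩

theorem IsTailRegular.mixedDiffOn_levyCopula {κ : Measure (Fin d → ℝ)} (hκ : IsCopulaLaw κ)
    (hreg : IsTailRegular κ) (J : Finset (Fin d)) :
    MixedDiffOn J {u | ∀ j ∈ J, 0 < u j} (levyCopula κ J) := by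
  intro I hI i hi hlt u hu
  exact ((hreg.tendsto_mixedPartial hκ ⟨i, hi⟩ hI u hu).2 i hi hlt).1

/-- Mixed derivatives of the rescaled survival copulas converge along converging arguments. -/
theorem IsTailRegular.tendsto_mixedPartial_of_tendsto {κ : Measure (Fin d → ℝ)}
    (hκ : IsCopulaLaw κ) (hreg : IsTailRegular κ) {J I : Finset (Fin d)} (hI : I ⊆ J)
    (hne : I.Nonempty) {u : Fin d → ℝ} (hu : ∀ j ∈ J, 0 < u j) {α : Type*} {l : Filter α}
    {h : α → ℝ} (hh : Tendsto h l (𝓝[>] 0)) {w : α → Fin d → ℝ} (hw : Tendsto w l (𝓝 u)) :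
    Tendsto (fun a => mixedPartial I (rescaledSurvival κ J (h a)) (w a)) l
      (𝓝 (mixedPartial I (levyCopula κ J) u)) := by
  rw [Metric.tendsto_nhds]
  intro ε hε
  obtain ⟨δ, hδ, he⟩ := hreg.equicontinuous J I hI hne u hu (ε / 2) (half_pos hε)
  have h1 := (hreg.tendsto_mixedPartial hκ (hne.mono hI) hI u hu).1.comp hh
  filter_upwards [hh.eventually he, Metric.tendsto_nhds.1 h1 (ε / 2) (half_pos hε),
    Metric.tendsto_nhds.1 hw δ hδ] with a ha hb hc
  have h2 := ha (w a) (fun j _ => by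
    rw [← Real.dist_eq]; exact (dist_le_pi_dist _ _ j).trans_lt hc)
  rw [← Real.dist_eq] at h2
  calc dist _ _ ≤ _ := dist_triangle _ (mixedPartial I (rescaledSurvival κ J (h a)) u) _
    _ < ε / 2 + ε / 2 := add_lt_add_of_le_of_lt h2 hb
    _ = ε := add_halves ε

theorem IsTailRegular.continuousOn_mixedPartial {κ : Measure (Fin d → ℝ)}
    (hκ : IsCopulaLaw κ) (hreg : IsTailRegular κ) {J I : Finset (Fin d)} (hI : I ⊆ J)
    (hne : I.Nonempty) :
    ContinuousOn (mixedPartial I (levyCopula κ J)) {u | ∀ j ∈ J, 0 < u j} := by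
  intro u hu
  have hopen : IsOpen {u : Fin d → ℝ | ∀ j ∈ J, u j ∈ Set.Ioi 0} :=
    isOpen_setOf_forall_mem fun _ => isOpen_Ioi
  refine ContinuousAt.continuousWithinAt ?_
  rw [ContinuousAt, Metric.tendsto_nhds]
  intro ε hε
  obtain ⟨δ, hδ, he⟩ := hreg.equicontinuous J I hI hne u hu (ε / 2) (half_pos hε)
  filter_upwards [Metric.ball_mem_nhds u hδ, hopen.mem_nhds hu] with v hv hv0
  have h1 := (hreg.tendsto_mixedPartial hκ (hne.mono hI) hI u hu).1
  have h2 := (hreg.tendsto_mixedPartial hκ (hne.mono hI) hI v hv0).1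
  have h3 := le_of_tendsto (h2.sub h1).abs (he.mono fun h hh => hh v fun j _ => by
    rw [← Real.dist_eq]; exact (dist_le_pi_dist _ _ j).trans_lt hv)
  rw [Real.dist_eq]
  linarith

theorem IsTailRegular.tendsto_rescaledSurvival_of_tendsto {κ : Measure (Fin d → ℝ)}
    (hκ : IsCopulaLaw κ) (hreg : IsTailRegular κ) {J : Finset (Fin d)}
    (hne : J.Nonempty) {u : Fin d → ℝ} (hu : ∀ j ∈ J, 0 ≤ u j) {α : Type*} {l : Filter α}
    {h : α → ℝ} (hh : Tendsto h l (𝓝[>] 0)) {w : α → Fin d → ℝ} (hw : Tendsto w l (𝓝 u)) :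
    Tendsto (fun a => rescaledSurvival κ J (h a) (w a)) l (𝓝 (levyCopula κ J u)) := by
  have h1 := (hreg.tendsto_rescaledSurvival hκ hne hu).comp hh
  have h2 : Tendsto (fun a => rescaledSurvival κ J (h a) (w a) - rescaledSurvival κ J (h a) u) l
      (𝓝 0) := by
    have h3 : Tendsto (fun a => ∑ j ∈ J, |w a j - u j|) l (𝓝 0) := by
      rw [← Finset.sum_const_zero (s := J)]
      refine tendsto_finsetSum _ fun j _ => ?_
      have := ((tendsto_pi_nhds.1 hw j).sub_const (u j)).abs
      simpa using this
    refine squeeze_zero_norm' ?_ h3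
    filter_upwards [hh.eventually self_mem_nhdsWithin] with a ha
    exact hκ.abs_rescaledSurvival_sub_le J ha _ _
  simpa using h2.add h1

/-! ### The likelihood of one observation -/

theorem mem_activeSet {x : Fin d → ℝ} {i : Fin d} : i ∈ activeSet x ↔ 0 < x i := by
  simp [activeSet]

theorem eq_zero_of_notMem_activeSet {x : Fin d → ℝ} (hx : ∀ i, 0 ≤ x i) {i : Fin d}
    (hi : i ∉ activeSet x) : x i = 0 :=
  le_antisymm (not_lt.1 fun h => hi (mem_activeSet.2 h)) (hx i)

/-- Inclusion–exclusion over the marginal tails expresses the distribution function of the active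
coordinates, jointly with the vanishing of the others, through the survival copulas. -/
theorem IsCombBernoulli.measureReal_face_le {κ : Measure (Fin d → ℝ)} (hκ : IsCopulaLaw κ)
    {ψ : Fin d → ℝ → ℝ} (hψ : ∀ i, IsSeverityDensity (ψ i)) {h : ℝ} (hh : 0 < h) {q : Fin d → ℝ}
    {P : Measure (Fin d → ℝ)} (hP : IsCombBernoulli κ ψ (fun i => h * q i) P)
    (I : Finset (Fin d)) {y : Fin d → ℝ} (hy : ∀ i ∈ I, 0 ≤ y i) :
    P.real {z | (∀ i ∈ I, z i ≤ y i) ∧ ∀ j ∉ I, z j = 0}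
      = ∑ K : Finset (Fin d), (h * (-1) ^ K.card) * rescaledSurvival κ K h
          (fun i => if i ∈ I then q i * severitySurvival (ψ i) (y i) else q i) := by
  have := hP.prob
  let a : Fin d → ℝ := fun i => if i ∈ I then y i else 0
  have ha : ∀ i, 0 ≤ a i := by
    intro i
    by_cases hi : i ∈ I
    · simpa [a, hi] using hy i hi
    · simp [a, hi]
  have h1 : P.real {z | (∀ i ∈ I, z i ≤ y i) ∧ ∀ j ∉ I, z j = 0}
      = P.real {z | z ∈ Set.univ ∧ ∀ i ∈ Finset.univ, z ∉ {z : Fin d → ℝ | a i < z i}} := by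
    apply measureReal_congr
    filter_upwards [hP.ae_nonneg hκ hψ] with z hz
    apply propext
    change ((∀ i ∈ I, z i ≤ y i) ∧ ∀ j ∉ I, z j = 0)
      ↔ (True ∧ ∀ i ∈ Finset.univ, ¬ (a i < z i))
    simp only [Finset.mem_univ, true_and, forall_const, not_lt]
    constructor
    · rintro ⟨h1, h2⟩ i
      by_cases hi : i ∈ I
      · simpa [a, hi] using h1 i hi
      · simpa [a, hi] using (h2 i hi).le
    · intro h
      refine ⟨fun i hi => by simpa [a, hi] using h i, fun i hi => le_antisymm ?_ (hz i)⟩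
      simpa [a, hi] using h i
  rw [h1, measureReal_notMem_eq_sum_powerset P
    (fun i => measurableSet_lt measurable_const (measurable_pi_apply i)), Finset.powerset_univ]
  refine Finset.sum_congr rfl fun K _ => ?_
  have h2 := hP.measureReal_forall_lt hκ hψ K (fun i _ => ha i)
  simp only [Set.mem_univ, true_and, Set.mem_ofPred_eq]
  rw [h2, rescaledSurvival, mul_comm h, mul_assoc, mul_div_cancel₀ _ hh.ne']
  congr 2
  ext i
  by_cases hi : i ∈ I
  · simp [a, hi, mul_assoc]
  · simp [a, hi, severitySurvival_zero]

theorem IsCombBernoulli.obsLikelihood_eq {κ : Measure (Fin d → ℝ)} (hκ : IsCopulaLaw κ)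
    {ψ : Fin d → ℝ → ℝ} (hψ : ∀ i, IsSeverityDensity (ψ i)) {h : ℝ} (hh : 0 < h) {q : Fin d → ℝ}
    {P : Measure (Fin d → ℝ)} (hP : IsCombBernoulli κ ψ (fun i => h * q i) P) {M : ℝ}
    (hM : ∀ J I : Finset (Fin d),
      MixedDiffOn I {u | ∀ j ∈ J, u j ∈ Set.Ioo 0 M} (rescaledSurvival κ J h))
    (hq : ∀ i, q i ∈ Set.Ioo 0 M) {x : Fin d → ℝ} (hx : ∀ i, 0 ≤ x i)
    (hxψ : ∀ i ∈ activeSet x, 0 < ψ i (x i)) :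
    obsLikelihood P x = h * ((∏ i ∈ activeSet x, q i * ψ i (x i)) *
      ∑ K ∈ Finset.univ.filter (fun K : Finset (Fin d) => activeSet x ⊆ K),
        (-1) ^ (K.card + (activeSet x).card) * mixedPartial (activeSet x)
          (rescaledSurvival κ K h) (fun i => q i * severitySurvival (ψ i) (x i))) := by
  set I := activeSet x with hI
  let φ : Fin d → ℝ → ℝ := fun i s => if i ∈ I then q i * severitySurvival (ψ i) s else q i
  let W' : Set (Fin d → ℝ) := {u | ∀ j ∈ Finset.univ, u j ∈ Set.Ioo 0 M}
  let A : Fin d → Set ℝ := fun i => Set.Ioi 0 ∩ severitySurvival (ψ i) ⁻¹' Set.Ioi 0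
  let W : Set (Fin d → ℝ) := {y | ∀ i ∈ I, y i ∈ A i}
  have hA : ∀ i, IsOpen (A i) := fun i =>
    ContinuousOn.isOpen_inter_preimage (fun s hs =>
      (hasDerivAt_severitySurvival (hψ i) hs).continuousAt.continuousWithinAt) isOpen_Ioi isOpen_Ioi
  have hW : IsOpen W := isOpen_setOf_forall_mem hA
  have hW' : IsOpen W' := isOpen_setOf_forall_mem fun _ => isOpen_Ioo
  have hxW : x ∈ W := fun i hi =>
    ⟨mem_activeSet.1 hi, severitySurvival_pos (hψ i) (mem_activeSet.1 hi) (hxψ i hi)⟩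
  have hφ : ∀ y ∈ W, (fun i => φ i (y i)) ∈ W' := by
    intro y hy i _
    by_cases hi : i ∈ I
    · simp only [φ, hi, if_true]
      have h0 : (0 : ℝ) < y i := (hy i hi).1
      have h1 : 0 < severitySurvival (ψ i) (y i) := (hy i hi).2
      have h2 := severitySurvival_antitoneOn (hψ i) le_rfl h0.le
      rw [severitySurvival_zero] at h2
      exact ⟨mul_pos (hq i).1 h1, (mul_le_of_le_one_right (hq i).1.le h2).trans_lt (hq i).2⟩
    · simp only [φ, hi, if_false]
      exact hq i
  have hder : ∀ y ∈ W, ∀ i ∈ I, HasDerivAt (φ i) (q i * -ψ i (y i)) (y i) := by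
    intro y hy i hi
    have : φ i = fun s => q i * severitySurvival (ψ i) s := by
      ext s; simp [φ, hi]
    rw [this]
    exact (hasDerivAt_severitySurvival (hψ i) (hy i hi).1).const_mul _
  have hF : ∀ K ∈ (Finset.univ : Finset (Finset (Fin d))),
      MixedDiffOn I W' (rescaledSurvival κ K h) := fun K _ =>
    (hM K I).mono subset_rfl fun u hu j _ => hu j (Finset.mem_univ j)
  have e1 : obsLikelihood P x = mixedPartial I (fun y => (fun u => ∑ K ∈ Finset.univ,
      (h * (-1) ^ K.card) * rescaledSurvival κ K h u) (fun i => φ i (y i))) x :=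
    mixedPartial_congr hW (fun y hy =>
      hP.measureReal_face_le hκ hψ hh I fun i hi => le_of_lt (hy i hi).1) I x hxW
  rw [e1, mixedPartial_coordwise (MixedDiffOn.sum hW' hF) hW φ hφ
    (fun y hy i hi => (hder y hy i hi).differentiableAt) subset_rfl x hxW,
    mixedPartial_sum hW' hF subset_rfl _ (hφ x hxW)]
  have e2 : (fun i => φ i (x i)) = fun i => q i * severitySurvival (ψ i) (x i) := by
    ext i
    by_cases hi : i ∈ I
    · simp [φ, hi]
    · simp [φ, hi, eq_zero_of_notMem_activeSet hx hi, severitySurvival_zero]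
  have e3 : ∏ i ∈ I, deriv (φ i) (x i) = (-1) ^ I.card * ∏ i ∈ I, q i * ψ i (x i) := by
    rw [← Finset.prod_const, ← Finset.prod_mul_distrib]
    refine Finset.prod_congr rfl fun i hi => ?_
    rw [(hder x hxW i hi).deriv]; ring
  rw [e2, e3, ← Finset.sum_filter_add_sum_filter_not Finset.univ (fun K => I ⊆ K),
    Finset.sum_eq_zero (s := Finset.univ.filter fun K => ¬ I ⊆ K), add_zero, Finset.mul_sum,
    Finset.mul_sum, Finset.mul_sum]
  · refine Finset.sum_congr rfl fun K _ => ?_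
    rw [pow_add]; ring
  · intro K hK
    obtain ⟨i, hiI, hiK⟩ := Finset.not_subset.1 (Finset.mem_filter.1 hK).2
    rw [mixedPartial_eq_zero_of_forall (fun u s => rescaledSurvival_update κ hiK h u s) hiI,
      mul_zero]

theorem IsCopulaLaw.restrictedSurvival_singleton {κ : Measure (Fin d → ℝ)} (hκ : IsCopulaLaw κ)
    (i : Fin d) {u : Fin d → ℝ} (h0 : 0 ≤ u i) (h1 : u i ≤ 1) :
    restrictedSurvival κ {i} u = u i := by
  rw [hκ.restrictedSurvival_eq]
  have e : {v : Fin d → ℝ | ∀ j ∈ ({i} : Finset (Fin d)), 1 - v j ≤ u j}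
      = {v | v i ∈ Set.Ici (1 - u i)} := by
    ext v
    simp only [Finset.mem_singleton, forall_eq, Set.mem_ofPred_eq, Set.mem_Ici]
    exact sub_le_comm
  rw [e, Measure.real, hκ.apply_eval i measurableSet_Ici]
  have e2 : Set.Ici (1 - u i) ∩ Set.Icc 0 1 = Set.Icc (1 - u i) 1 := by
    ext t
    simp only [Set.mem_inter_iff, Set.mem_Ici, Set.mem_Icc]
    constructor
    · rintro ⟨a, -, b⟩; exact ⟨a, b⟩
    · rintro ⟨a, b⟩; exact ⟨a, by linarith, b⟩
  rw [e2, Real.volume_Icc, sub_sub_cancel, ENNReal.toReal_ofReal h0]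

theorem IsCombBernoulli.sum_activeProb {κ : Measure (Fin d → ℝ)} (hκ : IsCopulaLaw κ)
    {ψ : Fin d → ℝ → ℝ} (hψ : ∀ i, IsSeverityDensity (ψ i)) {p : Fin d → ℝ}
    {P : Measure (Fin d → ℝ)} (hP : IsCombBernoulli κ ψ p P) (J : Finset (Fin d)) :
    ∑ I ∈ Finset.univ.filter (fun I => J ⊆ I), activeProb P I = restrictedSurvival κ J p := by
  have := hP.prob
  rw [← measureReal_forall_pos_eq_sum P (hP.ae_nonneg hκ hψ),
    hP.measureReal_forall_lt hκ hψ J (a := fun _ => 0) (fun _ _ => le_rfl)]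
  simp [severitySurvival_zero]

/-- The occurrence probability of a component is the sum of the probabilities of the active sets
that contain it. -/
theorem IsCombBernoulli.eq_sum_activeProb {κ : Measure (Fin d → ℝ)} (hκ : IsCopulaLaw κ)
    {ψ : Fin d → ℝ → ℝ} (hψ : ∀ i, IsSeverityDensity (ψ i)) {p : Fin d → ℝ}
    {P : Measure (Fin d → ℝ)} (hP : IsCombBernoulli κ ψ p P) (i : Fin d) :
    p i = ∑ I ∈ Finset.univ.filter (fun I => i ∈ I), activeProb P I := by
  have h := hP.sum_activeProb hκ hψ {i}
  rw [hκ.restrictedSurvival_singleton i (hP.p_pos i).le (hP.p_le_one i)] at h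
  simpa using h.symm

theorem IsCombBernoulli.obsLikelihood_zero {κ : Measure (Fin d → ℝ)} (hκ : IsCopulaLaw κ)
    {ψ : Fin d → ℝ → ℝ} (hψ : ∀ i, IsSeverityDensity (ψ i)) {p : Fin d → ℝ}
    {P : Measure (Fin d → ℝ)} (hP : IsCombBernoulli κ ψ p P) :
    obsLikelihood P 0
      = 1 - ∑ I ∈ Finset.univ.filter (fun I : Finset (Fin d) => I.Nonempty), activeProb P I := by
  have := hP.prob
  have h0 : activeSet (0 : Fin d → ℝ) = ∅ := by ext i; simp [mem_activeSet]
  have h1 : obsLikelihood P 0 = activeProb P ∅ := by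
    rw [obsLikelihood, h0, mixedPartial_empty, activeProb]
    simp
  have h2 := hP.sum_activeProb hκ hψ ∅
  have h3 : restrictedSurvival κ ∅ p = 1 := by
    have := hκ.prob
    rw [hκ.restrictedSurvival_eq]
    simp
  rw [h3] at h2
  simp only [Finset.empty_subset, Finset.filter_true] at h2
  rw [← Finset.sum_filter_add_sum_filter_not Finset.univ
    (fun I : Finset (Fin d) => I.Nonempty)] at h2
  have h4 : Finset.univ.filter (fun I : Finset (Fin d) => ¬ I.Nonempty) = {∅} := by
    ext I; simp [Finset.not_nonempty_iff_eq_empty]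
  rw [h4, Finset.sum_singleton] at h2
  rw [h1]; linarith

/-! ### Poisson scaling -/

section Scaling

variable {κ : Measure (Fin d → ℝ)} {ψ : Fin d → ℝ → ℝ} {T : ℝ} {lam : Finset (Fin d) → ℝ}
  {p : ℕ → Fin d → ℝ} {P : ℕ → Measure (Fin d → ℝ)}

theorem tendsto_step (hT : 0 < T) : Tendsto (fun N : ℕ => T / (N : ℝ)) atTop (𝓝[>] 0) := by
  refine tendsto_nhdsWithin_iff.2 ⟨tendsto_const_div_atTop_nhds_zero_nat T, ?_⟩
  filter_upwards [eventually_gt_atTop 0] with N hN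
  have : (0 : ℝ) < N := by exact_mod_cast hN
  exact div_pos hT this

theorem tendsto_occurrence_div (hκ : IsCopulaLaw κ) (hψ : ∀ i, IsSeverityDensity (ψ i))
    (hP : ∀ᶠ N in atTop, IsCombBernoulli κ ψ (p N) (P N))
    (hscale : ∀ I : Finset (Fin d), I.Nonempty →
      Tendsto (fun N : ℕ => activeProb (P N) I / (T / N)) atTop (𝓝 (lam I))) :
    Tendsto (fun (N : ℕ) i => p N i / (T / N)) atTop (𝓝 (intensity lam)) := by
  rw [tendsto_pi_nhds]
  intro i
  have h1 : Tendsto (fun N : ℕ => ∑ I ∈ Finset.univ.filter (fun I : Finset (Fin d) => i ∈ I),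
      activeProb (P N) I / (T / N)) atTop (𝓝 (intensity lam i)) :=
    tendsto_finsetSum _ fun I hI => hscale I ⟨i, (Finset.mem_filter.1 hI).2⟩
  refine h1.congr' ?_
  filter_upwards [hP] with N hN
  rw [hN.eq_sum_activeProb hκ hψ i, Finset.sum_div]

/-- The upper sums of the intensities of the active sets are the values of the Lévy copulas. -/
theorem sum_lam_eq_levyCopula (hκ : IsCopulaLaw κ) (hreg : IsTailRegular κ)
    (hψ : ∀ i, IsSeverityDensity (ψ i)) (hT : 0 < T) (hlam : ∀ i, 0 < intensity lam i)
    (hP : ∀ᶠ N in atTop, IsCombBernoulli κ ψ (p N) (P N))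
    (hscale : ∀ I : Finset (Fin d), I.Nonempty →
      Tendsto (fun N : ℕ => activeProb (P N) I / (T / N)) atTop (𝓝 (lam I)))
    {J : Finset (Fin d)} (hJ : J.Nonempty) :
    ∑ I ∈ Finset.univ.filter (fun I => J ⊆ I), lam I = levyCopula κ J (intensity lam) := by
  have h1 : Tendsto (fun N : ℕ => ∑ I ∈ Finset.univ.filter (fun I : Finset (Fin d) => J ⊆ I),
      activeProb (P N) I / (T / N)) atTop (𝓝 (∑ I ∈ Finset.univ.filter (fun I => J ⊆ I), lam I)) :=
    tendsto_finsetSum _ fun I hI => hscale I (hJ.mono (Finset.mem_filter.1 hI).2)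
  have h2 := hreg.tendsto_rescaledSurvival_of_tendsto hκ hJ (fun j _ => (hlam j).le)
    (tendsto_step hT) (tendsto_occurrence_div hκ hψ hP hscale)
  refine tendsto_nhds_unique h1 (h2.congr' ?_)
  filter_upwards [hP, (tendsto_step hT).eventually self_mem_nhdsWithin] with N hN hpos
  have hpos' : (0 : ℝ) < T / N := hpos
  rw [← Finset.sum_div, hN.sum_activeProb hκ hψ, rescaledSurvival]
  congr 2
  ext i
  rw [Pi.smul_apply, smul_eq_mul, mul_div_cancel₀ _ hpos'.ne']

/-- The likelihood of a non-zero observation, divided by the time step, converges. -/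
theorem tendsto_obsLikelihood_div (hκ : IsCopulaLaw κ) (hreg : IsTailRegular κ)
    (hψ : ∀ i, IsSeverityDensity (ψ i)) (hT : 0 < T) (hlam : ∀ i, 0 < intensity lam i)
    (hP : ∀ᶠ N in atTop, IsCombBernoulli κ ψ (p N) (P N))
    (hscale : ∀ I : Finset (Fin d), I.Nonempty →
      Tendsto (fun N : ℕ => activeProb (P N) I / (T / N)) atTop (𝓝 (lam I)))
    {x : Fin d → ℝ} (hx : ∀ i, 0 ≤ x i) (hne : (activeSet x).Nonempty)
    (hxψ : ∀ i ∈ activeSet x, 0 < ψ i (x i)) :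
    Tendsto (fun N : ℕ => obsLikelihood (P N) x / (T / N)) atTop
      (𝓝 (zeta κ ψ lam x * ∏ i ∈ activeSet x, intensity lam i * ψ i (x i))) := by
  have hq := tendsto_occurrence_div hκ hψ hP hscale
  have hu : ∀ i, 0 < intensity lam i * severitySurvival (ψ i) (x i) := by
    intro i
    refine mul_pos (hlam i) ?_
    by_cases hi : i ∈ activeSet x
    · exact severitySurvival_pos (hψ i) (mem_activeSet.1 hi) (hxψ i hi)
    · rw [eq_zero_of_notMem_activeSet hx hi, severitySurvival_zero]; exact one_pos
  have hw : Tendsto (fun (N : ℕ) i => p N i / (T / N) * severitySurvival (ψ i) (x i)) atTop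
      (𝓝 (fun i => intensity lam i * severitySurvival (ψ i) (x i))) :=
    tendsto_pi_nhds.2 fun i => (tendsto_pi_nhds.1 hq i).mul_const _
  have h1 : Tendsto (fun N : ℕ => (∏ i ∈ activeSet x, p N i / (T / N) * ψ i (x i)) *
      ∑ K ∈ Finset.univ.filter (fun K : Finset (Fin d) => activeSet x ⊆ K),
        (-1) ^ (K.card + (activeSet x).card) * mixedPartial (activeSet x)
          (rescaledSurvival κ K (T / N))
            (fun i => p N i / (T / N) * severitySurvival (ψ i) (x i))) atTop
      (𝓝 ((∏ i ∈ activeSet x, intensity lam i * ψ i (x i)) * zeta κ ψ lam x)) := by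
    refine (tendsto_finsetProd _ fun i _ => (tendsto_pi_nhds.1 hq i).mul_const _).mul
      (tendsto_finsetSum _ fun K hK => Tendsto.const_mul _ ?_)
    exact hreg.tendsto_mixedPartial_of_tendsto hκ (Finset.mem_filter.1 hK).2 hne
      (fun j _ => hu j) (tendsto_step hT) hw
  rw [mul_comm] at h1
  refine h1.congr' ?_
  let M : ℝ := ∑ i, |intensity lam i| + 1
  have hM : ∀ᶠ N : ℕ in atTop, ∀ i, p N i / (T / N) < M := by
    rw [eventually_all]
    intro i
    refine (tendsto_pi_nhds.1 hq i).eventually_lt_const ?_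
    have h1 := Finset.single_le_sum (f := fun i => |intensity lam i|) (fun i _ => abs_nonneg _)
        (Finset.mem_univ i)
    have h2 := le_abs_self (intensity lam i)
    simp only [M]
    linarith
  filter_upwards [hP, hM, (tendsto_step hT).eventually
    (hreg.eventually_mixedDiffOn_rescaledSurvival M),
    (tendsto_step hT).eventually self_mem_nhdsWithin] with N hN hNM hd hpos
  have hpos' : (0 : ℝ) < T / N := hpos
  have hN' : IsCombBernoulli κ ψ (fun i => T / N * (p N i / (T / N))) (P N) := by
    have : (fun i => T / N * (p N i / (T / N))) = p N := by
      ext i; rw [mul_div_cancel₀ _ hpos'.ne']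
    rwa [this]
  rw [hN'.obsLikelihood_eq hκ hψ hpos' hd
    (fun i => ⟨div_pos (hN.p_pos i) hpos', hNM i⟩) hx hxψ, mul_div_cancel_left₀ _ hpos'.ne']

/-- The likelihood `1 - ∑ p_I` of an observation without claims satisfies
`N log (1 - ∑ p_I) → -T ∑ λ_I`. -/
theorem tendsto_mul_log_obsLikelihood_zero (hκ : IsCopulaLaw κ)
    (hψ : ∀ i, IsSeverityDensity (ψ i)) (hT : 0 < T)
    (hP : ∀ᶠ N in atTop, IsCombBernoulli κ ψ (p N) (P N))
    (hscale : ∀ I : Finset (Fin d), I.Nonempty →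
      Tendsto (fun N : ℕ => activeProb (P N) I / (T / N)) atTop (𝓝 (lam I))) :
    Tendsto (fun N : ℕ => obsLikelihood (P N) 0) atTop (𝓝 1) ∧
    Tendsto (fun N : ℕ => (N : ℝ) * Real.log (obsLikelihood (P N) 0)) atTop
      (𝓝 (-(T * ∑ I ∈ Finset.univ.filter (fun I : Finset (Fin d) => I.Nonempty), lam I))) := by
  set Λ := ∑ I ∈ Finset.univ.filter (fun I : Finset (Fin d) => I.Nonempty), lam I with hΛ
  let s : ℕ → ℝ := fun N =>
    ∑ I ∈ Finset.univ.filter (fun I : Finset (Fin d) => I.Nonempty), activeProb (P N) I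
  have hs : Tendsto (fun N : ℕ => s N / (T / N)) atTop (𝓝 Λ) := by
    simp only [s, Finset.sum_div]
    exact tendsto_finsetSum _ fun I hI => hscale I (Finset.mem_filter.1 hI).2
  have hstep := tendsto_nhdsWithin_iff.1 (tendsto_step hT)
  have hNs : Tendsto (fun N : ℕ => (N : ℝ) * (-s N)) atTop (𝓝 (-(T * Λ))) := by
    refine ((hs.const_mul T).neg).congr' ?_
    filter_upwards [eventually_gt_atTop 0] with N hN
    have : (N : ℝ) ≠ 0 := by exact_mod_cast hN.ne'
    field_simp
  have hs0 : Tendsto s atTop (𝓝 0) := by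
    have := hs.mul hstep.1
    rw [mul_zero] at this
    refine this.congr' ?_
    filter_upwards [hstep.2] with N hN
    have hN' : (0 : ℝ) < T / N := hN
    rw [div_mul_cancel₀ _ hN'.ne']
  have h1s : Tendsto (fun N => 1 - s N) atTop (𝓝 1) := by simpa using hs0.const_sub 1
  have heq : ∀ᶠ N in atTop, 1 - s N = obsLikelihood (P N) 0 := by
    filter_upwards [hP] with N hN using (hN.obsLikelihood_zero hκ hψ).symm
  refine ⟨h1s.congr' heq, ?_⟩
  have h3 := Real.tendsto_nat_mul_log_one_add_of_tendsto hNs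
  refine h3.congr' ?_
  filter_upwards [heq] with N hN
  rw [← hN, sub_eq_add_neg]

end Scaling

/-! ### Monitored series and the continuous-time limit -/

theorem exists_monitoring_cell {T : ℝ} (hT : 0 < T) {N : ℕ} (hN : 0 < N) {t : ℝ}
    (ht : t ∈ Set.Ioc 0 T) :
    ∃ m : Fin N, t ∈ Set.Ioc ((m : ℝ) * (T / N)) (((m : ℝ) + 1) * (T / N)) := by
  have hN' : (0 : ℝ) < N := by exact_mod_cast hN
  have hs : 0 < T / N := div_pos hT hN'
  have hpos : 0 < t / (T / N) := div_pos ht.1 hs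
  have hc : 0 < ⌈t / (T / N)⌉₊ := Nat.ceil_pos.2 hpos
  have hle : t / (T / N) ≤ N := by
    rw [div_le_iff₀ hs, mul_div_cancel₀ _ hN'.ne']; exact ht.2
  have hcN : ⌈t / (T / N)⌉₊ ≤ N := Nat.ceil_le.2 hle
  have hcast : ((⌈t / (T / N)⌉₊ - 1 : ℕ) : ℝ) = (⌈t / (T / N)⌉₊ : ℝ) - 1 := by
    rw [Nat.cast_sub hc, Nat.cast_one]
  refine ⟨⟨⌈t / (T / N)⌉₊ - 1, by omega⟩, ?_, ?_⟩
  · change ((⌈t / (T / N)⌉₊ - 1 : ℕ) : ℝ) * (T / N) < t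
    rw [← lt_div_iff₀ hs, hcast]
    have := Nat.ceil_lt_add_one hpos.le
    linarith
  · change t ≤ (((⌈t / (T / N)⌉₊ - 1 : ℕ) : ℝ) + 1) * (T / N)
    rw [← div_le_iff₀ hs, hcast, sub_add_cancel]
    exact Nat.le_ceil _

theorem monitoring_cell_unique {s : ℝ} (hs : 0 < s) {N : ℕ} {m m' : Fin N} {t : ℝ}
    (h : t ∈ Set.Ioc ((m : ℝ) * s) (((m : ℝ) + 1) * s))
    (h' : t ∈ Set.Ioc ((m' : ℝ) * s) (((m' : ℝ) + 1) * s)) : m = m' := by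
  have h1 : (m : ℝ) < (m' : ℝ) + 1 := lt_of_mul_lt_mul_right (h.1.trans_le h'.2) hs.le
  have h2 : (m' : ℝ) < (m : ℝ) + 1 := lt_of_mul_lt_mul_right (h'.1.trans_le h.2) hs.le
  have h3 : (m : ℕ) < m' + 1 := by exact_mod_cast h1
  have h4 : (m' : ℕ) < m + 1 := by exact_mod_cast h2
  exact Fin.ext (by omega)

/-- When the monitoring cells of the claims are distinct, a product over the observations splits
into the claims and `N - n` empty observations. -/
@[to_additive]
theorem prod_monitoredSeries {M : Type*} [CommMonoid M] (F : (Fin d → ℝ) → M) {n N : ℕ} {T : ℝ}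
    (hs : 0 < T / N) {t : Fin n → ℝ} (x : Fin n → Fin d → ℝ) {c : Fin n → Fin N}
    (hc : Function.Injective c)
    (ht : ∀ k, t k ∈ Set.Ioc ((c k : ℝ) * (T / N)) (((c k : ℝ) + 1) * (T / N))) :
    ∏ m, F (monitoredSeries T t x N m) = F 0 ^ (N - n) * ∏ k, F (x k) := by
  have h1 : ∀ k, monitoredSeries T t x N (c k) = x k := by
    intro k
    rw [monitoredSeries, Finset.sum_eq_single k, Set.indicator_of_mem (ht k)]
    · intro l _ hl
      exact Set.indicator_of_notMem
        (fun h => hl (hc (monitoring_cell_unique hs (ht l) h))) _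
    · simp
  have h2 : ∀ m, m ∉ Finset.univ.image c → monitoredSeries T t x N m = 0 := by
    intro m hm
    rw [monitoredSeries]
    refine Finset.sum_eq_zero fun k _ => Set.indicator_of_notMem (fun h => hm ?_) _
    rw [monitoring_cell_unique hs h (ht k)]
    exact Finset.mem_image_of_mem _ (Finset.mem_univ _)
  rw [← Finset.prod_compl_mul_prod (Finset.univ.image c), Finset.prod_image fun _ _ _ _ h => hc h,
    Finset.prod_congr rfl (fun m hm => by rw [h2 m (Finset.mem_compl.1 hm)]), Finset.prod_const,
    Finset.card_compl, Finset.card_image_of_injective _ hc, Finset.card_univ, Fintype.card_fin,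
    Fintype.card_fin, Finset.prod_congr rfl (fun k _ => by rw [h1 k])]

theorem eventually_exists_injective_cells {T : ℝ} (hT : 0 < T) {n : ℕ} {t : Fin n → ℝ}
    (ht : ∀ k, t k ∈ Set.Ioc 0 T) (hinj : Function.Injective t) :
    ∀ᶠ N : ℕ in atTop, 0 < T / N ∧ ∃ c : Fin n → Fin N, Function.Injective c ∧
      ∀ k, t k ∈ Set.Ioc ((c k : ℝ) * (T / N)) (((c k : ℝ) + 1) * (T / N)) := by
  have h1 : ∀ᶠ N : ℕ in atTop, ∀ k l, k ≠ l → T / N < |t k - t l| := by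
    rw [eventually_all]
    intro k
    rw [eventually_all]
    intro l
    by_cases hkl : k = l
    · simp [hkl]
    · have : 0 < |t k - t l| := abs_pos.2 (sub_ne_zero.2 fun h => hkl (hinj h))
      filter_upwards [(tendsto_nhdsWithin_iff.1 (tendsto_step hT)).1.eventually_lt_const this]
        with N hN _ using hN
  filter_upwards [h1, eventually_gt_atTop 0] with N hN hpos
  have hN' : (0 : ℝ) < N := by exact_mod_cast hpos
  refine ⟨div_pos hT hN', ?_⟩
  choose c hc using fun k => exists_monitoring_cell hT hpos (ht k)
  refine ⟨c, fun k l hkl => ?_, hc⟩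
  by_contra hne
  have h := hN k l hne
  have hk := hc k
  have hl := hc l
  rw [hkl] at hk
  have : |t k - t l| ≤ T / N := by
    rw [abs_le]
    constructor <;> linarith [hk.1, hk.2, hl.1, hl.2]
  linarith

theorem levyLikelihood_eq (κ : Measure (Fin d → ℝ)) (ψ : Fin d → ℝ → ℝ)
    (lam : Finset (Fin d) → ℝ) (T : ℝ) {n : ℕ} {x : Fin n → Fin d → ℝ}
    (hx : ∀ k, (activeSet (x k)).Nonempty) :
    levyLikelihood κ ψ lam T x
      = Real.exp (-(T * ∑ I ∈ Finset.univ.filter (fun I : Finset (Fin d) => I.Nonempty), lam I)) *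
        ∏ k, (zeta κ ψ lam (x k) *
          ∏ i ∈ activeSet (x k), intensity lam i * ψ i (x k i)) := by
  rw [levyLikelihood, Finset.prod_mul_distrib]
  congr 1
  · rw [Finset.mul_sum, ← Finset.sum_neg_distrib, Real.exp_sum]
  · rw [← Finset.prod_fiberwise_of_maps_to (t := Finset.univ.filter
      (fun I : Finset (Fin d) => I.Nonempty)) (g := fun k => activeSet (x k))
      (fun k _ => Finset.mem_filter.2 ⟨Finset.mem_univ _, hx k⟩)]
    refine Finset.prod_congr rfl fun I _ => Finset.prod_congr rfl fun k hk => ?_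
    rw [(Finset.mem_filter.1 hk).2]

theorem levyLogLikelihood_eq (κ : Measure (Fin d → ℝ)) (ψ : Fin d → ℝ → ℝ)
    (lam : Finset (Fin d) → ℝ) (T : ℝ) {n : ℕ} {x : Fin n → Fin d → ℝ}
    (hx : ∀ k, (activeSet (x k)).Nonempty) (hζ : ∀ k, 0 < zeta κ ψ lam (x k))
    (hpos : ∀ k, ∀ i ∈ activeSet (x k), 0 < intensity lam i * ψ i (x k i)) :
    levyLogLikelihood κ ψ lam T x
      = -(T * ∑ I ∈ Finset.univ.filter (fun I : Finset (Fin d) => I.Nonempty), lam I) +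
        ∑ k, Real.log (zeta κ ψ lam (x k) *
          ∏ i ∈ activeSet (x k), intensity lam i * ψ i (x k i)) := by
  rw [levyLogLikelihood, Finset.sum_sub_distrib, ← Finset.mul_sum, sub_eq_neg_add]
  congr 1
  rw [← Finset.sum_fiberwise_of_maps_to (t := Finset.univ.filter
      (fun I : Finset (Fin d) => I.Nonempty)) (g := fun k => activeSet (x k))
      (fun k _ => Finset.mem_filter.2 ⟨Finset.mem_univ _, hx k⟩)]
  refine Finset.sum_congr rfl fun I _ => Finset.sum_congr rfl fun k hk => ?_
  rw [← (Finset.mem_filter.1 hk).2, Real.log_mul (hζ k).ne'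
    (Finset.prod_pos (hpos k)).ne', Real.log_prod fun i hi => (hpos k i hi).ne']

section Scaling

variable {κ : Measure (Fin d → ℝ)} {ψ : Fin d → ℝ → ℝ} {T : ℝ} {lam : Finset (Fin d) → ℝ}
  {p : ℕ → Fin d → ℝ} {P : ℕ → Measure (Fin d → ℝ)}

theorem tendsto_seriesLikelihood (hκ : IsCopulaLaw κ) (hreg : IsTailRegular κ)
    (hψ : ∀ i, IsSeverityDensity (ψ i)) (hT : 0 < T) (hlam : ∀ i, 0 < intensity lam i)
    (hP : ∀ᶠ N in atTop, IsCombBernoulli κ ψ (p N) (P N))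
    (hscale : ∀ I : Finset (Fin d), I.Nonempty →
      Tendsto (fun N : ℕ => activeProb (P N) I / (T / N)) atTop (𝓝 (lam I)))
    {n : ℕ} {t : Fin n → ℝ} {x : Fin n → Fin d → ℝ} (ht : ∀ k, t k ∈ Set.Ioc 0 T)
    (hinj : Function.Injective t) (hx : ∀ k i, 0 ≤ x k i) (hne : ∀ k, (activeSet (x k)).Nonempty)
    (hxψ : ∀ k, ∀ i ∈ activeSet (x k), 0 < ψ i (x k i)) :
    Tendsto (fun N : ℕ => seriesLikelihood (P N) (monitoredSeries T t x N) / (T / N) ^ n)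
        atTop (𝓝 (levyLikelihood κ ψ lam T x)) := by
  rw [levyLikelihood_eq κ ψ lam T hne]
  obtain ⟨hq1, hqN⟩ := tendsto_mul_log_obsLikelihood_zero hκ hψ hT hP hscale
  have h1 : Tendsto (fun N : ℕ => (N : ℝ) * Real.log (obsLikelihood (P N) 0)
      - n * Real.log (obsLikelihood (P N) 0)) atTop
      (𝓝 (-(T * ∑ I ∈ Finset.univ.filter (fun I : Finset (Fin d) => I.Nonempty), lam I))) := by
    have := hqN.sub ((hq1.log one_ne_zero).const_mul (n : ℝ))
    simpa using this
  have h2 := ((Real.continuous_exp.tendsto _).comp h1).mul (tendsto_finsetProd Finset.univ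
    fun k _ => tendsto_obsLikelihood_div hκ hreg hψ hT hlam hP hscale (hx k) (hne k) (hxψ k))
  refine h2.congr' ?_
  filter_upwards [eventually_exists_injective_cells hT ht hinj,
    hq1.eventually_const_lt zero_lt_one] with N ⟨hs, c, hc, htc⟩ hq
  have hnN : n ≤ N := by simpa using Fintype.card_le_of_injective c hc
  rw [seriesLikelihood, prod_monitoredSeries _ hs x hc htc, Function.comp_apply, ← sub_mul,
    Finset.prod_div_distrib, Finset.prod_const, Finset.card_univ, Fintype.card_fin,
    mul_div_assoc, ← Nat.cast_sub hnN, mul_comm (_ : ℝ) (Real.log _), Real.exp_mul,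
    Real.exp_log hq, Real.rpow_natCast]

theorem tendsto_seriesLogLikelihood (hκ : IsCopulaLaw κ) (hreg : IsTailRegular κ)
    (hψ : ∀ i, IsSeverityDensity (ψ i)) (hT : 0 < T) (hlam : ∀ i, 0 < intensity lam i)
    (hP : ∀ᶠ N in atTop, IsCombBernoulli κ ψ (p N) (P N))
    (hscale : ∀ I : Finset (Fin d), I.Nonempty →
      Tendsto (fun N : ℕ => activeProb (P N) I / (T / N)) atTop (𝓝 (lam I)))
    {n : ℕ} {t : Fin n → ℝ} {x : Fin n → Fin d → ℝ} (ht : ∀ k, t k ∈ Set.Ioc 0 T)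
    (hinj : Function.Injective t) (hx : ∀ k i, 0 ≤ x k i) (hne : ∀ k, (activeSet (x k)).Nonempty)
    (hxψ : ∀ k, ∀ i ∈ activeSet (x k), 0 < ψ i (x k i))
    (hζ : ∀ k, 0 < zeta κ ψ lam (x k)) :
    Tendsto (fun N : ℕ => seriesLogLikelihood (P N) (monitoredSeries T t x N)
            - n * Real.log (T / N)) atTop (𝓝 (levyLogLikelihood κ ψ lam T x)) := by
  have hpos : ∀ k, ∀ i ∈ activeSet (x k), 0 < intensity lam i * ψ i (x k i) :=
    fun k i hi => mul_pos (hlam i) (hxψ k i hi)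
  have hpos' : ∀ k, 0 < zeta κ ψ lam (x k) *
      ∏ i ∈ activeSet (x k), intensity lam i * ψ i (x k i) :=
    fun k => mul_pos (hζ k) (Finset.prod_pos (hpos k))
  rw [levyLogLikelihood_eq κ ψ lam T hne hζ hpos]
  obtain ⟨hq1, hqN⟩ := tendsto_mul_log_obsLikelihood_zero hκ hψ hT hP hscale
  have h1 : Tendsto (fun N : ℕ => (N : ℝ) * Real.log (obsLikelihood (P N) 0)
      - n * Real.log (obsLikelihood (P N) 0)) atTop
      (𝓝 (-(T * ∑ I ∈ Finset.univ.filter (fun I : Finset (Fin d) => I.Nonempty), lam I))) := by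
    have := hqN.sub ((hq1.log one_ne_zero).const_mul (n : ℝ))
    simpa using this
  have hobs := fun k =>
    tendsto_obsLikelihood_div hκ hreg hψ hT hlam hP hscale (hx k) (hne k) (hxψ k)
  have h2 := h1.add (tendsto_finsetSum Finset.univ fun k _ => (hobs k).log (hpos' k).ne')
  refine h2.congr' ?_
  filter_upwards [eventually_exists_injective_cells hT ht hinj,
    eventually_all.2 fun k => (hobs k).eventually_const_lt (hpos' k)] with N ⟨hs, c, hc, htc⟩ ho
  have hnN : n ≤ N := by simpa using Fintype.card_le_of_injective c hc
  have hlog : ∀ k, Real.log (obsLikelihood (P N) (x k) / (T / N))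
      = Real.log (obsLikelihood (P N) (x k)) - Real.log (T / N) := by
    intro k
    refine Real.log_div (fun h => ?_) hs.ne'
    have := ho k
    rw [h, zero_div] at this
    exact lt_irrefl _ this
  rw [seriesLogLikelihood, sum_monitoredSeries (fun y => Real.log (obsLikelihood (P N) y)) hs x hc
    htc, nsmul_eq_mul, Nat.cast_sub hnN]
  simp only [hlog, Finset.sum_sub_distrib, Finset.sum_const, Finset.card_univ, Fintype.card_fin,
    nsmul_eq_mul]
  ring

end Scaling

/-! ### Box increments -/

/-- The corner of the box `∏_{i ∈ s} (aᵢ, bᵢ]` with lower ends in `t` and upper ends in `s \ t`; the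
coordinates outside `s` are those of `u`. -/
def boxCorner (s t : Finset (Fin d)) (a b u : Fin d → ℝ) : Fin d → ℝ :=
  fun i => if i ∈ t then a i else if i ∈ s then b i else u i

/-- The increment of `f` over the box `∏_{i ∈ s} (aᵢ, bᵢ]`: the alternating sum over its corners. -/
def boxDiff (s : Finset (Fin d)) (a b : Fin d → ℝ) (f : (Fin d → ℝ) → ℝ) (u : Fin d → ℝ) : ℝ :=
  ∑ t ∈ s.powerset, (-1 : ℝ) ^ t.card * f (boxCorner s t a b u)

theorem boxDiff_empty (a b : Fin d → ℝ) (f : (Fin d → ℝ) → ℝ) : boxDiff ∅ a b f = f := by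
  ext u
  have : boxCorner ∅ ∅ a b u = u := by ext i; simp [boxCorner]
  simp [boxDiff, this]

theorem boxDiff_insert {s : Finset (Fin d)} {m : Fin d} (hm : m ∉ s) (a b : Fin d → ℝ)
    (f : (Fin d → ℝ) → ℝ) (u : Fin d → ℝ) :
    boxDiff (insert m s) a b f u
      = boxDiff s a b f (Function.update u m (b m))
        - boxDiff s a b f (Function.update u m (a m)) := by
  rw [boxDiff, Finset.sum_powerset_insert hm, sub_eq_add_neg, boxDiff, boxDiff,
    ← Finset.sum_neg_distrib]
  congr 1
  · refine Finset.sum_congr rfl fun t ht => ?_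
    have hmt : m ∉ t := fun h => hm (Finset.mem_powerset.1 ht h)
    congr 2
    ext i
    by_cases him : i = m
    · subst him; simp [boxCorner, hmt, hm]
    · simp [boxCorner, him]
  · refine Finset.sum_congr rfl fun t ht => ?_
    have hmt : m ∉ t := fun h => hm (Finset.mem_powerset.1 ht h)
    rw [Finset.card_insert_of_notMem hmt, pow_succ, mul_neg_one, neg_mul]
    congr 3
    ext i
    by_cases him : i = m
    · subst him; simp [boxCorner, hmt, hm]
    · simp [boxCorner, him]

theorem boxDiff_congr {s : Finset (Fin d)} {a b a' b' : Fin d → ℝ} (ha : ∀ i ∈ s, a i = a' i)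
    (hb : ∀ i ∈ s, b i = b' i) (f : (Fin d → ℝ) → ℝ) :
    boxDiff s a b f = boxDiff s a' b' f := by
  ext u
  refine Finset.sum_congr rfl fun t ht => ?_
  congr 2
  ext i
  simp only [boxCorner]
  split_ifs with h1 h2
  · exact ha i (Finset.mem_powerset.1 ht h1)
  · exact hb i h2
  · rfl

theorem boxCorner_update {s t : Finset (Fin d)} {m : Fin d} (hm : m ∉ s) (ht : t ⊆ s)
    (a b u : Fin d → ℝ) (y : ℝ) :
    boxCorner s t a b (Function.update u m y) = Function.update (boxCorner s t a b u) m y := by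
  ext i
  by_cases him : i = m
  · subst him
    have : i ∉ t := fun h => hm (ht h)
    simp [boxCorner, this, hm]
  · simp [boxCorner, him]

theorem boxCorner_pos {s t : Finset (Fin d)} {a b u : Fin d → ℝ} (ha : ∀ i, 0 < a i)
    (hb : ∀ i, a i ≤ b i) (hu : ∀ i, 0 < u i) (i : Fin d) : 0 < boxCorner s t a b u i := by
  simp only [boxCorner]
  split_ifs
  · exact ha i
  · exact (ha i).trans_le (hb i)
  · exact hu i

theorem isOpen_posOrthant : IsOpen {u : Fin d → ℝ | ∀ i, 0 < u i} := by
  simpa using isOpen_setOf_forall_mem (I := (Finset.univ : Finset (Fin d)))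
    (A := fun _ => Set.Ioi 0) fun _ => isOpen_Ioi

theorem update_pos {u : Fin d → ℝ} (hu : ∀ i, 0 < u i) (m : Fin d) {y : ℝ} (hy : 0 < y)
    (i : Fin d) : 0 < Function.update u m y i := by
  by_cases h : i = m
  · subst h; simpa using hy
  · simpa [h] using hu i

theorem hasDerivAt_boxDiff {s : Finset (Fin d)} {m : Fin d} (hm : m ∉ s) {a b : Fin d → ℝ}
    (ha : ∀ i, 0 < a i) (hb : ∀ i, a i ≤ b i) {F : (Fin d → ℝ) → ℝ}
    (hF : ∀ u : Fin d → ℝ, (∀ i, 0 < u i) →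
      DifferentiableAt ℝ (fun r => F (Function.update u m r)) (u m))
    {u : Fin d → ℝ} (hu : ∀ i, 0 < u i) {y : ℝ} (hy : 0 < y) :
    HasDerivAt (fun r => boxDiff s a b F (Function.update u m r))
      (boxDiff s a b (partialDeriv m F) (Function.update u m y)) y := by
  simp only [boxDiff]
  refine HasDerivAt.fun_sum fun t ht => HasDerivAt.const_mul _ ?_
  have hts := Finset.mem_powerset.1 ht
  simp only [boxCorner_update hm hts]
  have h := (hF (Function.update (boxCorner s t a b u) m y)
    (update_pos (boxCorner_pos ha hb hu) m hy)).hasDerivAt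
  rw [partialDeriv]
  simp only [Function.update_self, Function.update_idem] at h ⊢
  exact h

/-- A mixed derivative of a function with non-negative box increments has non-negative increments
over boxes in the remaining coordinates. -/
theorem boxDiff_mixedPartial_nonneg (t : Finset (Fin d)) : ∀ (F : (Fin d → ℝ) → ℝ)
    (s : Finset (Fin d)), Disjoint s t → MixedDiffOn t {u | ∀ i, 0 < u i} F →
    (∀ a b u : Fin d → ℝ, (∀ i, 0 < a i) → (∀ i, a i ≤ b i) → (∀ i, 0 < u i) →
      0 ≤ boxDiff (s ∪ t) a b F u) →
    ∀ a b u : Fin d → ℝ, (∀ i, 0 < a i) → (∀ i, a i ≤ b i) → (∀ i, 0 < u i) →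
      0 ≤ boxDiff s a b (mixedPartial t F) u := by
  induction t using Finset.induction_on_max with
  | empty =>
    intro F s _ _ hF
    simpa [mixedPartial_empty] using hF
  | insert m t hm ih =>
    intro F s hst hd hF
    have hmt : m ∉ t := fun h => lt_irrefl _ (hm m h)
    have hms : m ∉ s := fun h => Finset.disjoint_left.1 hst h (Finset.mem_insert_self _ _)
    have hmst : m ∉ s ∪ t := by simp [hms, hmt]
    rw [mixedPartial_insert_max hm]
    refine ih (partialDeriv m F) s (hst.mono_right (Finset.subset_insert _ _))
      (hd.partialDeriv_max hm) ?_
    intro a b u ha hb hu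
    have hFd : ∀ u : Fin d → ℝ, (∀ i, 0 < u i) →
        DifferentiableAt ℝ (fun r => F (Function.update u m r)) (u m) := by
      intro u hu
      have := hd ∅ (Finset.empty_subset _) m (Finset.mem_insert_self _ _) (by simp) u hu
      simpa only [mixedPartial_empty] using this
    have hder := hasDerivAt_boxDiff hmst ha hb hFd hu (hu m)
    rw [Function.update_eq_self] at hder
    have hmono : MonotoneOn (fun r => boxDiff (s ∪ t) a b F (Function.update u m r))
        (Set.Ioi 0) := by
      intro y hy y' _ hyy'
      have h := hF (Function.update a m y) (Function.update b m y') u (update_pos ha m hy)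
        (fun i => by
          by_cases him : i = m
          · subst him; simpa using hyy'
          · simpa [him] using hb i) hu
      rw [Finset.union_insert, boxDiff_insert hmst] at h
      simp only [Function.update_self] at h
      rw [boxDiff_congr (a' := a) (b' := b)] at h
      · exact sub_nonneg.1 h
      · intro i hi
        exact Function.update_of_ne (by rintro rfl; exact hmst hi) _ _
      · intro i hi
        exact Function.update_of_ne (by rintro rfl; exact hmst hi) _ _
    have h0 := hmono.derivWithin_nonneg (x := u m)
    rwa [hder.hasDerivWithinAt.derivWithin (isOpen_Ioi.uniqueDiffWithinAt (hu m))] at h0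

theorem measurable_indicator_of_continuousOn {W : Set (Fin d → ℝ)} (hW : IsOpen W)
    {f : (Fin d → ℝ) → ℝ} (hf : ContinuousOn f W) : Measurable (W.indicator f) := by
  classical
  rw [← Set.piecewise_eq_indicator]
  exact hf.measurable_piecewise continuousOn_const hW.measurableSet

/-- The fundamental theorem of calculus for mixed derivatives: integrating `∂_{s ∪ t} F` over a box
in the coordinates of `s` gives the box increment of `∂_t F`. -/
theorem lmarginal_mixedPartial {I : Finset (Fin d)} {F : (Fin d → ℝ) → ℝ}
    (hF : MixedDiffOn I {u | ∀ i, 0 < u i} F)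
    (hcont : ∀ t ⊆ I, t.Nonempty → ContinuousOn (mixedPartial t F) {u | ∀ i, 0 < u i})
    (hinc : ∀ a b u : Fin d → ℝ, (∀ i, 0 < a i) → (∀ i, a i ≤ b i) → (∀ i, 0 < u i) →
      0 ≤ boxDiff I a b F u)
    {a b : Fin d → ℝ} (ha : ∀ i, 0 < a i) (hb : ∀ i, a i ≤ b i)
    (μ : Fin d → Measure ℝ) [∀ i, SigmaFinite (μ i)] (s : Finset (Fin d)) :
    ∀ t : Finset (Fin d), (∀ i ∈ s, ∀ j ∈ t, i < j) → s ∪ t = I →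
    (∀ i ∈ s, μ i = volume.restrict (Set.Ioc (a i) (b i))) →
    ∀ u : Fin d → ℝ, (∀ i, 0 < u i) →
      lmarginal μ s (fun u => ENNReal.ofReal
        (Set.indicator {u | ∀ i, 0 < u i} (mixedPartial I F) u)) u
      = ENNReal.ofReal (boxDiff s a b (mixedPartial t F) u) := by
  induction s using Finset.induction_on_max with
  | empty =>
    intro t _ ht _ u hu
    rw [Finset.empty_union] at ht
    have hu' : u ∈ {u : Fin d → ℝ | ∀ i, 0 < u i} := hu
    rw [lmarginal_empty, boxDiff_empty, ht, Set.indicator_of_mem hu']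
  | insert m s hm ih =>
    intro t hst hI hμ u hu
    have hms : m ∉ s := fun h => lt_irrefl _ (hm m h)
    have hmt : ∀ j ∈ t, m < j := hst m (Finset.mem_insert_self _ _)
    have hI' : s ∪ insert m t = I := by rw [← hI, Finset.union_insert, Finset.insert_union]
    have hsub : insert m t ⊆ I := hI' ▸ Finset.subset_union_right
    have htI : t ⊆ I := (Finset.subset_insert _ _).trans hsub
    have hmI : m ∈ I := hsub (Finset.mem_insert_self _ _)
    have hdisj : Disjoint s (insert m t) := by
      rw [Finset.disjoint_left]
      intro i hi hi'
      rcases Finset.mem_insert.1 hi' with rfl | h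
      · exact hms hi
      · exact lt_irrefl _ (hst i (Finset.mem_insert_of_mem hi) i h)
    have hcI := hcont I subset_rfl ⟨m, hmI⟩
    have hmeas : Measurable (fun u => ENNReal.ofReal
        (Set.indicator {u | ∀ i, 0 < u i} (mixedPartial I F) u)) :=
      (measurable_indicator_of_continuousOn isOpen_posOrthant hcI).ennreal_ofReal
    rw [lmarginal_insert _ hmeas hms, hμ m (Finset.mem_insert_self _ _)]
    have hab := hb m
    have ham := ha m
    have e1 : ∫⁻ y in Set.Ioc (a m) (b m), lmarginal μ s (fun u => ENNReal.ofReal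
        (Set.indicator {u | ∀ i, 0 < u i} (mixedPartial I F) u)) (Function.update u m y)
        = ∫⁻ y in Set.Ioc (a m) (b m), ENNReal.ofReal
          (boxDiff s a b (mixedPartial (insert m t) F) (Function.update u m y)) := by
      refine setLIntegral_congr_fun measurableSet_Ioc fun y hy => ?_
      refine ih (insert m t) ?_ hI' (fun i hi => hμ i (Finset.mem_insert_of_mem hi)) _
        (update_pos hu m (ham.trans hy.1))
      intro i hi j hj
      rcases Finset.mem_insert.1 hj with rfl | h
      · exact hm i hi
      · exact hst i (Finset.mem_insert_of_mem hi) j h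
    have hnn : ∀ y, 0 < y →
        0 ≤ boxDiff s a b (mixedPartial (insert m t) F) (Function.update u m y) := fun y hy =>
      boxDiff_mixedPartial_nonneg (insert m t) F s hdisj (hF.mono hsub subset_rfl)
        (by rwa [hI']) a b _ ha hb (update_pos hu m hy)
    have hc : ContinuousOn
        (fun y => boxDiff s a b (mixedPartial (insert m t) F) (Function.update u m y))
        (Set.Icc (a m) (b m)) := by
      simp only [boxDiff]
      refine continuousOn_finsetSum _ fun t' ht' => ContinuousOn.mul continuousOn_const ?_
      simp only [boxCorner_update hms (Finset.mem_powerset.1 ht')]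
      have hup : Continuous fun y : ℝ => Function.update (boxCorner s t' a b u) m y :=
        continuous_const.update m continuous_id
      refine (hcont _ hsub ⟨m, Finset.mem_insert_self _ _⟩).comp hup.continuousOn fun y hy => ?_
      exact update_pos (boxCorner_pos ha hb hu) m (ham.trans_le hy.1)
    have hint : IntegrableOn
        (fun y => boxDiff s a b (mixedPartial (insert m t) F) (Function.update u m y))
        (Set.Ioc (a m) (b m)) := (hc.integrableOn_Icc).mono_set Set.Ioc_subset_Icc_self
    have hder : ∀ y ∈ Set.uIcc (a m) (b m),
        HasDerivAt (fun r => boxDiff s a b (mixedPartial t F) (Function.update u m r))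
          (boxDiff s a b (mixedPartial (insert m t) F) (Function.update u m y)) y := by
      intro y hy
      rw [Set.uIcc_of_le hab] at hy
      rw [mixedPartial_insert_min hmt]
      exact hasDerivAt_boxDiff hms ha hb (fun u hu => hF t htI m hmI hmt u hu) hu
        (ham.trans_le hy.1)
    have hftc := intervalIntegral.integral_eq_sub_of_hasDerivAt hder
      ((intervalIntegrable_iff_integrableOn_Ioc_of_le hab).2 hint)
    rw [e1, ← ofReal_integral_eq_lintegral_ofReal hint, ← intervalIntegral.integral_of_le hab,
      hftc, boxDiff_insert hms]
    filter_upwards [ae_restrict_mem measurableSet_Ioc] with y hy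
    exact hnn y (ham.trans hy.1)

theorem lmarginal_dirac {μ : Fin d → Measure ℝ} [∀ i, SigmaFinite (μ i)] (c : Fin d → ℝ)
    {f : (Fin d → ℝ) → ENNReal} (hf : Measurable f) (s : Finset (Fin d)) :
    (∀ i ∈ s, μ i = Measure.dirac (c i)) → ∀ u : Fin d → ℝ,
      lmarginal μ s f u = f (fun i => if i ∈ s then c i else u i) := by
  induction s using Finset.induction_on with
  | empty => intro _ u; simp
  | insert m s hm ih =>
    intro hμ u
    rw [lmarginal_insert _ hf hm, hμ m (Finset.mem_insert_self _ _), lintegral_dirac,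
      ih fun i hi => hμ i (Finset.mem_insert_of_mem hi)]
    congr 1
    ext i
    by_cases him : i = m
    · subst him; simp
    · simp [him]

/-! ### The tail functions of the faces -/

/-- The alternating sum `H_I = ∑_{K ⊇ I} (-1)^{|K| + |I|} 𝔠_K`. In the coordinates of `I` it is the
distribution function of the part of the Lévy measure on the face with active set `I`, after the
coordinates have been transformed by the marginal tail integrals. -/
noncomputable def faceTail (κ : Measure (Fin d → ℝ)) (I : Finset (Fin d)) (u : Fin d → ℝ) : ℝ :=
  ∑ K ∈ Finset.univ.filter (fun K : Finset (Fin d) => I ⊆ K),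
    (-1 : ℝ) ^ (K.card + I.card) * levyCopula κ K u

theorem sum_filter_superset {M : Type*} [AddCommMonoid M] (I : Finset (Fin d))
    (g : Finset (Fin d) → M) :
    ∑ K ∈ Finset.univ.filter (fun K : Finset (Fin d) => I ⊆ K), g K
      = ∑ L ∈ Iᶜ.powerset, g (I ∪ L) := by
  refine Finset.sum_nbij' (fun K => K \ I) (fun L => I ∪ L) ?_ ?_ ?_ ?_ ?_
  · intro K _
    rw [Finset.mem_powerset]
    intro i hi
    exact Finset.mem_compl.2 (Finset.mem_sdiff.1 hi).2
  · intro L _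
    simp
  · intro K hK
    exact Finset.union_sdiff_of_subset (Finset.mem_filter.1 hK).2
  · intro L hL
    have : Disjoint I L := by
      rw [Finset.disjoint_right]
      intro i hi
      exact Finset.mem_compl.1 (Finset.mem_powerset.1 hL hi)
    exact Finset.union_sdiff_cancel_left this
  · intro K hK
    rw [Finset.union_sdiff_of_subset (Finset.mem_filter.1 hK).2]

theorem neg_one_pow_card_union_add {I L : Finset (Fin d)} (hL : L ⊆ Iᶜ) :
    (-1 : ℝ) ^ ((I ∪ L).card + I.card) = (-1) ^ L.card := by
  have : Disjoint I L := by
    rw [Finset.disjoint_right]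
    intro i hi
    exact Finset.mem_compl.1 (hL hi)
  rw [Finset.card_union_of_disjoint this,
    show I.card + L.card + I.card = 2 * I.card + L.card by ring,
    pow_add, pow_mul]
  simp

/-- Box increments of alternating sums of survival copulas are probabilities. -/
theorem IsCopulaLaw.boxDiff_restrictedSurvival_nonneg {κ : Measure (Fin d → ℝ)}
    (hκ : IsCopulaLaw κ) (I : Finset (Fin d)) {a b : Fin d → ℝ} (hab : ∀ i, a i ≤ b i)
    (u : Fin d → ℝ) :
    0 ≤ boxDiff I a b (fun u => ∑ K ∈ Finset.univ.filter (fun K : Finset (Fin d) => I ⊆ K),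
      (-1 : ℝ) ^ (K.card + I.card) * restrictedSurvival κ K u) u := by
  have := hκ.prob
  have hm : ∀ c : Fin d → ℝ, ∀ i, MeasurableSet {v : Fin d → ℝ | 1 - v i ≤ c i} := fun c i =>
    measurableSet_le (measurable_const.sub (measurable_pi_apply i)) measurable_const
  have h1 : ∀ w : Fin d → ℝ, ∑ K ∈ Finset.univ.filter (fun K : Finset (Fin d) => I ⊆ K),
      (-1 : ℝ) ^ (K.card + I.card) * restrictedSurvival κ K w
      = κ.real {v | (∀ i ∈ I, 1 - v i ≤ w i) ∧ ∀ k ∈ Iᶜ, ¬ (1 - v k ≤ w k)} := by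
    intro w
    have h := measureReal_notMem_eq_sum_powerset κ (hm w) Iᶜ {v | ∀ i ∈ I, 1 - v i ≤ w i}
    simp only [Set.mem_ofPred_eq] at h
    rw [h, sum_filter_superset]
    refine Finset.sum_congr rfl fun L hL => ?_
    rw [neg_one_pow_card_union_add (Finset.mem_powerset.1 hL), hκ.restrictedSurvival_eq]
    congr 2
    ext v
    simp only [Set.mem_ofPred_eq, Finset.mem_union]
    constructor
    · intro h
      exact ⟨fun i hi => h i (Or.inl hi), fun i hi => h i (Or.inr hi)⟩
    · rintro ⟨h1, h2⟩ i (hi | hi)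
      · exact h1 i hi
      · exact h2 i hi
  have h2 := measureReal_notMem_eq_sum_powerset κ (hm a) I
    {v | (∀ i ∈ I, 1 - v i ≤ b i) ∧ ∀ k ∈ Iᶜ, ¬ (1 - v k ≤ u k)}
  have h3 : boxDiff I a b (fun u => ∑ K ∈ Finset.univ.filter
      (fun K : Finset (Fin d) => I ⊆ K),
      (-1 : ℝ) ^ (K.card + I.card) * restrictedSurvival κ K u) u
      = κ.real {v | v ∈ {v : Fin d → ℝ | (∀ i ∈ I, 1 - v i ≤ b i) ∧
          ∀ k ∈ Iᶜ, ¬ (1 - v k ≤ u k)} ∧ ∀ i ∈ I, v ∉ {v : Fin d → ℝ | 1 - v i ≤ a i}} := by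
    rw [h2, boxDiff]
    refine Finset.sum_congr rfl fun t ht => ?_
    have hts := Finset.mem_powerset.1 ht
    rw [h1]
    congr 2
    ext v
    simp only [Set.mem_ofPred_eq, boxCorner]
    constructor
    · rintro ⟨h1, h2⟩
      refine ⟨⟨fun i hi => ?_, fun k hk => ?_⟩, fun i hi => ?_⟩
      · have := h1 i hi
        rw [if_pos hi] at this
        split_ifs at this
        · exact this.trans (hab i)
        · exact this
      · have hkI := Finset.mem_compl.1 hk
        have := h2 k hk
        rwa [if_neg (fun h => hkI (hts h)), if_neg hkI] at this
      · have := h1 i (hts hi)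
        rwa [if_pos hi] at this
    · rintro ⟨⟨h1, h2⟩, h3⟩
      refine ⟨fun i hi => ?_, fun k hk => ?_⟩
      · rw [if_pos hi]
        split_ifs with hit
        · exact h3 i hit
        · exact h1 i hi
      · have hkI := Finset.mem_compl.1 hk
        rw [if_neg (fun h => hkI (hts h)), if_neg hkI]
        exact h2 k hk
  rw [h3]
  exact measureReal_nonneg

theorem IsTailRegular.boxDiff_faceTail_nonneg {κ : Measure (Fin d → ℝ)} (hκ : IsCopulaLaw κ)
    (hreg : IsTailRegular κ) {I : Finset (Fin d)} (hI : I.Nonempty) {a b u : Fin d → ℝ}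
    (ha : ∀ i, 0 < a i) (hab : ∀ i, a i ≤ b i) (hu : ∀ i, 0 < u i) :
    0 ≤ boxDiff I a b (faceTail κ I) u := by
  have hlim : Tendsto (fun h => boxDiff I a b (fun u => ∑ K ∈ Finset.univ.filter
      (fun K : Finset (Fin d) => I ⊆ K),
      (-1 : ℝ) ^ (K.card + I.card) * rescaledSurvival κ K h u) u) (𝓝[>] (0 : ℝ))
      (𝓝 (boxDiff I a b (faceTail κ I) u)) := by
    simp only [boxDiff, faceTail]
    refine tendsto_finsetSum _ fun t _ => Tendsto.const_mul _
      (tendsto_finsetSum _ fun K hK => Tendsto.const_mul _ ?_)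
    exact hreg.tendsto_rescaledSurvival hκ (hI.mono (Finset.mem_filter.1 hK).2)
      fun j _ => (boxCorner_pos ha hab hu j).le
  refine ge_of_tendsto hlim ?_
  filter_upwards [self_mem_nhdsWithin] with h hh
  have hh' : (0 : ℝ) < h := hh
  have h1 := hκ.boxDiff_restrictedSurvival_nonneg I (a := h • a) (b := h • b)
    (fun i => mul_le_mul_of_nonneg_left (hab i) hh'.le) (h • u)
  have h2 : boxDiff I a b (fun u => ∑ K ∈ Finset.univ.filter
      (fun K : Finset (Fin d) => I ⊆ K),
      (-1 : ℝ) ^ (K.card + I.card) * rescaledSurvival κ K h u) u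
      = boxDiff I (h • a) (h • b) (fun u => ∑ K ∈ Finset.univ.filter
      (fun K : Finset (Fin d) => I ⊆ K),
      (-1 : ℝ) ^ (K.card + I.card) * restrictedSurvival κ K u) (h • u) / h := by
    simp only [boxDiff]
    rw [Finset.sum_div]
    refine Finset.sum_congr rfl fun t _ => ?_
    rw [mul_div_assoc, Finset.sum_div]
    congr 1
    refine Finset.sum_congr rfl fun K _ => ?_
    rw [rescaledSurvival, mul_div_assoc]
    congr 3
    ext i
    simp only [boxCorner, Pi.smul_apply, smul_eq_mul]
    split_ifs <;> rfl
  rw [h2]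
  exact div_nonneg h1 hh'.le

theorem IsTailRegular.mixedDiffOn_levyCopula_posOrthant {κ : Measure (Fin d → ℝ)}
    (hκ : IsCopulaLaw κ) (hreg : IsTailRegular κ) {I K : Finset (Fin d)} (hIK : I ⊆ K) :
    MixedDiffOn I {u | ∀ i, 0 < u i} (levyCopula κ K) :=
  (hreg.mixedDiffOn_levyCopula hκ K).mono hIK fun _ hu j _ => hu j

theorem IsTailRegular.mixedDiffOn_faceTail {κ : Measure (Fin d → ℝ)} (hκ : IsCopulaLaw κ)
    (hreg : IsTailRegular κ) (I : Finset (Fin d)) :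
    MixedDiffOn I {u | ∀ i, 0 < u i} (faceTail κ I) :=
  MixedDiffOn.sum isOpen_posOrthant fun _ hK =>
    hreg.mixedDiffOn_levyCopula_posOrthant hκ (Finset.mem_filter.1 hK).2

theorem IsTailRegular.mixedPartial_faceTail {κ : Measure (Fin d → ℝ)} (hκ : IsCopulaLaw κ)
    (hreg : IsTailRegular κ) {I t : Finset (Fin d)} (ht : t ⊆ I) {u : Fin d → ℝ}
    (hu : ∀ i, 0 < u i) :
    mixedPartial t (faceTail κ I) u
      = ∑ K ∈ Finset.univ.filter (fun K : Finset (Fin d) => I ⊆ K),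
        (-1 : ℝ) ^ (K.card + I.card) * mixedPartial t (levyCopula κ K) u :=
  mixedPartial_sum isOpen_posOrthant (fun _ hK =>
    hreg.mixedDiffOn_levyCopula_posOrthant hκ (Finset.mem_filter.1 hK).2) ht u hu

theorem IsTailRegular.continuousOn_mixedPartial_faceTail {κ : Measure (Fin d → ℝ)}
    (hκ : IsCopulaLaw κ) (hreg : IsTailRegular κ) {I t : Finset (Fin d)} (ht : t ⊆ I)
    (hne : t.Nonempty) :
    ContinuousOn (mixedPartial t (faceTail κ I)) {u | ∀ i, 0 < u i} := by
  refine ContinuousOn.congr (f := fun u => ∑ K ∈ Finset.univ.filter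
    (fun K : Finset (Fin d) => I ⊆ K),
        (-1 : ℝ) ^ (K.card + I.card) * mixedPartial t (levyCopula κ K) u) ?_
    fun u hu => hreg.mixedPartial_faceTail hκ ht hu
  refine continuousOn_finsetSum _ fun K hK => ContinuousOn.mul continuousOn_const ?_
  exact (hreg.continuousOn_mixedPartial hκ (ht.trans (Finset.mem_filter.1 hK).2) hne).mono
    fun u hu j _ => hu j

theorem IsTailRegular.mixedPartial_faceTail_nonneg {κ : Measure (Fin d → ℝ)} (hκ : IsCopulaLaw κ)
    (hreg : IsTailRegular κ) {I : Finset (Fin d)} (hI : I.Nonempty) {u : Fin d → ℝ}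
    (hu : ∀ i, 0 < u i) : 0 ≤ mixedPartial I (faceTail κ I) u := by
  have := boxDiff_mixedPartial_nonneg I (faceTail κ I) ∅ (Finset.disjoint_empty_left _)
    (hreg.mixedDiffOn_faceTail hκ I) (fun a b u ha hb hu => by
      rw [Finset.empty_union]; exact hreg.boxDiff_faceTail_nonneg hκ hI ha hb hu)
    u u u hu (fun _ => le_rfl) hu
  rwa [boxDiff_empty] at this

theorem IsTailRegular.abs_faceTail_le {κ : Measure (Fin d → ℝ)} (hκ : IsCopulaLaw κ)
    (hreg : IsTailRegular κ) {I : Finset (Fin d)} {i : Fin d} (hi : i ∈ I) {u : Fin d → ℝ}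
    (hu : ∀ i, 0 ≤ u i) :
    |faceTail κ I u| ≤ (Finset.univ.filter (fun K : Finset (Fin d) => I ⊆ K)).card * u i := by
  refine (Finset.abs_sum_le_sum_abs _ _).trans ?_
  rw [← nsmul_eq_mul]
  refine Finset.sum_le_card_nsmul _ _ _ fun K hK => ?_
  have hiK := (Finset.mem_filter.1 hK).2 hi
  rw [abs_mul, abs_pow, abs_neg, abs_one, one_pow, one_mul,
    abs_of_nonneg (hreg.levyCopula_nonneg hκ ⟨i, hiK⟩ fun j _ => hu j)]
  exact hreg.levyCopula_le hκ (fun j _ => hu j) hiK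

/-- As the lower ends of the box go to zero, only the upper corner contributes to the increment. -/
theorem IsTailRegular.tendsto_boxDiff_faceTail {κ : Measure (Fin d → ℝ)} (hκ : IsCopulaLaw κ)
    (hreg : IsTailRegular κ) {I : Finset (Fin d)} {b : Fin d → ℝ}
    (hb : ∀ i, 0 < b i) :
    Tendsto (fun ε : ℝ => boxDiff I (fun _ => ε) b (faceTail κ I) b) (𝓝[>] 0)
      (𝓝 (faceTail κ I b)) := by
  have h1 : ∀ t ∈ I.powerset, Tendsto (fun ε : ℝ =>
      (-1 : ℝ) ^ t.card * faceTail κ I (boxCorner I t (fun _ => ε) b b)) (𝓝[>] 0)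
      (𝓝 (if t = ∅ then faceTail κ I b else 0)) := by
    intro t ht
    by_cases h0 : t = ∅
    · have : ∀ ε : ℝ, boxCorner I ∅ (fun _ => ε) b b = b := by
        intro ε; ext i; simp [boxCorner]
      subst h0
      simp only [this, if_true, Finset.card_empty, pow_zero, one_mul]
      exact tendsto_const_nhds
    · obtain ⟨i, hi⟩ := Finset.nonempty_iff_ne_empty.2 h0
      rw [if_neg h0]
      have h2 : Tendsto (fun ε : ℝ =>
          ((Finset.univ.filter (fun K : Finset (Fin d) => I ⊆ K)).card : ℝ) * ε) (𝓝[>] 0)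
          (𝓝 0) := by
        have hc : Continuous (fun ε : ℝ =>
          ((Finset.univ.filter (fun K : Finset (Fin d) => I ⊆ K)).card : ℝ) * ε) := by fun_prop
        have := hc.tendsto' 0 0 (by simp)
        exact this.mono_left nhdsWithin_le_nhds
      refine squeeze_zero_norm' ?_ h2
      filter_upwards [self_mem_nhdsWithin] with ε hε
      have hε' : (0 : ℝ) < ε := hε
      rw [norm_mul, norm_pow, norm_neg, norm_one, one_pow, one_mul]
      refine (hreg.abs_faceTail_le hκ (Finset.mem_powerset.1 ht hi) fun j => ?_).trans_eq ?_
      · simp only [boxCorner]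
        split_ifs
        · exact hε'.le
        · exact (hb j).le
        · exact (hb j).le
      · simp [boxCorner, hi]
  have h2 := tendsto_finsetSum _ h1
  rw [Finset.sum_ite_eq' I.powerset ∅, if_pos (Finset.empty_mem_powerset I)] at h2
  exact h2

/-- The mixed derivative of `H_I` along the coordinates of `I`, set to zero outside the open
orthant: the density of the face `I` in the transformed coordinates. -/
noncomputable def faceDensity (κ : Measure (Fin d → ℝ)) (I : Finset (Fin d)) (u : Fin d → ℝ) : ℝ :=
  Set.indicator {u | ∀ i, 0 < u i} (mixedPartial I (faceTail κ I)) u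

theorem IsTailRegular.measurable_faceDensity {κ : Measure (Fin d → ℝ)} (hκ : IsCopulaLaw κ)
    (hreg : IsTailRegular κ) {I : Finset (Fin d)} (hI : I.Nonempty) :
    Measurable (faceDensity κ I) :=
  measurable_indicator_of_continuousOn isOpen_posOrthant
    (hreg.continuousOn_mixedPartial_faceTail hκ subset_rfl hI)

/-- Lebesgue measure on the box `∏_{i ∈ I} (0, bᵢ]`, with the other coordinates equal to those
of `b`. -/
noncomputable def faceBox (I : Finset (Fin d)) (b : Fin d → ℝ) (i : Fin d) : Measure ℝ :=
  if i ∈ I then volume.restrict (Set.Ioc 0 (b i)) else Measure.dirac (b i)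

instance (I : Finset (Fin d)) (b : Fin d → ℝ) (i : Fin d) : IsFiniteMeasure (faceBox I b i) := by
  unfold faceBox
  split_ifs <;> infer_instance

theorem IsTailRegular.setLIntegral_faceDensity {κ : Measure (Fin d → ℝ)} (hκ : IsCopulaLaw κ)
    (hreg : IsTailRegular κ) {I : Finset (Fin d)} (hI : I.Nonempty) {b : Fin d → ℝ}
    (hb : ∀ i, 0 < b i) {ε : ℝ} (hε : 0 < ε) (hεb : ∀ i, ε ≤ b i) :
    ∫⁻ u in {u | ∀ i ∈ I, ε < u i}, ENNReal.ofReal (faceDensity κ I u)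
        ∂(Measure.pi (faceBox I b))
      = ENNReal.ofReal (boxDiff I (fun _ => ε) b (faceTail κ I) b) := by
  let S : Fin d → Set ℝ := fun i => if i ∈ I then Set.Ioi ε else Set.univ
  have hS : {u : Fin d → ℝ | ∀ i ∈ I, ε < u i} = Set.univ.pi S := by
    ext u
    simp only [Set.mem_ofPred_eq, Set.mem_pi, Set.mem_univ, true_imp_iff, S]
    refine forall_congr' fun i => ?_
    by_cases hi : i ∈ I <;> simp [hi]
  have hmeas : Measurable fun u => ENNReal.ofReal (faceDensity κ I u) :=
    (hreg.measurable_faceDensity hκ hI).ennreal_ofReal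
  rw [hS, Measure.restrict_pi_pi, lintegral_eq_lmarginal_univ b]
  have hμI : ∀ i ∈ I, (faceBox I b i).restrict (S i) = volume.restrict (Set.Ioc ε (b i)) := by
    intro i hi
    simp only [faceBox, S, hi, if_true]
    rw [Measure.restrict_restrict measurableSet_Ioi]
    congr 1
    ext y
    simp only [Set.mem_inter_iff, Set.mem_Ioi, Set.mem_Ioc]
    exact ⟨fun h => ⟨h.1, h.2.2⟩, fun h => ⟨h.1, hε.trans h.1, h.2⟩⟩
  have hμI' : ∀ i ∈ Iᶜ, (faceBox I b i).restrict (S i) = Measure.dirac (b i) := by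
    intro i hi
    simp [faceBox, S, Finset.mem_compl.1 hi]
  have hdisj : Disjoint Iᶜ I := disjoint_compl_left
  rw [← Finset.union_compl I, Finset.union_comm, lmarginal_union _ _ hmeas hdisj,
    lmarginal_dirac b (hmeas.lmarginal _) Iᶜ hμI']
  have hbu : (fun i => if i ∈ Iᶜ then b i else b i) = b := by ext i; simp
  rw [hbu]
  have := lmarginal_mixedPartial (hreg.mixedDiffOn_faceTail hκ I)
    (fun t ht hne => hreg.continuousOn_mixedPartial_faceTail hκ ht hne)
    (fun a b u ha hb hu => hreg.boxDiff_faceTail_nonneg hκ hI ha hb hu)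
    (a := fun _ => ε) (b := b) (fun _ => hε) hεb
    (fun i => (faceBox I b i).restrict (S i)) I ∅ (by simp) (by simp) hμI b hb
  rw [mixedPartial_empty] at this
  exact this

/-- The total mass of the face `I` over a box is the value of `H_I` at its upper corner. -/
theorem IsTailRegular.lintegral_faceDensity {κ : Measure (Fin d → ℝ)} (hκ : IsCopulaLaw κ)
    (hreg : IsTailRegular κ) {I : Finset (Fin d)} (hI : I.Nonempty) {b : Fin d → ℝ}
    (hb : ∀ i, 0 ≤ b i) (hbI : ∀ i ∉ I, 0 < b i) :
    ∫⁻ u, ENNReal.ofReal (faceDensity κ I u) ∂(Measure.pi (faceBox I b))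
      = ENNReal.ofReal (faceTail κ I b) := by
  by_cases hpos : ∀ i, 0 < b i
  · let ε : ℕ → ℝ := fun n => 1 / ((n : ℝ) + 1)
    have hε : Tendsto ε atTop (𝓝[>] 0) := tendsto_nhdsWithin_iff.2
      ⟨tendsto_one_div_add_atTop_nhds_zero_nat, Eventually.of_forall fun n => by
        rw [Set.mem_Ioi]; positivity⟩
    let S : ℕ → Set (Fin d → ℝ) := fun n => {u | ∀ i ∈ I, ε n < u i}
    have hSmono : Monotone S := by
      intro m n hmn u hu i hi
      exact (Nat.one_div_le_one_div hmn).trans_lt (hu i hi)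
    have hSU : ⋃ n, S n = {u | ∀ i ∈ I, 0 < u i} := by
      ext u
      simp only [Set.mem_iUnion, Set.mem_ofPred_eq]
      constructor
      · rintro ⟨n, hn⟩ i hi
        have : (0 : ℝ) < ε n := by positivity
        exact this.trans (hn i hi)
      · intro h
        have : ∀ᶠ n in atTop, ∀ i ∈ I, ε n < u i := by
          rw [Filter.eventually_all_finset]
          intro i hi
          exact tendsto_one_div_add_atTop_nhds_zero_nat.eventually_lt_const (h i hi)
        exact this.exists
    have hSmeas : ∀ n, MeasurableSet (S n) := fun n =>
      (isOpen_setOf_forall_mem (I := I) (A := fun _ => Set.Ioi (ε n))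
        fun _ => isOpen_Ioi).measurableSet
    have h1 := tendsto_measure_iUnion_atTop (μ := (Measure.pi (faceBox I b)).withDensity
      fun u => ENNReal.ofReal (faceDensity κ I u)) hSmono
    rw [hSU] at h1
    have h2 : ((Measure.pi (faceBox I b)).withDensity fun u => ENNReal.ofReal (faceDensity κ I u))
        {u | ∀ i ∈ I, 0 < u i}
        = ∫⁻ u, ENNReal.ofReal (faceDensity κ I u) ∂(Measure.pi (faceBox I b)) := by
      rw [← hSU, withDensity_apply _ (MeasurableSet.iUnion hSmeas), hSU,
        Measure.restrict_eq_self_of_ae_mem]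
      refine eventually_all.2 fun i => ?_
      by_cases hi : i ∈ I
      · have h0 : ∀ᵐ y ∂(faceBox I b i), 0 < y := by
          rw [faceBox, if_pos hi]
          filter_upwards [ae_restrict_mem measurableSet_Ioc] with y hy using hy.1
        filter_upwards [Measure.tendsto_eval_ae_ae.eventually h0] with u hu _ using hu
      · exact Eventually.of_forall fun _ h => absurd h hi
    rw [← h2]
    refine tendsto_nhds_unique h1 ?_
    have h3 := (ENNReal.continuous_ofReal.tendsto _).comp
      ((hreg.tendsto_boxDiff_faceTail hκ hpos (I := I)).comp hε)
    refine h3.congr' ?_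
    have h4 : ∀ᶠ n in atTop, ∀ i, ε n < b i := by
      rw [eventually_all]
      intro i
      exact tendsto_one_div_add_atTop_nhds_zero_nat.eventually_lt_const (hpos i)
    filter_upwards [h4] with n hn
    have : (0 : ℝ) < ε n := by positivity
    rw [Function.comp_apply, Function.comp_apply, Function.comp_apply,
      withDensity_apply _ (hSmeas n)]
    exact (hreg.setLIntegral_faceDensity hκ hI hpos this fun i => (hn i).le).symm
  · push Not at hpos
    obtain ⟨i, hi⟩ := hpos
    have hi0 : b i = 0 := le_antisymm hi (hb i)
    have hiI : i ∈ I := by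
      by_contra h
      exact (hbI i h).not_ge hi
    have hzero : Measure.pi (faceBox I b) = 0 := by
      rw [← Measure.measure_univ_eq_zero, Measure.pi_univ]
      refine Finset.prod_eq_zero (Finset.mem_univ i) ?_
      simp [faceBox, hiI, hi0]
    rw [hzero, lintegral_zero_measure]
    have := hreg.abs_faceTail_le hκ hiI hb
    rw [hi0, mul_zero] at this
    rw [abs_nonpos_iff.1 this, ENNReal.ofReal_zero]

/-! ### Product measures and densities -/

theorem lmarginal_prod_eq {ι : Type*} [DecidableEq ι] {α : ι → Type*}
    [∀ i, MeasurableSpace (α i)] (μ : ∀ i, Measure (α i)) [∀ i, SigmaFinite (μ i)]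
    {w : ∀ i, α i → ENNReal} (hw : ∀ i, Measurable (w i)) (u : Finset ι) (s : Finset ι) :
    s ⊆ u → ∀ x : ∀ i, α i, lmarginal μ s (fun x => ∏ i ∈ u, w i (x i)) x
      = (∏ i ∈ s, ∫⁻ y, w i y ∂(μ i)) * ∏ i ∈ u \ s, w i (x i) := by
  have hmeas : Measurable (fun x : ∀ i, α i => ∏ i ∈ u, w i (x i)) :=
    Finset.measurable_fun_prod _ fun i _ => (hw i).comp (measurable_pi_apply i)
  induction s using Finset.induction_on with
  | empty => intro _ x; simp
  | insert m s hm ih =>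
    intro hs x
    have hmu : m ∈ u := hs (Finset.mem_insert_self _ _)
    have e : u \ s = insert m (u \ insert m s) := by
      ext i
      simp only [Finset.mem_sdiff, Finset.mem_insert]
      by_cases h : i = m
      · subst h; simp [hmu, hm]
      · simp [h]
    have hmn : m ∉ u \ insert m s := by simp
    rw [lmarginal_insert _ hmeas hm, Finset.prod_insert hm]
    simp only [ih ((Finset.subset_insert _ _).trans hs), e]
    have h1 : ∀ y, ∏ i ∈ insert m (u \ insert m s), w i (Function.update x m y i)
        = w m y * ∏ i ∈ u \ insert m s, w i (x i) := by
      intro y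
      rw [Finset.prod_insert hmn, Function.update_self]
      congr 1
      refine Finset.prod_congr rfl fun i hi => ?_
      rw [Function.update_of_ne (by rintro rfl; exact hmn hi)]
    simp only [h1]
    rw [lintegral_const_mul _ ((hw m).mul_const _), lintegral_mul_const _ (hw m)]
    ring

theorem lintegral_pi_prod_eq {ι : Type*} [Fintype ι] {α : ι → Type*}
    [∀ i, MeasurableSpace (α i)] (μ : ∀ i, Measure (α i)) [∀ i, SigmaFinite (μ i)]
    {w : ∀ i, α i → ENNReal} (hw : ∀ i, Measurable (w i)) :
    ∫⁻ x, ∏ i, w i (x i) ∂(Measure.pi μ) = ∏ i, ∫⁻ y, w i y ∂(μ i) := by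
  classical
  by_cases hne : Nonempty (∀ i, α i)
  · obtain ⟨x⟩ := hne
    rw [lintegral_eq_lmarginal_univ x, lmarginal_prod_eq μ hw _ _ subset_rfl]
    simp
  · rw [not_nonempty_iff] at hne
    obtain ⟨i, hi⟩ := isEmpty_pi.1 hne
    rw [Measure.eq_zero_of_isEmpty (Measure.pi μ), lintegral_zero_measure]
    refine (Finset.prod_eq_zero (Finset.mem_univ i) ?_).symm
    rw [Measure.eq_zero_of_isEmpty (μ i), lintegral_zero_measure]

theorem pi_withDensity {ι : Type*} [Fintype ι] {α : ι → Type*}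
    [∀ i, MeasurableSpace (α i)] (μ : ∀ i, Measure (α i)) [∀ i, SigmaFinite (μ i)]
    {w : ∀ i, α i → ENNReal} (hw : ∀ i, Measurable (w i))
    [∀ i, SigmaFinite ((μ i).withDensity (w i))] :
    (Measure.pi μ).withDensity (fun x => ∏ i, w i (x i))
      = Measure.pi (fun i => (μ i).withDensity (w i)) := by
  symm
  refine Measure.pi_eq fun s hs => ?_
  rw [withDensity_apply _ (MeasurableSet.univ_pi hs), Measure.restrict_pi_pi,
    lintegral_pi_prod_eq _ hw]
  exact Finset.prod_congr rfl fun i _ => (withDensity_apply _ (hs i)).symm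

theorem withDensity_finsetSum {ι α : Type*} [MeasurableSpace α] (s : Finset ι) (μ : ι → Measure α)
    (f : α → ENNReal) : (∑ i ∈ s, μ i).withDensity f = ∑ i ∈ s, (μ i).withDensity f := by
  classical
  induction s using Finset.induction_on with
  | empty => simp
  | insert a s ha ih => rw [Finset.sum_insert ha, Finset.sum_insert ha, withDensity_add_measure, ih]

/-! ### Transforming a severity by its tail integral -/

theorem severitySurvival_antitone {ψ : ℝ → ℝ} (hψ : IsSeverityDensity ψ) :
    Antitone (severitySurvival ψ) := by
  intro x y hxy
  rcases le_total 0 x with hx | hx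
  · exact severitySurvival_antitoneOn hψ hx hxy
  · rw [severitySurvival, severitySurvival, severityCDF_of_nonpos hx, sub_zero, sub_le_self_iff,
      severityCDF]
    exact setIntegral_nonneg measurableSet_Ioc fun s hs => hψ.nonneg s hs.1

theorem continuousOn_severitySurvival {ψ : ℝ → ℝ} (hψ : IsSeverityDensity ψ) (b : ℝ) :
    ContinuousOn (severitySurvival ψ) (Set.Icc 0 b) := by
  have h : IntegrableOn ψ (Set.Icc 0 b) := by
    rw [integrableOn_Icc_iff_integrableOn_Ioc]
    exact hψ.integrableOn.mono_set Set.Ioc_subset_Ioi_self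
  exact continuousOn_const.sub (intervalIntegral.continuousOn_primitive h)

theorem exists_severitySurvival_eq {ψ : ℝ → ℝ} (hψ : IsSeverityDensity ψ) {a : ℝ} (ha : 0 ≤ a)
    {y : ℝ} (hy : 0 < y) (hya : y < severitySurvival ψ a) :
    ∃ x, a ≤ x ∧ severitySurvival ψ x = y := by
  obtain ⟨b, hb1, hb2⟩ := (((tendsto_severitySurvival hψ).eventually_lt_const hy).and
    (eventually_ge_atTop a)).exists
  obtain ⟨x, hx, hxy⟩ := intermediate_value_Icc' hb2
    ((continuousOn_severitySurvival hψ b).mono (Set.Icc_subset_Icc_left ha)) ⟨hb1.le, hya.le⟩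
  exact ⟨x, hx.1, hxy⟩

/-- The density `c ψ` as a function on the line, set to zero off `(0, ∞)`, where `ψ` is
arbitrary. -/
noncomputable def severityWeight (c : ℝ) (ψ : ℝ → ℝ) (x : ℝ) : ENNReal :=
  ENNReal.ofReal (c * Set.indicator (Set.Ioi 0) ψ x)

theorem measurable_severityWeight {ψ : ℝ → ℝ} (hψ : IsSeverityDensity ψ) (c : ℝ) :
    Measurable (severityWeight c ψ) := by
  classical
  have : Measurable (Set.indicator (Set.Ioi 0) ψ) := by
    rw [← Set.piecewise_eq_indicator]
    exact hψ.continuousOn.measurable_piecewise continuousOn_const measurableSet_Ioi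
  exact (measurable_const.mul this).ennreal_ofReal

theorem withDensity_severityWeight_Ioi {ψ : ℝ → ℝ} (hψ : IsSeverityDensity ψ) {c : ℝ}
    (hc : 0 < c) {x : ℝ} (hx : 0 ≤ x) :
    ((volume.restrict (Set.Ioi 0)).withDensity (severityWeight c ψ)) (Set.Ioi x)
      = ENNReal.ofReal (c * severitySurvival ψ x) := by
  rw [withDensity_apply _ measurableSet_Ioi, Measure.restrict_restrict measurableSet_Ioi,
    Set.inter_eq_self_of_subset_left (Set.Ioi_subset_Ioi hx), severitySurvival_eq_integral hψ hx,
    ← integral_const_mul, ofReal_integral_eq_lintegral_ofReal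
      ((hψ.integrableOn.mono_set (Set.Ioi_subset_Ioi hx)).const_mul c)]
  · refine setLIntegral_congr_fun measurableSet_Ioi fun y hy => ?_
    have hy0 : y ∈ Set.Ioi (0 : ℝ) := lt_of_le_of_lt hx hy
    rw [severityWeight, Set.indicator_of_mem hy0]
  · filter_upwards [ae_restrict_mem measurableSet_Ioi] with y hy
    exact mul_nonneg hc.le (hψ.nonneg y (lt_of_le_of_lt hx hy))

/-- The tail integral `c Ψ̄` maps the measure `c ψ(x) dx` on `(a, ∞)` to Lebesgue measure on
`(0, c Ψ̄(a)]`. -/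
theorem map_severitySurvival {ψ : ℝ → ℝ} (hψ : IsSeverityDensity ψ) {c : ℝ} (hc : 0 < c)
    {a : ℝ} (ha : 0 ≤ a) :
    (((volume.restrict (Set.Ioi 0)).withDensity (severityWeight c ψ)).restrict
      (Set.Ioi a)).map (fun x => c * severitySurvival ψ x)
      = volume.restrict (Set.Ioc 0 (c * severitySurvival ψ a)) := by
  have hmeas : Measurable fun x => c * severitySurvival ψ x :=
    measurable_const.mul (severitySurvival_antitone hψ).measurable
  set m := (volume.restrict (Set.Ioi 0)).withDensity (severityWeight c ψ) with hm
  have hIoi : ∀ x, a ≤ x → m (Set.Ioi x) = ENNReal.ofReal (c * severitySurvival ψ x) :=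
    fun x hx => withDensity_severityWeight_Ioi hψ hc (ha.trans hx)
  have hfin : IsFiniteMeasure (m.restrict (Set.Ioi a)) := by
    refine ⟨?_⟩
    rw [Measure.restrict_apply MeasurableSet.univ, Set.univ_inter, hIoi a le_rfl]
    exact ENNReal.ofReal_lt_top
  refine Measure.ext_of_Iic _ _ fun t => ?_
  rw [Measure.map_apply hmeas measurableSet_Iic,
    Measure.restrict_apply (hmeas measurableSet_Iic), Measure.restrict_apply measurableSet_Iic]
  have hR : Set.Iic t ∩ Set.Ioc 0 (c * severitySurvival ψ a)
      = Set.Ioc 0 (min t (c * severitySurvival ψ a)) := by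
    ext y
    simp only [Set.mem_inter_iff, Set.mem_Iic, Set.mem_Ioc, le_min_iff]
    tauto
  rw [hR, Real.volume_Ioc, sub_zero]
  rcases le_or_gt (c * severitySurvival ψ a) t with hta | hta
  · rw [min_eq_right hta, ← hIoi a le_rfl]
    congr 1
    refine Set.inter_eq_right.2 fun x hx => ?_
    exact (mul_le_mul_of_nonneg_left (severitySurvival_antitone hψ (le_of_lt hx)) hc.le).trans hta
  · rw [min_eq_left hta.le]
    rcases lt_or_ge t 0 with ht0 | ht0
    · rw [ENNReal.ofReal_of_nonpos ht0.le]
      have : (fun x => c * severitySurvival ψ x) ⁻¹' Set.Iic t ∩ Set.Ioi a = ∅ := by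
        ext x
        simp only [Set.mem_inter_iff, Set.mem_preimage, Set.mem_Iic, Set.mem_Ioi,
          Set.mem_empty_iff_false, iff_false, not_and]
        intro h hx
        have := mul_nonneg hc.le (severitySurvival_nonneg hψ (ha.trans (le_of_lt hx)))
        linarith
      rw [this, measure_empty]
    -- values strictly between `t` and the total mass are attained, and bound the level set
    have hex : ∀ y, 0 < y → y < c * severitySurvival ψ a →
        ∃ x, a ≤ x ∧ c * severitySurvival ψ x = y := by
      intro y hy hya
      obtain ⟨x, hx, hxy⟩ := exists_severitySurvival_eq hψ ha (div_pos hy hc)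
        ((div_lt_iff₀' hc).2 hya)
      exact ⟨x, hx, by rw [hxy, mul_div_cancel₀ _ hc.ne']⟩
    apply le_antisymm
    · have hlim : Tendsto (fun y => ENNReal.ofReal y) (𝓝[>] t) (𝓝 (ENNReal.ofReal t)) :=
        (ENNReal.continuous_ofReal.tendsto t).mono_left nhdsWithin_le_nhds
      refine ge_of_tendsto hlim ?_
      filter_upwards [Ioo_mem_nhdsGT hta] with y hy
      obtain ⟨x, hx, hxy⟩ := hex y (ht0.trans_lt hy.1) hy.2
      rw [← hxy, ← hIoi x hx]
      refine measure_mono ?_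
      rintro z ⟨hz, -⟩
      rw [Set.mem_preimage, Set.mem_Iic] at hz
      by_contra hzx
      have := mul_le_mul_of_nonneg_left (severitySurvival_antitone hψ (not_lt.1 hzx)) hc.le
      linarith [hy.1]
    · rcases ht0.eq_or_lt with rfl | ht0
      · simp
      · obtain ⟨x, hx, hxy⟩ := hex t ht0 hta
        rw [← hxy, ← hIoi x hx]
        refine measure_mono fun z hz => ⟨?_, lt_of_le_of_lt hx hz⟩
        rw [Set.mem_preimage, Set.mem_Iic]
        exact mul_le_mul_of_nonneg_left (severitySurvival_antitone hψ (le_of_lt hz)) hc.le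

/-! ### Möbius inversion over the active sets -/

theorem sum_interval_neg_one_pow_card (J K : Finset (Fin d)) :
    ∑ I ∈ Finset.univ.filter (fun I : Finset (Fin d) => J ⊆ I ∧ I ⊆ K), (-1 : ℝ) ^ I.card
      = if J = K then (-1) ^ J.card else 0 := by
  by_cases hJK : J ⊆ K
  · have h1 : ∑ I ∈ Finset.univ.filter (fun I : Finset (Fin d) => J ⊆ I ∧ I ⊆ K), (-1 : ℝ) ^ I.card
        = ∑ L ∈ (K \ J).powerset, (-1 : ℝ) ^ J.card * (-1) ^ L.card := by
      refine Finset.sum_nbij' (fun I => I \ J) (fun L => J ∪ L) ?_ ?_ ?_ ?_ ?_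
      · intro I hI
        exact Finset.mem_powerset.2
          (Finset.sdiff_subset_sdiff (Finset.mem_filter.1 hI).2.2 subset_rfl)
      · intro L hL
        have hL' := Finset.mem_powerset.1 hL
        refine Finset.mem_filter.2 ⟨Finset.mem_univ _, Finset.subset_union_left, ?_⟩
        exact Finset.union_subset hJK (hL'.trans Finset.sdiff_subset)
      · intro I hI
        exact Finset.union_sdiff_of_subset (Finset.mem_filter.1 hI).2.1
      · intro L hL
        have hL' := Finset.mem_powerset.1 hL
        exact Finset.union_sdiff_cancel_left
          (Finset.disjoint_sdiff.mono_right hL')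
      · intro I hI
        rw [← pow_add, ← Finset.card_union_of_disjoint Finset.disjoint_sdiff,
          Finset.union_sdiff_of_subset (Finset.mem_filter.1 hI).2.1]
    have h2 : ∑ L ∈ (K \ J).powerset, (-1 : ℝ) ^ L.card = if K \ J = ∅ then 1 else 0 := by
      have := Finset.sum_powerset_neg_one_pow_card (x := K \ J)
      exact_mod_cast this
    rw [h1, ← Finset.mul_sum, h2]
    by_cases h : J = K
    · simp [h]
    · have : K \ J ≠ ∅ := fun h0 => h (subset_antisymm hJK (Finset.sdiff_eq_empty_iff_subset.1 h0))
      simp [h, this]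
  · rw [if_neg (fun h => hJK h.le), Finset.sum_eq_zero]
    intro I hI
    exact absurd ((Finset.mem_filter.1 hI).2.1.trans (Finset.mem_filter.1 hI).2.2) hJK

theorem sum_superset_sum_superset (f : Finset (Fin d) → ℝ) (J : Finset (Fin d)) :
    ∑ I ∈ Finset.univ.filter (fun I : Finset (Fin d) => J ⊆ I), (-1 : ℝ) ^ I.card *
      ∑ K ∈ Finset.univ.filter (fun K : Finset (Fin d) => I ⊆ K), f K = (-1) ^ J.card * f J := by
  have h1 : ∀ I : Finset (Fin d), (-1 : ℝ) ^ I.card *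
      ∑ K ∈ Finset.univ.filter (fun K : Finset (Fin d) => I ⊆ K), f K
      = ∑ K, if I ⊆ K then (-1 : ℝ) ^ I.card * f K else 0 := by
    intro I
    rw [Finset.mul_sum, Finset.sum_filter]
  simp only [h1]
  rw [Finset.sum_comm]
  have h2 : ∀ K : Finset (Fin d), ∑ I ∈ Finset.univ.filter (fun I : Finset (Fin d) => J ⊆ I),
      (if I ⊆ K then (-1 : ℝ) ^ I.card * f K else 0)
      = if J = K then (-1) ^ J.card * f K else 0 := by
    intro K
    rw [← Finset.sum_filter, Finset.filter_filter, ← Finset.sum_mul,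
      sum_interval_neg_one_pow_card, ite_mul, zero_mul]
  simp only [h2]
  rw [Finset.sum_ite_eq, if_pos (Finset.mem_univ _)]

theorem neg_one_pow_mul_self (n : ℕ) : (-1 : ℝ) ^ n * (-1) ^ n = 1 := by
  rw [← mul_pow]; simp

/-- Functions of the nonempty active sets are determined by their upper sums. -/
theorem eq_of_sum_superset_eq {f g : Finset (Fin d) → ℝ} {J : Finset (Fin d)}
    (hJ : J.Nonempty) (h : ∀ I : Finset (Fin d), I.Nonempty →
      ∑ K ∈ Finset.univ.filter (fun K : Finset (Fin d) => I ⊆ K), f K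
        = ∑ K ∈ Finset.univ.filter (fun K : Finset (Fin d) => I ⊆ K), g K) : f J = g J := by
  have h1 := sum_superset_sum_superset f J
  rw [Finset.sum_congr rfl fun I hI => by rw [h I (hJ.mono (Finset.mem_filter.1 hI).2)],
    sum_superset_sum_superset g J] at h1
  have h2 := congrArg (fun y => (-1 : ℝ) ^ J.card * y) h1
  simp only [← mul_assoc, neg_one_pow_mul_self, one_mul] at h2
  exact h2.symm

/-- The face contributions `H_I`, `I ⊇ J`, add up to the Lévy copula `𝔠_J`. -/
theorem sum_faceTail (κ : Measure (Fin d → ℝ)) (J : Finset (Fin d)) (u : Fin d → ℝ) :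
    ∑ I ∈ Finset.univ.filter (fun I : Finset (Fin d) => J ⊆ I), faceTail κ I u
      = levyCopula κ J u := by
  have h := sum_superset_sum_superset (fun K => (-1 : ℝ) ^ K.card * levyCopula κ K u) J
  rw [← mul_assoc, neg_one_pow_mul_self, one_mul] at h
  rw [← h]
  refine Finset.sum_congr rfl fun I _ => ?_
  rw [faceTail, Finset.mul_sum]
  refine Finset.sum_congr rfl fun K _ => ?_
  rw [pow_add]; ring

theorem IsTailRegular.faceTail_nonneg {κ : Measure (Fin d → ℝ)} (hκ : IsCopulaLaw κ)
    (hreg : IsTailRegular κ) {I : Finset (Fin d)} (hI : I.Nonempty) {b : Fin d → ℝ}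
    (hb : ∀ i, 0 ≤ b i) (hbI : ∀ i ∉ I, 0 < b i) : 0 ≤ faceTail κ I b := by
  by_cases hpos : ∀ i, 0 < b i
  · refine ge_of_tendsto (hreg.tendsto_boxDiff_faceTail hκ hpos) ?_
    have : ∀ᶠ ε in 𝓝[>] (0 : ℝ), ∀ i, ε ≤ b i := by
      rw [eventually_all]
      intro i
      exact mem_nhdsWithin_of_mem_nhds (Iic_mem_nhds (hpos i))
    filter_upwards [self_mem_nhdsWithin, this] with ε hε hεb
    exact hreg.boxDiff_faceTail_nonneg hκ hI (fun _ => hε) hεb hpos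
  · push Not at hpos
    obtain ⟨i, hi⟩ := hpos
    have hi0 : b i = 0 := le_antisymm hi (hb i)
    have hiI : i ∈ I := by
      by_contra h
      exact (hbI i h).not_ge hi
    have := hreg.abs_faceTail_le hκ hiI hb
    rw [hi0, mul_zero] at this
    exact (abs_nonpos_iff.1 this).ge

/-! ### The Lévy measure with density `ζ ∏ λᵢ ψᵢ` -/

/-- The marginals of the part of the reference measure for claim vectors on the face `I`. -/
noncomputable def claimMarginal (I : Finset (Fin d)) (i : Fin d) : Measure ℝ :=
  if i ∈ I then volume.restrict (Set.Ioi (0 : ℝ)) else Measure.dirac 0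

instance (I : Finset (Fin d)) (i : Fin d) : SigmaFinite (claimMarginal I i) := by
  unfold claimMarginal
  split_ifs <;> infer_instance

theorem claimReference_eq (d : ℕ) : claimReference d
    = ∑ I ∈ Finset.univ.filter (fun I : Finset (Fin d) => I.Nonempty),
      Measure.pi (claimMarginal I) := rfl

/-- The claim vectors with active set `I`. -/
def claimFace (I : Finset (Fin d)) : Set (Fin d → ℝ) :=
  {x | (∀ i ∈ I, 0 < x i) ∧ ∀ j ∉ I, x j = 0}

theorem measurableSet_claimFace (I : Finset (Fin d)) : MeasurableSet (claimFace I) := by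
  have h1 : MeasurableSet {z : Fin d → ℝ | ∀ i ∈ I, 0 < z i} :=
    (isOpen_setOf_forall_mem (A := fun _ => Set.Ioi 0) fun _ => isOpen_Ioi).measurableSet
  have h2 : MeasurableSet {z : Fin d → ℝ | ∀ j ∉ I, z j = 0} := by
    simp only [Set.ofPred_forall]
    exact MeasurableSet.iInter fun i => MeasurableSet.iInter fun _ =>
      measurableSet_eq_fun (measurable_pi_apply i) measurable_const
  exact h1.inter h2

theorem activeSet_of_mem_claimFace {I : Finset (Fin d)} {x : Fin d → ℝ} (hx : x ∈ claimFace I) :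
    activeSet x = I := by
  ext i
  rw [mem_activeSet]
  constructor
  · intro h
    by_contra hi
    exact h.ne' (hx.2 i hi)
  · exact hx.1 i

theorem mem_claimFace_activeSet {x : Fin d → ℝ} (hx : ∀ i, 0 ≤ x i) :
    x ∈ claimFace (activeSet x) :=
  ⟨fun _ hi => mem_activeSet.1 hi, fun _ hj => eq_zero_of_notMem_activeSet hx hj⟩

theorem ae_mem_claimFace (I : Finset (Fin d)) :
    ∀ᵐ x ∂(Measure.pi (claimMarginal I)), x ∈ claimFace I := by
  have h : ∀ i, ∀ᵐ y ∂(claimMarginal I i), if i ∈ I then 0 < y else y = 0 := by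
    intro i
    by_cases hi : i ∈ I
    · simp only [claimMarginal, hi, if_true]
      filter_upwards [ae_restrict_mem measurableSet_Ioi] with y hy using hy
    · simp only [claimMarginal, hi, if_false]
      rw [ae_dirac_eq]
      exact rfl
  have h2 : ∀ᵐ x ∂(Measure.pi (claimMarginal I)), ∀ i, if i ∈ I then 0 < x i else x i = 0 :=
    eventually_all.2 fun i => Measure.tendsto_eval_ae_ae.eventually (h i)
  filter_upwards [h2] with x hx
  refine ⟨fun i hi => ?_, fun i hi => ?_⟩
  · have := hx i
    rwa [if_pos hi] at this
  · have := hx i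
    rwa [if_neg hi] at this

theorem ae_claimReference (d : ℕ) : ∀ᵐ x ∂(claimReference d),
    (∀ i, 0 ≤ x i) ∧ (activeSet x).Nonempty := by
  rw [claimReference_eq, ← Measure.sum_coe_finset, Measure.ae_sum_iff]
  rintro ⟨I, hI⟩
  filter_upwards [ae_mem_claimFace I] with x hx
  rw [activeSet_of_mem_claimFace hx]
  refine ⟨fun i => ?_, (Finset.mem_filter.1 hI).2⟩
  by_cases hi : i ∈ I
  · exact (hx.1 i hi).le
  · exact (hx.2 i hi).ge

/-- The vector of the marginal tail integrals. -/
noncomputable def tailTransform (ψ : Fin d → ℝ → ℝ) (c : Fin d → ℝ) (x : Fin d → ℝ) : Fin d → ℝ :=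
  fun i => c i * severitySurvival (ψ i) (x i)

theorem measurable_tailTransform {ψ : Fin d → ℝ → ℝ} (hψ : ∀ i, IsSeverityDensity (ψ i))
    (c : Fin d → ℝ) : Measurable (tailTransform ψ c) :=
  measurable_pi_lambda _ fun i => measurable_const.mul
    ((severitySurvival_antitone (hψ i)).measurable.comp (measurable_pi_apply i))

/-- The factors of the density on the face `I`. -/
noncomputable def faceWeight (ψ : Fin d → ℝ → ℝ) (c : Fin d → ℝ) (I : Finset (Fin d)) (i : Fin d) :
    ℝ → ENNReal := if i ∈ I then severityWeight (c i) (ψ i) else fun _ => 1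

theorem measurable_faceWeight {ψ : Fin d → ℝ → ℝ} (hψ : ∀ i, IsSeverityDensity (ψ i))
    (c : Fin d → ℝ) (I : Finset (Fin d)) (i : Fin d) : Measurable (faceWeight ψ c I i) := by
  unfold faceWeight
  split_ifs
  · exact measurable_severityWeight (hψ i) _
  · exact measurable_const

instance (ψ : Fin d → ℝ → ℝ) (c : Fin d → ℝ) (I : Finset (Fin d)) (i : Fin d) :
    SigmaFinite ((claimMarginal I i).withDensity (faceWeight ψ c I i)) := by
  unfold faceWeight
  split_ifs
  · exact SigmaFinite.withDensity_ofReal _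
  · rw [show (fun _ : ℝ => (1 : ENNReal)) = 1 from rfl, withDensity_one]
    infer_instance

/-- A measurable version of the density `ζ(x) ∏_{i ∈ S(x)} λᵢ ψᵢ(xᵢ)` of the Lévy measure. -/
noncomputable def levyDensity (κ : Measure (Fin d → ℝ)) (ψ : Fin d → ℝ → ℝ) (c : Fin d → ℝ)
    (x : Fin d → ℝ) : ENNReal :=
  ∑ I ∈ Finset.univ.filter (fun I : Finset (Fin d) => I.Nonempty),
    Set.indicator (claimFace I) (fun x => ENNReal.ofReal (faceDensity κ I (tailTransform ψ c x)) *
      ∏ i, faceWeight ψ c I i (x i)) x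

theorem IsTailRegular.measurable_levyDensity {κ : Measure (Fin d → ℝ)} (hκ : IsCopulaLaw κ)
    (hreg : IsTailRegular κ) {ψ : Fin d → ℝ → ℝ} (hψ : ∀ i, IsSeverityDensity (ψ i))
    (c : Fin d → ℝ) : Measurable (levyDensity κ ψ c) := by
  refine Finset.measurable_fun_sum _ fun I hI => ?_
  refine Measurable.indicator (Measurable.mul ?_ ?_) (measurableSet_claimFace I)
  · exact ((hreg.measurable_faceDensity hκ (Finset.mem_filter.1 hI).2).comp
      (measurable_tailTransform hψ c)).ennreal_ofReal
  · exact Finset.measurable_fun_prod _ fun i _ =>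
      (measurable_faceWeight hψ c I i).comp (measurable_pi_apply i)

theorem levyDensity_of_mem {κ : Measure (Fin d → ℝ)} (ψ : Fin d → ℝ → ℝ) (c : Fin d → ℝ)
    {I : Finset (Fin d)} (hI : I.Nonempty) {x : Fin d → ℝ} (hx : x ∈ claimFace I) :
    levyDensity κ ψ c x = ENNReal.ofReal (faceDensity κ I (tailTransform ψ c x)) *
      ∏ i, faceWeight ψ c I i (x i) := by
  rw [levyDensity, Finset.sum_eq_single_of_mem I (Finset.mem_filter.2 ⟨Finset.mem_univ _, hI⟩),
    Set.indicator_of_mem hx]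
  intro K _ hKI
  refine Set.indicator_of_notMem (fun h => hKI ?_) _
  rw [← activeSet_of_mem_claimFace h, activeSet_of_mem_claimFace hx]

/-- The density is non-negative: on the face `I`, the factor `ζ` is a mixed derivative of `H_I`
unless one of the severity densities vanishes. -/
theorem IsTailRegular.zeta_mul_nonneg_and_levyDensity_eq {κ : Measure (Fin d → ℝ)}
    (hκ : IsCopulaLaw κ)
    (hreg : IsTailRegular κ) {ψ : Fin d → ℝ → ℝ} (hψ : ∀ i, IsSeverityDensity (ψ i))
    {lam : Finset (Fin d) → ℝ} (hlam : ∀ i, 0 < intensity lam i) {x : Fin d → ℝ}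
    (hx : ∀ i, 0 ≤ x i) (hne : (activeSet x).Nonempty) :
    0 ≤ zeta κ ψ lam x * ∏ i ∈ activeSet x, intensity lam i * ψ i (x i) ∧
    ((∀ i ∈ activeSet x, 0 < ψ i (x i)) → 0 ≤ zeta κ ψ lam x) ∧
    levyDensity κ ψ (intensity lam) x = ENNReal.ofReal
      (zeta κ ψ lam x * ∏ i ∈ activeSet x, intensity lam i * ψ i (x i)) := by
  have hface := mem_claimFace_activeSet hx
  rw [levyDensity_of_mem ψ _ hne hface]
  have hw : ∏ i, faceWeight ψ (intensity lam) (activeSet x) i (x i)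
      = ENNReal.ofReal (∏ i ∈ activeSet x, intensity lam i * ψ i (x i)) := by
    rw [ENNReal.ofReal_prod_of_nonneg fun i hi =>
      mul_nonneg (hlam i).le ((hψ i).nonneg _ (mem_activeSet.1 hi)),
      ← Finset.prod_subset (Finset.subset_univ (activeSet x))]
    · refine Finset.prod_congr rfl fun i hi => ?_
      have hi0 : x i ∈ Set.Ioi (0 : ℝ) := mem_activeSet.1 hi
      rw [faceWeight, if_pos hi, severityWeight, Set.indicator_of_mem hi0]
    · intro i _ hi
      rw [faceWeight, if_neg hi]
  rw [hw]
  by_cases hpos : ∀ i ∈ activeSet x, 0 < ψ i (x i)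
  · have hu : ∀ i, 0 < tailTransform ψ (intensity lam) x i := by
      intro i
      refine mul_pos (hlam i) ?_
      by_cases hi : i ∈ activeSet x
      · exact severitySurvival_pos (hψ i) (mem_activeSet.1 hi) (hpos i hi)
      · rw [eq_zero_of_notMem_activeSet hx hi, severitySurvival_zero]; exact one_pos
    have hu' : tailTransform ψ (intensity lam) x ∈ {u : Fin d → ℝ | ∀ i, 0 < u i} := hu
    have hz : faceDensity κ (activeSet x) (tailTransform ψ (intensity lam) x)
        = zeta κ ψ lam x := by
      rw [faceDensity, Set.indicator_of_mem hu', hreg.mixedPartial_faceTail hκ subset_rfl hu]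
      rfl
    have hz0 : 0 ≤ zeta κ ψ lam x := by
      rw [← hz, faceDensity, Set.indicator_of_mem hu']
      exact hreg.mixedPartial_faceTail_nonneg hκ hne hu
    have hp0 : 0 ≤ ∏ i ∈ activeSet x, intensity lam i * ψ i (x i) :=
      Finset.prod_nonneg fun i hi => (mul_pos (hlam i) (hpos i hi)).le
    refine ⟨mul_nonneg hz0 hp0, fun _ => hz0, ?_⟩
    rw [hz, ENNReal.ofReal_mul hz0]
  · have hzero : ∏ i ∈ activeSet x, intensity lam i * ψ i (x i) = 0 := by
      push Not at hpos
      obtain ⟨i, hi, hi0⟩ := hpos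
      refine Finset.prod_eq_zero hi ?_
      rw [le_antisymm hi0 ((hψ i).nonneg _ (mem_activeSet.1 hi)), mul_zero]
    rw [hzero]
    simp [hpos]

theorem lintegral_faceDensity_tailTransform {κ : Measure (Fin d → ℝ)} (hκ : IsCopulaLaw κ)
    (hreg : IsTailRegular κ) {ψ : Fin d → ℝ → ℝ} (hψ : ∀ i, IsSeverityDensity (ψ i))
    {c : Fin d → ℝ} (hc : ∀ i, 0 < c i) {I : Finset (Fin d)} (hI : I.Nonempty)
    {a : Fin d → ℝ} (ha : ∀ i, 0 ≤ a i) (haI : ∀ i ∉ I, a i = 0) :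
    ∫⁻ x in {x | ∀ i ∈ I, a i < x i}, ENNReal.ofReal (faceDensity κ I (tailTransform ψ c x)) *
        ∏ i, faceWeight ψ c I i (x i) ∂(Measure.pi (claimMarginal I))
      = ENNReal.ofReal (faceTail κ I (tailTransform ψ c a)) := by
  let S : Fin d → Set ℝ := fun i => if i ∈ I then Set.Ioi (a i) else Set.univ
  have hS : {u : Fin d → ℝ | ∀ i ∈ I, a i < u i} = Set.univ.pi S := by
    ext u
    simp only [Set.mem_ofPred_eq, Set.mem_pi, Set.mem_univ, true_imp_iff, S]
    refine forall_congr' fun i => ?_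
    by_cases hi : i ∈ I <;> simp [hi]
  have hSm : MeasurableSet (Set.univ.pi S) := by
    rw [← hS]
    exact (isOpen_setOf_forall_mem (A := fun i => Set.Ioi (a i)) fun _ => isOpen_Ioi).measurableSet
  have hfm : Measurable fun u => ENNReal.ofReal (faceDensity κ I u) :=
    (hreg.measurable_faceDensity hκ hI).ennreal_ofReal
  have hT := measurable_tailTransform hψ c
  have hwm : Measurable fun x : Fin d → ℝ => ∏ i, faceWeight ψ c I i (x i) :=
    Finset.measurable_fun_prod _ fun i _ =>
      (measurable_faceWeight hψ c I i).comp (measurable_pi_apply i)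
  have hmap : ∀ i, (((claimMarginal I i).withDensity (faceWeight ψ c I i)).restrict (S i)).map
      (fun y => c i * severitySurvival (ψ i) y) = faceBox I (tailTransform ψ c a) i := by
    intro i
    have hmi : Measurable fun y => c i * severitySurvival (ψ i) y :=
      measurable_const.mul (severitySurvival_antitone (hψ i)).measurable
    by_cases hi : i ∈ I
    · simp only [claimMarginal, faceWeight, S, faceBox, hi, if_true]
      exact map_severitySurvival (hψ i) (hc i) (ha i)
    · simp only [claimMarginal, faceWeight, S, faceBox, hi, if_false, Measure.restrict_univ]
      rw [show (fun _ : ℝ => (1 : ENNReal)) = 1 from rfl, withDensity_one,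
        Measure.map_dirac' hmi, tailTransform, haI i hi]
  have hsf : ∀ i, SigmaFinite ((((claimMarginal I i).withDensity
      (faceWeight ψ c I i)).restrict (S i)).map
      (fun y => c i * severitySurvival (ψ i) y)) := by
    intro i; rw [hmap i]; infer_instance
  have hpush : (((Measure.pi (claimMarginal I)).withDensity fun x =>
      ∏ i, faceWeight ψ c I i (x i)).restrict (Set.univ.pi S)).map (tailTransform ψ c)
      = Measure.pi (faceBox I (tailTransform ψ c a)) := by
    rw [pi_withDensity _ (measurable_faceWeight hψ c I), Measure.restrict_pi_pi]
    have := Measure.pi_map_pi (μ := fun i => ((claimMarginal I i).withDensity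
      (faceWeight ψ c I i)).restrict (S i)) (f := fun i y => c i * severitySurvival (ψ i) y)
      (fun i => (measurable_const.mul (severitySurvival_antitone (hψ i)).measurable).aemeasurable)
    simp only [hmap] at this
    exact this
  have hb : ∀ i, 0 ≤ tailTransform ψ c a i := fun i =>
    mul_nonneg (hc i).le (severitySurvival_nonneg (hψ i) (ha i))
  have hbI : ∀ i ∉ I, 0 < tailTransform ψ c a i := by
    intro i hi
    rw [tailTransform, haI i hi, severitySurvival_zero, mul_one]
    exact hc i
  rw [← hreg.lintegral_faceDensity hκ hI hb hbI, ← hpush, lintegral_map hfm hT,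
    restrict_withDensity hSm, hS]
  refine Eq.trans ?_ (lintegral_withDensity_eq_lintegral_mul _ hwm (hfm.comp hT)).symm
  refine lintegral_congr fun x => ?_
  rw [Pi.mul_apply, Function.comp_apply, mul_comm]

/-- The measure with density `ζ ∏ λᵢ ψᵢ` with respect to the reference measure. -/
noncomputable def levyMeasure (κ : Measure (Fin d → ℝ)) (ψ : Fin d → ℝ → ℝ) (c : Fin d → ℝ) :
    Measure (Fin d → ℝ) := (claimReference d).withDensity (levyDensity κ ψ c)

theorem IsTailRegular.levyMeasure_tail {κ : Measure (Fin d → ℝ)} (hκ : IsCopulaLaw κ)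
    (hreg : IsTailRegular κ) {ψ : Fin d → ℝ → ℝ} (hψ : ∀ i, IsSeverityDensity (ψ i))
    {c : Fin d → ℝ} (hc : ∀ i, 0 < c i) (J : Finset (Fin d)) {a : Fin d → ℝ}
    (ha : ∀ i, 0 ≤ a i) (haJ : ∀ i ∉ J, a i = 0) :
    levyMeasure κ ψ c {x | ∀ j ∈ J, a j < x j}
      = ∑ I ∈ Finset.univ.filter (fun I : Finset (Fin d) => I.Nonempty ∧ J ⊆ I),
        ENNReal.ofReal (faceTail κ I (tailTransform ψ c a)) := by
  have hm : MeasurableSet {x : Fin d → ℝ | ∀ j ∈ J, a j < x j} :=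
    (isOpen_setOf_forall_mem (A := fun i => Set.Ioi (a i)) fun _ => isOpen_Ioi).measurableSet
  rw [levyMeasure, claimReference_eq, withDensity_finsetSum, Measure.finsetSum_apply,
    ← Finset.filter_filter, Finset.sum_filter (fun I => J ⊆ I)]
  refine Finset.sum_congr rfl fun I hI => ?_
  have hne := (Finset.mem_filter.1 hI).2
  rw [withDensity_apply _ hm]
  split_ifs with hJI
  · rw [← lintegral_faceDensity_tailTransform hκ hreg hψ hc hne ha fun i hi =>
      haJ i fun h => hi (hJI h)]
    have hset : ({x : Fin d → ℝ | ∀ j ∈ J, a j < x j} : Set (Fin d → ℝ))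
        =ᵐ[Measure.pi (claimMarginal I)] {x | ∀ i ∈ I, a i < x i} := by
      filter_upwards [ae_mem_claimFace I] with x hx
      apply propext
      change (∀ j ∈ J, a j < x j) ↔ ∀ i ∈ I, a i < x i
      refine ⟨fun h i hi => ?_, fun h j hj => h j (hJI hj)⟩
      by_cases hiJ : i ∈ J
      · exact h i hiJ
      · rw [haJ i hiJ]; exact hx.1 i hi
    rw [setLIntegral_congr hset]
    refine lintegral_congr_ae (ae_restrict_of_ae ?_)
    filter_upwards [ae_mem_claimFace I] with x hx
    exact levyDensity_of_mem ψ c hne hx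
  · obtain ⟨j, hj, hjI⟩ := Finset.not_subset.1 hJI
    have hset : (Measure.pi (claimMarginal I)) {x : Fin d → ℝ | ∀ j ∈ J, a j < x j} = 0 := by
      have : ∀ᵐ x ∂(Measure.pi (claimMarginal I)), ¬ (∀ j ∈ J, a j < x j) := by
        filter_upwards [ae_mem_claimFace I] with x hx h
        have h1 := h j hj
        rw [hx.2 j hjI] at h1
        exact h1.not_ge (ha j)
      rw [ae_iff] at this
      simpa using this
    rw [Measure.restrict_eq_zero.2 hset, lintegral_zero_measure]

theorem IsTailRegular.isLevyMeasureOf_levyMeasure {κ : Measure (Fin d → ℝ)} (hκ : IsCopulaLaw κ)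
    (hreg : IsTailRegular κ) {ψ : Fin d → ℝ → ℝ} (hψ : ∀ i, IsSeverityDensity (ψ i))
    {lam : Finset (Fin d) → ℝ} (hlam : ∀ i, 0 < intensity lam i) :
    IsLevyMeasureOf κ ψ lam (levyMeasure κ ψ (intensity lam)) where
  finite := by
    refine ⟨?_⟩
    have h := hreg.levyMeasure_tail hκ hψ hlam ∅ (a := fun _ => 0) (fun _ => le_rfl)
      (fun _ _ => rfl)
    simp only [Finset.notMem_empty, false_imp_iff, implies_true] at h
    rw [show (Set.univ : Set (Fin d → ℝ)) = {x | True} from by ext; simp, h]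
    exact ENNReal.sum_lt_top.2 fun _ _ => ENNReal.ofReal_lt_top
  carrier := by
    have h := (withDensity_absolutelyContinuous (claimReference d)
      (levyDensity κ ψ (intensity lam))).ae_le (ae_claimReference d)
    filter_upwards [h] with x hx
    refine ⟨hx.1, ?_⟩
    rintro rfl
    obtain ⟨i, hi⟩ := hx.2
    exact lt_irrefl _ (mem_activeSet.1 hi)
  tail := by
    intro J hJ a ha
    let a' : Fin d → ℝ := fun i => if i ∈ J then a i else 0
    have ha' : ∀ i, 0 ≤ a' i := by
      intro i
      simp only [a']
      split_ifs
      · exact ha i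
      · exact le_rfl
    have haJ : ∀ i ∉ J, a' i = 0 := fun i hi => by simp [a', hi]
    have hset : {x : Fin d → ℝ | ∀ j ∈ J, a j < x j} = {x | ∀ j ∈ J, a' j < x j} := by
      ext x
      exact forall₂_congr fun j hj => by simp [a', hj]
    have hfilter : Finset.univ.filter (fun I : Finset (Fin d) => I.Nonempty ∧ J ⊆ I)
        = Finset.univ.filter (fun I : Finset (Fin d) => J ⊆ I) := by
      ext I
      simp only [Finset.mem_filter, Finset.mem_univ, true_and]
      exact ⟨fun h => h.2, fun h => ⟨hJ.mono h, h⟩⟩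
    have hb : ∀ i, 0 ≤ tailTransform ψ (intensity lam) a' i := fun i =>
      mul_nonneg (hlam i).le (severitySurvival_nonneg (hψ i) (ha' i))
    rw [Measure.real, hset, hreg.levyMeasure_tail hκ hψ hlam J ha' haJ, hfilter,
      ENNReal.toReal_sum fun _ _ => ENNReal.ofReal_ne_top]
    rw [Finset.sum_congr rfl fun I hI => ENNReal.toReal_ofReal (hreg.faceTail_nonneg hκ
      (hJ.mono (Finset.mem_filter.1 hI).2) hb fun i hi => ?_), sum_faceTail]
    · refine levyCopula_congr κ fun j hj => ?_
      simp [tailTransform, a', hj]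
    · have hiJ : i ∉ J := fun h => hi ((Finset.mem_filter.1 hI).2 h)
      rw [tailTransform, haJ i hiJ, severitySurvival_zero, mul_one]
      exact hlam i

/-! ### Uniqueness of the Lévy measure -/

theorem IsLevyMeasureOf.sum_activeProb {κ : Measure (Fin d → ℝ)} {ψ : Fin d → ℝ → ℝ}
    {lam : Finset (Fin d) → ℝ} {ν : Measure (Fin d → ℝ)} (hν : IsLevyMeasureOf κ ψ lam ν)
    {J : Finset (Fin d)} (hJ : J.Nonempty) :
    ∑ I ∈ Finset.univ.filter (fun I => J ⊆ I), activeProb ν I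
      = levyCopula κ J (intensity lam) := by
  have := hν.finite
  rw [← measureReal_forall_pos_eq_sum ν (hν.carrier.mono fun x hx => hx.1),
    hν.tail J hJ (fun _ => 0) (fun _ => le_rfl)]
  simp [severitySurvival_zero]

/-- A finite measure carried by the orthant without the origin has total mass `∑ λ_I` when its
faces have the masses `λ_I`. -/
theorem IsLevyMeasureOf.measureReal_univ {κ : Measure (Fin d → ℝ)} {ψ : Fin d → ℝ → ℝ}
    {lam : Finset (Fin d) → ℝ} {ν : Measure (Fin d → ℝ)} (hν : IsLevyMeasureOf κ ψ lam ν)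
    (h : ∀ I : Finset (Fin d), I.Nonempty → activeProb ν I = lam I) :
    ν.real Set.univ = ∑ I ∈ Finset.univ.filter (fun I : Finset (Fin d) => I.Nonempty), lam I := by
  have := hν.finite
  have h1 := measureReal_forall_pos_eq_sum ν (hν.carrier.mono fun x hx => hx.1) ∅
  simp only [Finset.notMem_empty, false_imp_iff, implies_true, Finset.empty_subset,
    Finset.filter_true] at h1
  have h0 : activeProb ν ∅ = 0 := by
    rw [activeProb, measureReal_eq_zero_iff]
    have : ∀ᵐ z ∂ν, ¬ ((∀ i ∈ (∅ : Finset (Fin d)), 0 < z i) ∧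
        ∀ j ∉ (∅ : Finset (Fin d)), z j = 0) := by
      filter_upwards [hν.carrier] with z hz hz0
      exact hz.2 (funext fun j => hz0.2 j (Finset.notMem_empty j))
    rw [ae_iff] at this
    simpa only [not_not] using this
  rw [show (Set.univ : Set (Fin d → ℝ)) = {x | True} from by ext; simp, h1,
    ← Finset.sum_filter_add_sum_filter_not Finset.univ (fun I : Finset (Fin d) => I.Nonempty),
    Finset.sum_congr rfl fun I hI => h I (Finset.mem_filter.1 hI).2]
  have h4 : Finset.univ.filter (fun I : Finset (Fin d) => ¬ I.Nonempty) = {∅} := by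
    ext I; simp [Finset.not_nonempty_iff_eq_empty]
  rw [h4, Finset.sum_singleton, h0, add_zero]

theorem IsLevyMeasureOf.eq {κ : Measure (Fin d → ℝ)} {ψ : Fin d → ℝ → ℝ}
    {lam : Finset (Fin d) → ℝ} {ν ν' : Measure (Fin d → ℝ)} (hν : IsLevyMeasureOf κ ψ lam ν)
    (hν' : IsLevyMeasureOf κ ψ lam ν') (huniv : ν.real Set.univ = ν'.real Set.univ) :
    ν = ν' := by
  have := hν.finite
  have := hν'.finite
  have hspan : IsCountablySpanning (Set.range (Set.Ioi : ℝ → Set ℝ)) := by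
    refine ⟨fun n => Set.Ioi (-(n : ℝ)), fun n => ⟨_, rfl⟩, ?_⟩
    ext y
    simp only [Set.mem_iUnion, Set.mem_Ioi, Set.mem_univ, iff_true]
    obtain ⟨n, hn⟩ := exists_nat_gt (-y)
    exact ⟨n, by linarith⟩
  have hgen : (MeasurableSpace.pi : MeasurableSpace (Fin d → ℝ)) = MeasurableSpace.generateFrom
      (Set.univ.pi '' Set.univ.pi fun _ : Fin d => Set.range (Set.Ioi : ℝ → Set ℝ)) := by
    have hb : (inferInstance : MeasurableSpace ℝ)
        = MeasurableSpace.generateFrom (Set.range (Set.Ioi : ℝ → Set ℝ)) :=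
      BorelSpace.measurable_eq.trans (borel_eq_generateFrom_Ioi ℝ)
    rw [← generateFrom_pi_eq fun _ : Fin d => hspan]
    congr 1
    funext _
    exact hb
  -- on the carrier, the constraints `a_j < x_j` with `a_j < 0` are void
  have hred : ∀ {μ : Measure (Fin d → ℝ)}, IsLevyMeasureOf κ ψ lam μ → ∀ a : Fin d → ℝ,
      μ.real (Set.univ.pi fun i => Set.Ioi (a i))
        = μ.real {x | ∀ j ∈ Finset.univ.filter (fun j => 0 ≤ a j), max (a j) 0 < x j} := by
    intro μ hμ a
    apply measureReal_congr
    filter_upwards [hμ.carrier] with x hx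
    apply propext
    change x ∈ Set.univ.pi (fun i => Set.Ioi (a i)) ↔ ∀ j ∈ _, max (a j) 0 < x j
    simp only [Set.mem_pi, Set.mem_univ, true_imp_iff, Set.mem_Ioi, Finset.mem_filter,
      Finset.mem_univ, true_and]
    refine forall_congr' fun j => ⟨fun h h0 => by rwa [max_eq_left h0], fun h => ?_⟩
    rcases le_or_gt 0 (a j) with h0 | h0
    · simpa [max_eq_left h0] using h h0
    · exact h0.trans_le (hx.1 j)
  refine ext_of_generate_finite _ hgen (IsPiSystem.pi fun _ => isPiSystem_Ioi) ?_ ?_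
  · rintro _ ⟨s, hs, rfl⟩
    choose a ha using fun i => hs i (Set.mem_univ i)
    obtain rfl : s = fun i => Set.Ioi (a i) := funext fun i => (ha i).symm
    rw [← measureReal_eq_measureReal_iff, hred hν a, hred hν' a]
    by_cases hJ : (Finset.univ.filter (fun j => 0 ≤ a j)).Nonempty
    · rw [hν.tail _ hJ _ fun i => le_max_right _ _, hν'.tail _ hJ _ fun i => le_max_right _ _]
    · rw [Finset.not_nonempty_iff_eq_empty] at hJ
      simp only [hJ, Finset.notMem_empty, false_imp_iff, implies_true]
      simpa using huniv
  · exact (measureReal_eq_measureReal_iff).1 huniv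

/-! ### Densities of Poisson point processes -/

theorem measurableEmbedding_sigmaMk {ι : Type*} {α : ι → Type*} [∀ i, MeasurableSpace (α i)]
    (i : ι) : MeasurableEmbedding (Sigma.mk i : α i → Σ i, α i) where
  injective := sigma_mk_injective
  measurable := fun s hs => MeasurableSpace.measurableSet_iInf.1 hs i
  measurableSet_image' := by
    intro s hs
    refine MeasurableSpace.measurableSet_iInf.2 fun j => ?_
    change MeasurableSet (Sigma.mk j ⁻¹' (Sigma.mk i '' s))
    by_cases hij : i = j
    · subst hij
      rwa [Set.preimage_image_eq _ sigma_mk_injective]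
    · convert MeasurableSet.empty
      ext y
      simp only [Set.mem_preimage, Set.mem_image, Sigma.mk.injEq, Set.mem_empty_iff_false,
        iff_false, not_exists, not_and]
      intro _ _ h
      exact absurd h hij

theorem measurable_of_forall_sigmaMk {ι β : Type*} {α : ι → Type*} [∀ i, MeasurableSpace (α i)]
    [MeasurableSpace β] {f : (Σ i, α i) → β} (hf : ∀ i, Measurable fun a => f ⟨i, a⟩) :
    Measurable f :=
  fun _ hs => MeasurableSpace.measurableSet_iInf.2 fun i => hf i hs

theorem map_withDensity_comp {α β : Type*} [MeasurableSpace α] [MeasurableSpace β] (μ : Measure α)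
    {g : α → β} (hg : Measurable g) {f : β → ENNReal} (hf : Measurable f) :
    (μ.map g).withDensity f = (μ.withDensity fun a => f (g a)).map g := by
  ext s hs
  rw [withDensity_apply _ hs, Measure.map_apply hg hs, withDensity_apply _ (hg hs),
    setLIntegral_map hs hf hg]

theorem ae_configReference {E : Type*} [MeasurableSpace E] (χ : Measure E) [SigmaFinite χ]
    {Q : E → Prop} (hQ : ∀ᵐ e ∂χ, Q e) : ∀ᵐ ω ∂(configReference χ), ∀ k, Q (ω.2 k) := by
  rw [configReference, Measure.ae_sum_iff]
  intro n
  rw [(measurableEmbedding_sigmaMk n).ae_map_iff]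
  refine Measure.ae_smul_measure ?_ _
  exact eventually_all.2 fun k =>
    (Measure.tendsto_eval_ae_ae (μ := fun _ : Fin n => χ) (i := k)).eventually hQ

/-- The law of the Poisson process with intensity `g ρ` has density `e^{-∫ g dρ} ∏ g(x_k)` with
respect to the reference measure of `ρ`. -/
theorem poissonLaw_withDensity {E : Type*} [MeasurableSpace E] (ρ : Measure E) [SigmaFinite ρ]
    {g : E → ENNReal} (hg : Measurable g) [IsFiniteMeasure (ρ.withDensity g)] :
    poissonLaw (ρ.withDensity g) = (configReference ρ).withDensity (fun ω =>
      ENNReal.ofReal (Real.exp (-(ρ.withDensity g).real Set.univ)) * ∏ k, g (ω.2 k)) := by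
  set e := Real.exp (-(ρ.withDensity g).real Set.univ) with he
  have hp : ∀ n : ℕ, Measurable fun x : Fin n → E => ∏ k, g (x k) := fun n =>
    Finset.measurable_fun_prod _ fun k _ => hg.comp (measurable_pi_apply k)
  have hF : Measurable fun ω : (Σ n : ℕ, Fin n → E) => ENNReal.ofReal e * ∏ k, g (ω.2 k) :=
    measurable_of_forall_sigmaMk fun n => measurable_const.mul (hp n)
  rw [poissonLaw, configReference, withDensity_sum]
  congr 1
  funext n
  rw [map_withDensity_comp _ (measurableEmbedding_sigmaMk n).measurable hF,
    withDensity_smul_measure]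
  congr 1
  have h1 : (fun a : Fin n → E => ENNReal.ofReal e * ∏ k, g (a k))
      = ENNReal.ofReal e • fun a : Fin n → E => ∏ k, g (a k) := rfl
  have h2 := pi_withDensity (fun _ : Fin n => ρ) (w := fun _ => g) fun _ => hg
  rw [h1, withDensity_smul _ (hp n), h2, smul_smul, ← ENNReal.ofReal_mul (by positivity)]
  congr 2
  rw [one_div, div_eq_inv_mul]

instance (d : ℕ) : SigmaFinite (claimReference d) := by
  rw [claimReference_eq, ← Measure.sum_coe_finset]
  infer_instance

theorem IsTailRegular.compoundPoissonLaw_levyMeasure {κ : Measure (Fin d → ℝ)}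
    (hκ : IsCopulaLaw κ) (hreg : IsTailRegular κ) {ψ : Fin d → ℝ → ℝ}
    (hψ : ∀ i, IsSeverityDensity (ψ i)) {lam : Finset (Fin d) → ℝ}
    (hlam : ∀ i, 0 < intensity lam i) {T : ℝ} (hT : 0 < T)
    (huniv : (levyMeasure κ ψ (intensity lam)).real Set.univ
      = ∑ I ∈ Finset.univ.filter (fun I : Finset (Fin d) => I.Nonempty), lam I) :
    compoundPoissonLaw T (levyMeasure κ ψ (intensity lam)) = (eventReference T d).withDensity
        (fun ω => ENNReal.ofReal (levyLikelihood κ ψ lam T (fun k => (ω.2 k).2))) := by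
  have hfin := (hreg.isLevyMeasureOf_levyMeasure hκ hψ hlam).finite
  have hgm := hreg.measurable_levyDensity hκ hψ (intensity lam)
  have hprod : (volume.restrict (Set.Ioc 0 T)).prod (levyMeasure κ ψ (intensity lam))
      = ((volume.restrict (Set.Ioc 0 T)).prod (claimReference d)).withDensity
        (fun z => levyDensity κ ψ (intensity lam) z.2) :=
    prod_withDensity_right hgm
  have hmass : ((volume.restrict (Set.Ioc 0 T)).prod
      (levyMeasure κ ψ (intensity lam))).real Set.univ
      = T * ∑ I ∈ Finset.univ.filter (fun I : Finset (Fin d) => I.Nonempty), lam I := by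
    rw [← Set.univ_prod_univ, measureReal_prod_prod, huniv, measureReal_restrict_apply_univ,
      Real.volume_real_Ioc_of_le hT.le, sub_zero]
  have hfin' : IsFiniteMeasure (((volume.restrict (Set.Ioc 0 T)).prod
      (claimReference d)).withDensity fun z => levyDensity κ ψ (intensity lam) z.2) := by
    rw [← hprod]; infer_instance
  rw [compoundPoissonLaw, eventReference, hprod,
    poissonLaw_withDensity _ (g := fun z : ℝ × (Fin d → ℝ) => levyDensity κ ψ (intensity lam) z.2)
      (hgm.comp measurable_snd)]
  refine withDensity_congr_ae ?_
  have hae : ∀ᵐ z ∂((volume.restrict (Set.Ioc 0 T)).prod (claimReference d)),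
      (∀ i, 0 ≤ z.2 i) ∧ (activeSet z.2).Nonempty :=
    Measure.quasiMeasurePreserving_snd.ae (ae_claimReference d)
  filter_upwards [ae_configReference _ hae] with ω hω
  have hk := fun k => hreg.zeta_mul_nonneg_and_levyDensity_eq hκ hψ hlam (hω k).1 (hω k).2
  rw [levyLikelihood_eq κ ψ lam T fun k => (hω k).2, ENNReal.ofReal_mul (Real.exp_nonneg _),
    ENNReal.ofReal_prod_of_nonneg fun k _ => (hk k).1, ← hprod, hmass]
  congr 1
  exact Finset.prod_congr rfl fun k _ => (hk k).2.2

end CombBernoulli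

theorem mainTheorem3 {d : ℕ} (κ : Measure (Fin d → ℝ)) (hκ : IsCopulaLaw κ)
    (hreg : IsTailRegular κ)
    (ψ : Fin d → ℝ → ℝ) (hψ : ∀ i, IsSeverityDensity (ψ i))
    (T : ℝ) (hT : 0 < T)
    (lam : Finset (Fin d) → ℝ) (hlam : ∀ i, 0 < intensity lam i)
    (p : ℕ → Fin d → ℝ) (P : ℕ → Measure (Fin d → ℝ))
    (hP : ∀ᶠ N in atTop, IsCombBernoulli κ ψ (p N) (P N))
    (hscale : ∀ I : Finset (Fin d), I.Nonempty →
      Tendsto (fun N : ℕ => activeProb (P N) I / (T / N)) atTop (𝓝 (lam I))) :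
    -- the mixed derivatives of the Lévy copulas exist
    (∀ J I : Finset (Fin d), I ⊆ J → ∀ i ∈ J, (∀ j ∈ I, i < j) →
      ∀ u : Fin d → ℝ, (∀ j ∈ J, 0 < u j) →
      DifferentiableAt ℝ
        (fun s => mixedPartial I (levyCopula κ J) (Function.update u i s)) (u i)) ∧
    -- convergence of the likelihood and of the log-likelihood
    (∀ (n : ℕ) (t : Fin n → ℝ) (x : Fin n → Fin d → ℝ),
      (∀ k, t k ∈ Set.Ioc 0 T) → Function.Injective t →
      (∀ k i, 0 ≤ x k i) → (∀ k, (activeSet (x k)).Nonempty) →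
      (∀ k, ∀ i ∈ activeSet (x k), 0 < ψ i (x k i)) →
      Tendsto (fun N : ℕ => seriesLikelihood (P N) (monitoredSeries T t x N) / (T / N) ^ n)
        atTop (𝓝 (levyLikelihood κ ψ lam T x)) ∧
      (∀ k, 0 ≤ zeta κ ψ lam (x k)) ∧
      ((∀ k, 0 < zeta κ ψ lam (x k)) →
        Real.log (levyLikelihood κ ψ lam T x) = levyLogLikelihood κ ψ lam T x ∧
        Tendsto
          (fun N : ℕ => seriesLogLikelihood (P N) (monitoredSeries T t x N)
            - n * Real.log (T / N))
          atTop (𝓝 (levyLogLikelihood κ ψ lam T x)))) ∧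
    -- the limit is the likelihood of the compound Poisson model built from the Lévy copula
    (∃! ν : Measure (Fin d → ℝ), IsLevyMeasureOf κ ψ lam ν) ∧
    (∀ ν : Measure (Fin d → ℝ), IsLevyMeasureOf κ ψ lam ν →
      (∀ I : Finset (Fin d), I.Nonempty →
        ν.real {z | (∀ i ∈ I, 0 < z i) ∧ ∀ j ∉ I, z j = 0} = lam I) ∧
      compoundPoissonLaw T ν = (eventReference T d).withDensity
        (fun ω => ENNReal.ofReal
          (levyLikelihood κ ψ lam T (fun k => (ω.2 k).2)))) := by
  have hν₀ := hreg.isLevyMeasureOf_levyMeasure hκ hψ hlam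
  have hface : ∀ ν : Measure (Fin d → ℝ), IsLevyMeasureOf κ ψ lam ν →
      ∀ I : Finset (Fin d), I.Nonempty → activeProb ν I = lam I := fun ν hν I hI =>
    eq_of_sum_superset_eq hI fun J hJ => by
      rw [hν.sum_activeProb hJ, sum_lam_eq_levyCopula hκ hreg hψ hT hlam hP hscale hJ]
  have huniq : ∀ ν : Measure (Fin d → ℝ), IsLevyMeasureOf κ ψ lam ν →
      ν = levyMeasure κ ψ (intensity lam) := fun ν hν => hν.eq hν₀ (by
    rw [hν.measureReal_univ (hface ν hν), hν₀.measureReal_univ (hface _ hν₀)])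
  refine ⟨fun J I hI i hi hlt u hu => hreg.mixedDiffOn_levyCopula hκ J I hI i hi hlt u hu, ?_,
    ⟨_, hν₀, huniq⟩, fun ν hν => ⟨hface ν hν, ?_⟩⟩
  · intro n t x ht hinj hx hne hxψ
    refine ⟨tendsto_seriesLikelihood hκ hreg hψ hT hlam hP hscale ht hinj hx hne hxψ, fun k =>
      (hreg.zeta_mul_nonneg_and_levyDensity_eq hκ hψ hlam (hx k) (hne k)).2.1 (hxψ k),
      fun hζ => ⟨?_,
        tendsto_seriesLogLikelihood hκ hreg hψ hT hlam hP hscale ht hinj hx hne hxψ hζ⟩⟩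
    have hpos : ∀ k, ∀ i ∈ activeSet (x k), 0 < intensity lam i * ψ i (x k i) :=
      fun k i hi => mul_pos (hlam i) (hxψ k i hi)
    rw [levyLikelihood_eq κ ψ lam T hne, levyLogLikelihood_eq κ ψ lam T hne hζ hpos,
      Real.log_mul (Real.exp_ne_zero _) (Finset.prod_pos fun k _ =>
        mul_pos (hζ k) (Finset.prod_pos (hpos k))).ne', Real.log_exp, Real.log_prod fun k _ =>
        (mul_pos (hζ k) (Finset.prod_pos (hpos k))).ne']
  · rw [huniq ν hν]
    exact hreg.compoundPoissonLaw_levyMeasure hκ hψ hlam hT (hν₀.measureReal_univ (hface _ hν₀))
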